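/- **Setting.** An operator-valued $C^*$-probability space $(\mathcal A,E,\mathcal B)$ consists of a unital $C^*$-algebra $\mathcal A$, a unital $C^*$-subalgebra $\mathcal B\subseteq\mathcal A$ and a completely positive conditional expectation $E:\mathcal A\to\mathcal B$ (so $E[b_1ab_2]=b_1E[a]b_2$ and $E[b]=b$). Let $\mathbb H^+(\mathcal B)$ be the set of $b\in\mathcal B$ for which $\operatorname{Im}(b)=\frac1{2i}(b-b^*)$ is positive and invertible, and let $G_a(b)=(b-a)^{-1}$. For $a\in\mathcal A$ let $\mathcal A_a$ be the set of finite sums of elements $b_0ab_1a\cdots ab_k$ with $k\ge1$, $b_i\in\mathcal B$. Elements $x_1,\dots,x_n$ are *monotone independent over $\mathcal B$* (in this order, $\mathcal A_{x_1}\prec\dots\prec\mathcal A_{x_n}$) if $E[a_1\cdots a_j\cdots a_m]=E[a_1\cdots a_{j-1}E[a_j]a_{j+1}\cdots a_m]$ whenever $a_k\in\mathcal A_{x_{i_k}}$ for all $k$ and $i_{j-1}<i_j>i_{j+1}$ (one inequality being dropped if $j=1$ or $j=m$, both if $m=1$). The *$\mathcal B$-distribution* of $a$ is the family of its moments $E[b_0ab_1\cdots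 ab_k]$, $k\ge 0$, $b_i\in\mathcal B$. For $\eta:\mathcal B\to\mathcal B$ completely positive, the *$\mathcal B$-valued arcsine distribution* $\nu_\eta$ is the distribution with moments $$\sum_{\pi\in NC_2(k)}\frac1{\tau(\pi)!}\,b_0\,\eta_\pi(b_1,\dots,b_{k-1})\,b_k$$ ($0$ for odd $k$), where $NC_2(k)$ is the set of non-crossing pair partitions of $\{1,\dots,k\}$, $\tau(\pi)!=\prod_{V\in\pi}\#\{W\in\pi: W\subseteq\{\min V,\dots,\max V\}\}$, and $b_0\eta_\pi(b_1,\dots,b_{k-1})b_k$ is obtained from $b_0ab_1\cdots ab_k$ by replacing, from the inside outwards, each pair $a\,c\,a$ prescribed by $\pi$ with $\eta(c)$. The *monotone convolution* $\mu\rhd\nu$ is the distribution of $x+y$ for $x\prec y$ monotone independent over $\mathcal B$ with distributions $\mu$ and $\nu$; explicitly, its moments are obtained by expanding $b_0(x+y)b_1\cdots(x+y)b_k$ into words in $x$ and $y$, replacing every maximal run $c_0yc_1\cdots yc_r$ by its $\nu$-moment, and applying $\mu$ to the resulting monomials in $x$. Finally $\mathrm{dil}_c(\mu)$ is the distribution of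 $ca$ if $a$ has distribution $\mu$. **Theorem.** Let $n\ge1$ and let $x_1,\dots,x_n$ be self-adjoint elements of an operator-valued $C^*$-probability space $(\mathcal A,E,\mathcal B)$ which are monotone independent over $\mathcal B$ and satisfy $E[x_j]=0$. Put $X_n=n^{-1/2}\sum_{j=1}^nx_j$, $\eta_j(b)=E[x_jbx_j]$, and $$\alpha_2=\max_j\|E[x_j^2]\|,\qquad \alpha_4=\max_j\sup_{b\in\mathcal B,\|b\|=1}\|E[x_jb^*x_j^2bx_j]\|,\qquad \widetilde\alpha_4=\max_j\|E[x_j^4]\|.$$ Let $A_n$ be a generalized arcsine element, that is, a self-adjoint element of $\mathcal A$, or of any other operator-valued $C^*$-probability space over $\mathcal B$ (whose conditional expectation is also denoted by $E$), with $\mathcal B$-distribution $\mathrm{dil}_{n^{-1/2}}(\nu_{\eta_1}\rhd\dots\rhd\nu_{\eta_n})$. Then, for every $b\in\mathbb H^+(\mathcal B)$, $$\big\|E[G_{X_n}(b)]-E[G_{A_n}(b)]\big\|\le\frac1{\sqrt n}\,\|\operatorname{Im}(b)^{-1}\|^4\sqrt{\alpha_2}\Big(\sqrt{\alpha_4}+\sqrt{\tfrac32\alpha_2^2}\Big).$$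 Moreover, there is a universal constant $c>0$ such that in the scalar case $\mathcal B=\mathbb C$ (where $E$ is a state $\varphi$) one always has $$L(\mu_{X_n},\mu_{A_n})\le c\,\Big(\alpha_2\big(\widetilde\alpha_4+\tfrac32\alpha_2^2\big)\Big)^{1/14}n^{-1/14},$$ where $\mu_a$ is the Borel probability measure on $\mathbb R$ with $\int f\,d\mu_a=\varphi(f(a))$ for $f$ continuous with compact support, and $L(\mu,\nu)=\inf\{\epsilon>0:\mu(-\infty,t-\epsilon]-\epsilon\le\nu(-\infty,t]\le\mu(-\infty,t+\epsilon]+\epsilon\ \ \forall t\in\mathbb R\}$ is the Lévy distance. -/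

import Mathlib

open scoped CStarAlgebra ComplexOrder ComplexStarModule CompactlySupported

noncomputable section

namespace OVProb

universe u v

/-- An operator-valued C*-probability space `(A, E, B)`: the C*-algebra `B` sits in the unital
C*-algebra `A` through the unital *-homomorphism `incl` (injective because of `E_incl`), and
`E : A → B` is a completely positive conditional expectation. -/
structure OVSpace (B : Type u) (A : Type v)
    [CStarAlgebra B] [PartialOrder B] [StarOrderedRing B]
    [CStarAlgebra A] [PartialOrder A] [StarOrderedRing A] where
  incl : B →⋆ₐ[ℂ] A
  E : A →CP B
  E_bimodule : ∀ (b₁ b₂ : B) (a : A), E (incl b₁ * a * incl b₂) = b₁ * E a * b₂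
  E_incl : ∀ b : B, E (incl b) = b

section Space

variable {B : Type u} {A : Type v}
  [CStarAlgebra B] [PartialOrder B] [StarOrderedRing B]
  [CStarAlgebra A] [PartialOrder A] [StarOrderedRing A]

/-- The monomial `b₀ x b₁ x b₂ ⋯ x b_k` of `A`, where `l = [b₁, …, b_k]`. -/
def OVSpace.monomial (P : OVSpace B A) (x : A) (b₀ : B) (l : List B) : A :=
  P.incl b₀ * (l.map fun b => x * P.incl b).prod

/-- The (possibly non-unital) `B`-bimodule algebra generated by `x`: finite sums of monomials
`b₀ x b₁ ⋯ x b_k` with `k ≥ 1`. -/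
def OVSpace.bimoduleAlg (P : OVSpace B A) (x : A) : Submodule ℂ A :=
  Submodule.span ℂ {a | ∃ (b₀ : B) (l : List B), l ≠ [] ∧ a = P.monomial x b₀ l}

/-- Monotone independence over `B` of `x 0 ≺ x 1 ≺ ⋯ ≺ x (n - 1)`: in a product of elements
`a_j` of the bimodule algebras generated by `x (i_j)`, a factor `a` whose index `i` is strictly
larger than the indices of its neighbours (at an end of the product: of its only neighbour) may
be replaced by `E a`. The factors to the left and to the right of `a` are listed, with their
indices, in `L` and `R`. -/
def OVSpace.MonotoneIndep (P : OVSpace B A) {n : ℕ} (x : Fin n → A) : Prop :=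
  ∀ (L R : List (Fin n × A)) (i : Fin n) (a : A),
    (∀ p ∈ L, p.2 ∈ P.bimoduleAlg (x p.1)) → (∀ p ∈ R, p.2 ∈ P.bimoduleAlg (x p.1)) →
    a ∈ P.bimoduleAlg (x i) →
    (∀ p ∈ L.getLast?, p.1 < i) → (∀ p ∈ R.head?, p.1 < i) →
    P.E ((L.map Prod.snd).prod * a * (R.map Prod.snd).prod) =
      P.E ((L.map Prod.snd).prod * P.incl (P.E a) * (R.map Prod.snd).prod)

/-- The resolvent `G_x(b) = (b - x)⁻¹`. -/
def OVSpace.resolvent (P : OVSpace B A) (x : A) (b : B) : A :=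
  Ring.inverse (P.incl b - x)

/-- The operator-valued Cauchy transform `b ↦ E[G_x(b)]`. -/
def OVSpace.cauchy (P : OVSpace B A) (x : A) (b : B) : B :=
  P.E (P.resolvent x b)

/-- The operator-valued upper half plane: `Im b` is positive and invertible. -/
def upperHalfPlane (B : Type u) [CStarAlgebra B] [PartialOrder B] : Set B :=
  {b | IsStrictlyPositive (ℑ b : B)}

/-- The variance `b ↦ E[x b x]` of a centered element `x`. -/
def OVSpace.variance (P : OVSpace B A) (x : A) (b : B) : B :=
  P.E (x * P.incl b * x)

/-- `α₂(x) = max_i ‖E[x_i²]‖`. -/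
def OVSpace.alpha2 (P : OVSpace B A) {n : ℕ} (x : Fin n → A) : ℝ :=
  ⨆ i, ‖P.E (x i ^ 2)‖

/-- `α₄(x) = max_i sup_{‖b‖ = 1} ‖E[x_i b* x_i² b x_i]‖`. -/
def OVSpace.alpha4 (P : OVSpace B A) {n : ℕ} (x : Fin n → A) : ℝ :=
  ⨆ i, ⨆ b : Metric.sphere (0 : B) 1,
    ‖P.E (x i * star (P.incl b) * x i ^ 2 * P.incl b * x i)‖

/-- `α̃₄(x) = max_i ‖E[x_i⁴]‖`. -/
def OVSpace.alpha4Tilde (P : OVSpace B A) {n : ℕ} (x : Fin n → A) : ℝ :=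
  ⨆ i, ‖P.E (x i ^ 4)‖

end Space

/-! Operator-valued distributions. -/

/-- A `B`-valued (algebraic) distribution, recorded by its moments: for `l = [b₁, …, b_k]`, the
value at `b₀`, `l` is the moment which for an element `x` reads `E[b₀ x b₁ x b₂ ⋯ x b_k]`. -/
abbrev Law (B : Type u) : Type u := B → List B → B

/-- The `B`-distribution of an element `x`. -/
def OVSpace.law {B : Type u} {A : Type v}
    [CStarAlgebra B] [PartialOrder B] [StarOrderedRing B]
    [CStarAlgebra A] [PartialOrder A] [StarOrderedRing A]
    (P : OVSpace B A) (x : A) : Law B :=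
  fun b₀ l => P.E (P.monomial x b₀ l)

/-- Pair partitions of `{0, …, k - 1}` as fixed-point-free involutions `σ` (the blocks are the sets
`{i, σ i}`); non-crossing: there are no `i < j < σ i < σ j`. -/
def IsNCPairing {k : ℕ} (σ : Fin k → Fin k) : Prop :=
  (∀ i, σ i ≠ i) ∧ (∀ i, σ (σ i) = i) ∧ ∀ i j, i < j → j < σ i → ¬ σ i < σ j

open Classical in
/-- The set `NC₂(k)` of non-crossing pair partitions (empty for odd `k`). -/
def ncPairings (k : ℕ) : Finset (Fin k → Fin k) :=
  Finset.univ.filter IsNCPairing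

/-- `τ(π)!`, the product over the blocks `V` of the number of blocks contained in the interval
`{min V, …, max V}`. A block is indexed here by its minimum, a point `i` with `i < σ i`. -/
def treeFactorial {k : ℕ} (σ : Fin k → Fin k) : ℕ :=
  ∏ i : Fin k with i < σ i, (Finset.univ.filter fun j : Fin k => j < σ j ∧ i ≤ j ∧ σ j ≤ σ i).card

/-- The nested evaluation of `b_s x b_{s+1} x ⋯ x b_e`, in which the `x` between `b_i` and `b_{i+1}`
has number `i`, and each pair `x c x` prescribed by the pairing `p` is replaced by `η(c)`: if `s` is
paired with `m`, the value is `b_s · η(value of b_{s+1} ⋯ b_m) · (value of b_{m+1} ⋯ b_e)`. -/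
def pairEval {B : Type u} [Mul B] (η : B → B) (b : ℕ → B) (p : ℕ → ℕ) (s e : ℕ) : B :=
  if _h : s < p s ∧ p s < e then
    b s * η (pairEval η b p (s + 1) (p s)) * pairEval η b p (p s + 1) e
  else b s
termination_by e - s

/-- The `B`-valued arcsine distribution `ν_η` with variance `η`:
`E[b₀ x b₁ ⋯ x b_k] = ∑_{π ∈ NC₂(k)} (1 / τ(π)!) b₀ η_π(b₁, …, b_{k-1}) b_k`. -/
def arcsineLaw {B : Type u} [CStarAlgebra B] (η : B → B) : Law B :=
  fun b₀ l => ∑ σ ∈ ncPairings l.length,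
    ((treeFactorial σ : ℂ)⁻¹) •
      pairEval η (fun j => (b₀ :: l).getD j 0)
        (fun i => if h : i < l.length then (σ ⟨i, h⟩ : ℕ) else i) 0 l.length

/-- Expansion of `(c₀ y r₁ ⋯ y r_j) z d₁ z d₂ ⋯ z d_m` for `z = x + y`, `r = [r₁, …, r_j]` and the
last argument `[d₁, …, d_m]`, into a sum over words in `x` and `y`. In every word, each maximal
run `c y ⋯ y d` (possibly without a `y`) is replaced by its `ν`-moment, and `μ` is then applied to
the resulting monomial in `x`. In the recursive step the first letter is `y` in the first summand,
and `x` in the second one. -/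
def convAux {B : Type u} [Add B] (ν : Law B) : Law B → B → List B → List B → B
  | μ, c₀, r, [] => μ (ν c₀ r) []
  | μ, c₀, r, d :: l =>
      convAux ν μ c₀ (r ++ [d]) l + convAux ν (fun e₀ es => μ (ν c₀ r) (e₀ :: es)) d [] l

/-- The monotone convolution `μ ▷ ν`: the distribution of `x + y` for `x ≺ y` monotone independent
over `B`, where `x` has distribution `μ` and `y` has distribution `ν`. -/
def monotoneConv {B : Type u} [Add B] (μ ν : Law B) : Law B :=
  fun b₀ l => convAux ν μ b₀ [] l

/-- The defining property of `▷`: if `x ≺ y` are monotone independent over `B`, then the distribution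
of `x + y` is the monotone convolution of the distributions of `x` and `y`. -/
theorem OVSpace.law_add {B : Type u} {A : Type v}
    [CStarAlgebra B] [PartialOrder B] [StarOrderedRing B]
    [CStarAlgebra A] [PartialOrder A] [StarOrderedRing A] (P : OVSpace B A) (x y : A) (h : P.MonotoneIndep ![x, y]) :
    P.law (x + y) = monotoneConv (P.law x) (P.law y) := by
  have mono_append : ∀ (a : A) (c : B) (r : List B) (d : B),
      P.monomial a c (r ++ [d]) = P.monomial a c r * (a * P.incl d) := by
    intro a c r d
    simp [OVSpace.monomial, mul_assoc]
  have mem : ∀ (a : A) (c : B) (r : List B), r ≠ [] → P.monomial a c r ∈ P.bimoduleAlg a :=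
    fun a c r hr => Submodule.subset_span ⟨c, r, hr, rfl⟩
  have mem1 : ∀ (a : A) (d : B), a * P.incl d ∈ P.bimoduleAlg a := by
    intro a d
    simpa [OVSpace.monomial] using mem a 1 [d] (by simp)
  -- replacing a `y`-run between `W` and a right factor which starts with `x`
  have run : ∀ (L : List (Fin 2 × A)) (c : B) (r : List B),
      (∀ p ∈ L, p.1 = 0 ∧ p.2 ∈ P.bimoduleAlg x) →
      ∀ (l : List B) (R : List (Fin 2 × A)),
        (∀ p ∈ R, p.2 ∈ P.bimoduleAlg ((![x, y] : Fin 2 → A) p.1)) → (∀ p ∈ R.head?, p.1 = 0) →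
        (R = [] → l = []) →
        P.E ((L.map Prod.snd).prod * P.monomial y c r *
            ((R.map Prod.snd).prod * (l.map fun b => (x + y) * P.incl b).prod)) =
          P.E ((L.map Prod.snd).prod * P.incl (P.law y c r) *
            ((R.map Prod.snd).prod * (l.map fun b => (x + y) * P.incl b).prod)) := by
    intro L c r hL l
    induction l with
    | nil =>
      intro R hR hR0 _
      by_cases hr : r = []
      · subst hr
        simp [OVSpace.law, OVSpace.monomial, P.E_incl]
      · have := h L R 1 (P.monomial y c r) (fun p hp => by
          rw [(hL p hp).1]; exact (hL p hp).2) hR (mem y c r hr)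
          (fun p hp => by rw [(hL p (List.mem_of_getLast? hp)).1]; decide)
          (fun p hp => by rw [hR0 p hp]; decide)
        simpa [OVSpace.law] using this
    | cons d l ih =>
      intro R hR hR0 hne
      have hRne : R ≠ [] := fun e => by simpa using hne e
      have key : ∀ (i : Fin 2), _ := fun i => ih (R ++ [(i, (![x, y] : Fin 2 → A) i * P.incl d)])
        (fun p hp => by
          rcases List.mem_append.1 hp with hp | hp
          · exact hR p hp
          · simp only [List.mem_singleton] at hp
            subst hp
            exact mem1 _ d)
        (fun p hp => hR0 p (by
          cases R with
          | nil => exact absurd rfl hRne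
          | cons a R => simpa using hp)) (by simp)
      have k0 := key 0
      have k1 := key 1
      simp only [List.map_append, List.prod_append, List.map_cons, List.map_nil, List.prod_cons,
        List.prod_nil, mul_one, Matrix.cons_val_zero, Matrix.cons_val_one] at k0 k1
      simp only [List.map_cons, List.prod_cons, add_mul, mul_add, map_add, mul_assoc] at k0 k1 ⊢
      rw [k0, k1]
  have main : ∀ (l : List B) (L : List (Fin 2 × A)) (c : B) (r : List B),
      (∀ p ∈ L, p.1 = 0 ∧ p.2 ∈ P.bimoduleAlg x) →
      convAux (P.law y) (fun e es => P.E ((L.map Prod.snd).prod * P.monomial x e es)) c r l =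
        P.E ((L.map Prod.snd).prod * P.monomial y c r *
          (l.map fun b => (x + y) * P.incl b).prod) := by
    intro l
    induction l with
    | nil =>
      intro L c r hL
      have := run L c r hL [] [] (by simp) (by simp) (by simp)
      simp only [List.map_nil, List.prod_nil, mul_one] at this ⊢
      rw [this, convAux]
      simp [OVSpace.monomial]
    | cons d l ih =>
      intro L c r hL
      have r1 := run L c r hL l [(0, x * P.incl d)] (by simpa using mem1 x d) (by simp) (by simp)
      have i1 := ih (L ++ [(0, P.incl (P.law y c r) * x)]) d [] (by
        intro p hp
        rcases List.mem_append.1 hp with hp | hp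
        · exact hL p hp
        · simp only [List.mem_singleton] at hp
          subst hp
          refine ⟨rfl, ?_⟩
          simpa [OVSpace.monomial] using mem x (P.law y c r) [1] (by simp))
      rw [convAux, ih L c (r ++ [d]) hL, mono_append]
      simp only [List.map_append, List.prod_append, List.map_cons, List.map_nil, List.prod_cons,
        List.prod_nil, mul_one, OVSpace.monomial, mul_assoc] at i1 r1 ⊢
      rw [i1, add_mul, mul_add, mul_add, mul_add, map_add, r1, add_comm]
  funext c l
  have := main l [] c [] (by simp)
  simp only [List.map_nil, List.prod_nil, one_mul] at this
  rw [monotoneConv, show P.law x = fun e es => P.E (P.monomial x e es) from rfl, this]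
  simp [OVSpace.law, OVSpace.monomial]

/-- The distribution of the element `0`. -/
def diracZero {B : Type u} [Zero B] : Law B
  | b₀, [] => b₀
  | _, _ :: _ => 0

/-- The monotone convolution `ν 0 ▷ (ν 1 ▷ ⋯ ▷ ν (n - 1))`. -/
def monotoneConvFamily {B : Type u} [AddMonoid B] {n : ℕ} (ν : Fin n → Law B) : Law B :=
  (List.ofFn ν).foldr monotoneConv diracZero

/-- The dilation `dil_c μ`, the distribution of `c x` for `x` with distribution `μ`. -/
def dilation {B : Type u} [SMul ℝ B] (c : ℝ) (μ : Law B) : Law B :=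
  fun b₀ l => c ^ l.length • μ b₀ l

/-! Scalar distributions and the Lévy distance. -/

/-- The positive functional `f ↦ φ(f(a))` on compactly supported continuous functions, for a
self-adjoint `a` in a C*-probability space `(A, φ)`. -/
def functionalOf {A : Type v} [CStarAlgebra A] [PartialOrder A] [StarOrderedRing A]
    (P : OVSpace ℂ A) (a : A) : C_c(ℝ, ℝ) →ₚ[ℝ] ℝ :=
  PositiveLinearMap.mk₀
    { toFun := fun f => (P.E (cfc (⇑f) a)).re
      map_add' := fun f g => by
        have h : cfc (⇑(f + g)) a = cfc (⇑f) a + cfc (⇑g) a :=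
          cfc_add a (⇑f) (⇑g) f.continuous.continuousOn g.continuous.continuousOn
        rw [h, map_add, Complex.add_re]
      map_smul' := fun c f => by
        have h : cfc (⇑(c • f)) a = (c : ℂ) • cfc (⇑f) a := by
          rw [Complex.coe_smul]
          exact cfc_smul c (⇑f) a f.continuous.continuousOn
        rw [h, map_smul, smul_eq_mul, Complex.re_ofReal_mul]
        rfl }
    (fun f hf => by
      have h : 0 ≤ cfc (⇑f) a := cfc_nonneg fun t _ => hf t
      have h2 : 0 ≤ P.E (cfc (⇑f) a) := map_nonneg P.E h
      exact (Complex.nonneg_iff.mp h2).1)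

/-- The distribution `μ_a` of a self-adjoint `a` in a C*-probability space `(A, φ)`: the Borel
measure on `ℝ` with `∫ f dμ_a = φ(f(a))`, given by the Riesz-Markov-Kakutani theorem. -/
def scalarLaw {A : Type v} [CStarAlgebra A] [PartialOrder A] [StarOrderedRing A]
    (P : OVSpace ℂ A) (a : A) : MeasureTheory.Measure ℝ :=
  RealRMK.rieszMeasure (functionalOf P a)

/-- The Lévy distance, through the distribution functions `t ↦ μ (-∞, t]`. -/
def levyDist (μ ν : MeasureTheory.Measure ℝ) : ℝ :=
  sInf {ε : ℝ | 0 < ε ∧ ∀ t : ℝ,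
    μ.real (Set.Iic (t - ε)) - ε ≤ ν.real (Set.Iic t) ∧
      ν.real (Set.Iic t) ≤ μ.real (Set.Iic (t + ε)) + ε}

end OVProb

end

open OVProb

/-! The proof is a Lindeberg exchange in which a summand is not replaced by an arcsine element but
by a deformation of the argument of the Cauchy transform. For a positive map `η` let `flow η s` be
the time-`s` map of `w' = -η(w⁻¹)` on the upper half plane.

Arcsine side. Splitting a non-crossing pairing at its first block turns the tree factorial into a
weight `1/(i+1)`, which acts as an integration in time. Hence the generating function of `ν_η` is
`(flow η (r²) w)⁻¹` at `w⁻¹` (`IsPositiveMap.genFun_arcsineLaw`). Generating functions of monotone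
convolutions compose (`genFun_monotoneConv`), so the Cauchy transform of `A_n` is the inverse of the
composed flows of `η_1, …, η_n` applied to `b`. This holds for large imaginary part by power series,
and everywhere by analytic continuation (`OVSpace.cauchy_eq_inverse_foldr_flow`).

Exchange. Let `S` be a combination of the `x_i` with `i < j`, and `y` a multiple of `x_j`. The
resolvent `G` of `S` at `w` is `w⁻¹` plus a limit of words in lower letters. Monotone independence
therefore gives `E[GyG] = 0` and `E[GyGyG] = E[G η_y(w⁻¹) G]`. The last term is also the derivative
of `E[G]` when `w` moves along the flow. So adding `y` and flowing the argument agree to second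
order. The errors are a third order remainder, bounded by Cauchy-Schwarz through `α₂` and `α₄`
(`OVSpace.MonotoneIndep.norm_cauchy_add_sub_le`), and a second order remainder of the flow
(`OVSpace.norm_cauchy_flow_sub_le`). Telescoping over `j` ends at `E[G_0] = ` the inverse of the
composed flows, which is the transform of `A_n`.

The flow error carries `‖Im(b)⁻¹‖⁵ / n`. It is absorbed in the stated bound when `√(3/2) √α₂
‖Im(b)⁻¹‖ / √n ≤ 1`; otherwise the claim is weaker than the trivial estimate coming from the disc
that contains all Cauchy transforms.

Lévy distance. In the scalar case the real part of the Cauchy transform is integrated down a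
vertical line, which compares integrals of `arctan((t - x)/y)`, a smoothed step function. A bound `D
v⁻⁴` yields `L ≤ 3 D^(1/7)` (`levyDist_le_rpow`), and `D` of order `n^(-1/2)` gives the exponent
`1/14`. -/

namespace OVProb

universe u v

open scoped Ring

set_option linter.unusedSectionVars false

/-! ### Inverses on operator half spaces `Im c ≥ δ`. -/

section HalfSpace

variable {A : Type*} [CStarAlgebra A] [PartialOrder A] [StarOrderedRing A]

/-- The closed half space of elements whose imaginary part is at least `δ`. -/
def halfSpace (A : Type*) [CStarAlgebra A] [PartialOrder A] (δ : ℝ) : Set A :=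
  {c | algebraMap ℝ A δ ≤ (ℑ c : A)}

theorem sub_star_eq_smul_imaginaryPart (c : A) : c - star c = (2 * Complex.I) • (ℑ c : A) := by
  rw [imaginaryPart_apply_coe, smul_smul, ← Complex.coe_smul, smul_smul]
  have : 2 * Complex.I * -Complex.I * (((2⁻¹ : ℝ)) : ℂ) = 1 := by
    push_cast
    linear_combination (-1) * Complex.I_mul_I
  rw [this, one_smul]

theorem imaginaryPart_eq_of_sub_star {c q : A} (h : c - star c = (2 * Complex.I) • q) :
    (ℑ c : A) = q := by
  rw [sub_star_eq_smul_imaginaryPart] at h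
  exact (smul_right_injective A (by simp : (2 * Complex.I) ≠ 0)) h

theorem mem_halfSpace_iff {δ : ℝ} {c : A} :
    c ∈ halfSpace A δ ↔ algebraMap ℝ A δ ≤ (ℑ c : A) := Iff.rfl

theorem halfSpace_mono {δ δ' : ℝ} (h : δ ≤ δ') : halfSpace A δ' ⊆ halfSpace A δ := fun _ hc =>
  le_trans ((algebraMap_mono A) h) hc

theorem halfSpace_add_nonneg {δ : ℝ} {c d : A} (hc : c ∈ halfSpace A δ) (hd : 0 ≤ (ℑ d : A)) :
    c + d ∈ halfSpace A δ := by
  rw [mem_halfSpace_iff] at *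
  simpa using add_le_add hc hd

theorem isClosed_halfSpace (δ : ℝ) : IsClosed (halfSpace A δ) := by
  have : Continuous fun c : A => (ℑ c : A) := by
    simp only [imaginaryPart_apply_coe]
    fun_prop
  exact isClosed_le continuous_const this

/-- A large rotated dilation of the identity is close to `c`: `c = i l (1 - u)` with `u = 1 + (i/l)
c`. Here `u* u = 1 - (2/l) Im c + l⁻² c* c` drops below `1` for large `l`, because the negative
linear term beats the quadratic one. -/
theorem isUnit_of_mem_halfSpace {δ : ℝ} (hδ : 0 < δ) {c : A} (hc : c ∈ halfSpace A δ) :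
    IsUnit c := by
  obtain _ | _ := subsingleton_or_nontrivial A
  · exact isUnit_of_subsingleton c
  -- Any `l` with `2 δ l > ‖c‖²` would do; this one has `δ l = ‖c‖² + 1`.
  set l : ℝ := (‖c‖ ^ 2 + 1) / δ with hl
  have hlpos : 0 < l := by positivity
  set u : A := 1 + (Complex.I / l) • c with hu
  have h1 : star u * u = 1 - ((2 / l : ℝ) : ℂ) • (ℑ c : A) + ((1 / l ^ 2 : ℝ) : ℂ) • (star c * c) := by
    have e : c = star c + (2 * Complex.I) • (ℑ c : A) := by
      rw [← sub_star_eq_smul_imaginaryPart]; abel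
    have hs : star (Complex.I / l : ℂ) = -(Complex.I / l) := by simp [neg_div]
    have : star u * u = 1 + (Complex.I / l) • (c - star c) +
        (-(Complex.I / l) * (Complex.I / l)) • (star c * c) := by
      rw [hu, star_add, star_one, star_smul, hs]
      simp only [add_mul, mul_add, one_mul, mul_one, smul_mul_smul_comm, smul_sub, neg_smul,
        neg_mul]
      abel
    rw [this, sub_star_eq_smul_imaginaryPart, smul_smul]
    have e1 : Complex.I / l * (2 * Complex.I) = -((2 / l : ℝ) : ℂ) := by
      push_cast
      linear_combination (2 / l : ℂ) * Complex.I_mul_I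
    have e2 : -(Complex.I / l) * (Complex.I / l) = ((1 / l ^ 2 : ℝ) : ℂ) := by
      push_cast
      linear_combination (-1 / l ^ 2 : ℂ) * Complex.I_mul_I
    rw [e1, e2, neg_smul]
    abel
  have h2 : star u * u ≤ algebraMap ℝ A (1 - 2 * δ / l + ‖c‖ ^ 2 / l ^ 2) := by
    rw [h1, Complex.coe_smul, Complex.coe_smul]
    have a1 : (2 / l) • algebraMap ℝ A δ ≤ (2 / l) • (ℑ c : A) :=
      smul_le_smul_of_nonneg_left hc (by positivity)
    have a2 : (1 / l ^ 2) • (star c * c) ≤ (1 / l ^ 2) • algebraMap ℝ A (‖c‖ ^ 2) :=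
      smul_le_smul_of_nonneg_left CStarAlgebra.star_mul_le_algebraMap_norm_sq (by positivity)
    have e : algebraMap ℝ A (1 - 2 * δ / l + ‖c‖ ^ 2 / l ^ 2) =
        1 - (2 / l) • algebraMap ℝ A δ + (1 / l ^ 2) • algebraMap ℝ A (‖c‖ ^ 2) := by
      simp only [Algebra.algebraMap_eq_smul_one, smul_smul, add_smul, sub_smul, one_smul]
      congr 2
      · congr 2; ring
      · ring
    rw [e]
    gcongr
  have h3 : ‖u‖ < 1 := by
    have hr : 1 - 2 * δ / l + ‖c‖ ^ 2 / l ^ 2 < 1 := by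
      have : ‖c‖ ^ 2 / l ^ 2 < 2 * δ / l := by
        rw [div_lt_div_iff₀ (by positivity) hlpos]
        have : δ * l = ‖c‖ ^ 2 + 1 := by rw [hl]; field_simp
        nlinarith [sq_nonneg ‖c‖]
      linarith
    have h0 : 0 ≤ 1 - 2 * δ / l + ‖c‖ ^ 2 / l ^ 2 := by
      have := le_trans (star_mul_self_nonneg u) h2
      rw [← map_zero (algebraMap ℝ A)] at this
      exact (algebraMap_le_algebraMap (β := A)).1 this
    have := (CStarAlgebra.norm_le_iff_le_algebraMap _ h0 (star_mul_self_nonneg u)).2 h2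
    rw [CStarRing.norm_star_mul_self] at this
    nlinarith [norm_nonneg u]
  have h4 : IsUnit (1 - u) := isUnit_one_sub_of_norm_lt_one h3
  have h5 : c = algebraMap ℂ A (Complex.I * l) * (1 - u) := by
    rw [hu, ← Algebra.smul_def, sub_add_cancel_left, smul_neg, smul_smul, ← neg_smul]
    have : -(Complex.I * l * (Complex.I / l)) = 1 := by
      have := Complex.I_mul_I
      have hl' : (l : ℂ) ≠ 0 := by exact_mod_cast hlpos.ne'
      field_simp
      linear_combination (-1) * this
    rw [this, one_smul]
  rw [h5]
  refine IsUnit.mul (IsUnit.map _ (IsUnit.mk0 _ ?_)) h4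
  simp [hlpos.ne']

theorem imaginaryPart_inverse {c : A} (hc : IsUnit c) :
    (ℑ c⁻¹ʳ : A) = -(star c⁻¹ʳ * (ℑ c : A) * c⁻¹ʳ) := by
  refine imaginaryPart_eq_of_sub_star ?_
  have h1 : c * c⁻¹ʳ = 1 := Ring.mul_inverse_cancel c hc
  have h2 : star c⁻¹ʳ * star c = 1 := by rw [← star_mul, h1, star_one]
  have : star c⁻¹ʳ * (c - star c) * c⁻¹ʳ = star c⁻¹ʳ - c⁻¹ʳ := by
    rw [mul_sub, sub_mul, mul_assoc, h1, h2, mul_one, one_mul]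
  rw [sub_star_eq_smul_imaginaryPart, mul_smul_comm, smul_mul_assoc] at this
  rw [smul_neg, this]
  abel

theorem imaginaryPart_inverse_nonpos {δ : ℝ} (hδ : 0 < δ) {c : A} (hc : c ∈ halfSpace A δ) :
    (ℑ c⁻¹ʳ : A) ≤ 0 := by
  rw [imaginaryPart_inverse (isUnit_of_mem_halfSpace hδ hc), neg_nonpos]
  refine star_left_conjugate_nonneg (le_trans ?_ hc) _
  rw [← map_zero (algebraMap ℝ A)]
  exact (algebraMap_mono A) hδ.le

/-- This is `δ ≤ Im c` conjugated by `c⁻¹`. It is the source of both the norm bound `δ⁻¹` and the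
sharper disc below. -/
theorem smul_star_mul_inverse_le {δ : ℝ} (hδ : 0 < δ) {c : A} (hc : c ∈ halfSpace A δ) :
    δ • (star c⁻¹ʳ * c⁻¹ʳ) ≤ -(ℑ c⁻¹ʳ : A) := by
  rw [imaginaryPart_inverse (isUnit_of_mem_halfSpace hδ hc), neg_neg]
  have := star_left_conjugate_le_conjugate hc c⁻¹ʳ
  rwa [Algebra.algebraMap_eq_smul_one, mul_smul_comm, mul_one, smul_mul_assoc] at this

theorem norm_inverse_le_of_mem_halfSpace {δ : ℝ} (hδ : 0 < δ) {c : A} (hc : c ∈ halfSpace A δ) :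
    ‖c⁻¹ʳ‖ ≤ δ⁻¹ := by
  have h1 := smul_star_mul_inverse_le hδ hc
  have h2 := CStarAlgebra.norm_le_norm_of_nonneg_of_le
    (smul_nonneg hδ.le (star_mul_self_nonneg c⁻¹ʳ)) h1
  rw [norm_smul, CStarRing.norm_star_mul_self, norm_neg, Real.norm_of_nonneg hδ.le] at h2
  have h3 : ‖(ℑ c⁻¹ʳ : A)‖ ≤ ‖c⁻¹ʳ‖ := imaginaryPart.norm_le c⁻¹ʳ
  rcases (norm_nonneg c⁻¹ʳ).eq_or_lt with h | h
  · rw [← h]; positivity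
  · rw [← one_div, le_div_iff₀ hδ]
    have : ‖c⁻¹ʳ‖ * (‖c⁻¹ʳ‖ * δ) ≤ ‖c⁻¹ʳ‖ * 1 := by nlinarith
    exact le_of_mul_le_mul_left this h

/-- The inverse of an element of the half space lies in a disc of diameter `δ⁻¹`. -/
theorem norm_inverse_add_le {δ : ℝ} (hδ : 0 < δ) {c : A} (hc : c ∈ halfSpace A δ) :
    ‖c⁻¹ʳ + (Complex.I / (2 * δ)) • (1 : A)‖ ≤ (2 * δ)⁻¹ := by
  set T := c⁻¹ʳ with hT
  have h1 := smul_star_mul_inverse_le hδ hc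
  rw [← hT] at h1
  set V := T + (Complex.I / (2 * δ)) • (1 : A) with hV
  have hδ' : (δ : ℂ) ≠ 0 := by exact_mod_cast hδ.ne'
  -- Completing the square: by `h1` the imaginary part term is at most `-T* T`, so only the constant
  -- survives.
  have h2 : star V * V = star T * T + δ⁻¹ • (ℑ T : A) + algebraMap ℝ A ((2 * δ)⁻¹ ^ 2) := by
    have hs : star (Complex.I / (2 * δ) : ℂ) = -(Complex.I / (2 * δ)) := by
      simp [neg_div]
    have e0 : star V * V = star T * T - (Complex.I / (2 * δ)) • (T - star T) +
        (-(Complex.I / (2 * δ)) * (Complex.I / (2 * δ))) • (1 : A) := by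
      rw [hV, star_add, star_smul, hs, star_one]
      simp only [add_mul, mul_add, mul_smul_comm, smul_mul_assoc, one_mul, mul_one, smul_sub,
        neg_smul, smul_smul, neg_mul, smul_add, smul_neg]
      abel
    rw [e0, sub_star_eq_smul_imaginaryPart, smul_smul, Algebra.algebraMap_eq_smul_one,
      ← Complex.coe_smul, ← Complex.coe_smul, sub_eq_add_neg, ← neg_smul]
    congr 2
    · congr 1
      push_cast
      field_simp
      linear_combination (-1) * Complex.I_mul_I
    · push_cast
      linear_combination (-1 / (2 * δ) ^ 2 : ℂ) * Complex.I_mul_I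
  have h3 : star V * V ≤ algebraMap ℝ A ((2 * δ)⁻¹ ^ 2) := by
    rw [h2]
    have : δ⁻¹ • (δ • (star T * T)) ≤ δ⁻¹ • (-(ℑ T : A)) :=
      smul_le_smul_of_nonneg_left h1 (by positivity)
    rw [smul_smul, inv_mul_cancel₀ hδ.ne', one_smul, smul_neg] at this
    have := add_le_add_left this (δ⁻¹ • (ℑ T : A))
    simpa using this
  have h4 := (CStarAlgebra.norm_le_iff_le_algebraMap _ (by positivity) (star_mul_self_nonneg V)).2 h3
  rw [CStarRing.norm_star_mul_self, ← sq] at h4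
  exact le_of_sq_le_sq h4 (by positivity)

theorem inverse_sub_inverse {c d : A} (hc : IsUnit c) (hd : IsUnit d) :
    c⁻¹ʳ - d⁻¹ʳ = c⁻¹ʳ * (d - c) * d⁻¹ʳ := by
  rw [mul_sub, sub_mul, mul_assoc, Ring.mul_inverse_cancel d hd, Ring.inverse_mul_cancel c hc]
  simp

theorem norm_inverse_sub_inverse_le {δ : ℝ} (hδ : 0 < δ) {c d : A} (hc : c ∈ halfSpace A δ)
    (hd : d ∈ halfSpace A δ) : ‖c⁻¹ʳ - d⁻¹ʳ‖ ≤ δ⁻¹ ^ 2 * ‖c - d‖ := by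
  rw [inverse_sub_inverse (isUnit_of_mem_halfSpace hδ hc) (isUnit_of_mem_halfSpace hδ hd)]
  calc _ ≤ ‖c⁻¹ʳ‖ * ‖d - c‖ * ‖d⁻¹ʳ‖ := norm_mul₃_le
    _ ≤ δ⁻¹ * ‖d - c‖ * δ⁻¹ := by
      gcongr <;> exact norm_inverse_le_of_mem_halfSpace hδ (by assumption)
    _ = _ := by rw [norm_sub_rev]; ring

/-- A point of the upper half plane lies in an explicit half space. -/
theorem mem_halfSpace_of_mem_upperHalfPlane [Nontrivial A] {b : A} (hb : b ∈ upperHalfPlane A) :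
    0 < ‖(ℑ b : A)⁻¹ʳ‖ ∧ b ∈ halfSpace A ‖(ℑ b : A)⁻¹ʳ‖⁻¹ := by
  set q : A := (ℑ b : A) with hq
  have hb : IsStrictlyPositive q := hb
  have hu : IsUnit q⁻¹ʳ := hb.isUnit.ringInverse
  have hpos : 0 < ‖q⁻¹ʳ‖ := norm_pos_iff.2 hu.ne_zero
  refine ⟨hpos, ?_⟩
  have h1 : q⁻¹ʳ ≤ algebraMap ℝ A ‖q⁻¹ʳ‖ :=
    IsSelfAdjoint.le_algebraMap_norm_self (IsSelfAdjoint.of_nonneg hb.ringInverse.nonneg)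
  -- Inversion is operator antitone, so the upper bound for `q⁻¹` becomes a lower bound for `q`.
  have h2 := CStarAlgebra.ringInverse_le_ringInverse h1 hb.ringInverse
  have e1 : (algebraMap ℝ A ‖q⁻¹ʳ‖)⁻¹ʳ = algebraMap ℝ A ‖q⁻¹ʳ‖⁻¹ := by
    refine left_inv_eq_right_inv (Ring.inverse_mul_cancel _
      ((IsUnit.mk0 _ hpos.ne').map (algebraMap ℝ A))) ?_
    rw [← map_mul, mul_inv_cancel₀ hpos.ne', map_one]
  rw [e1] at h2
  have e2 : q⁻¹ʳ⁻¹ʳ = q := Ring.inverse_inverse hb.isUnit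
  rwa [e2] at h2

end HalfSpace

/-! ### Cauchy-Schwarz and norm bounds for the conditional expectation and the variance maps. -/

section Expectation

variable {B : Type u} {A : Type v}
  [CStarAlgebra B] [PartialOrder B] [StarOrderedRing B]
  [CStarAlgebra A] [PartialOrder A] [StarOrderedRing A]

theorem OVSpace.E_nonneg (P : OVSpace B A) {a : A} (ha : 0 ≤ a) : 0 ≤ P.E a := map_nonneg P.E ha

theorem OVSpace.E_mono (P : OVSpace B A) {a b : A} (h : a ≤ b) : P.E a ≤ P.E b := by
  have := P.E_nonneg (sub_nonneg.2 h)
  rwa [map_sub, sub_nonneg] at this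

theorem OVSpace.E_star (P : OVSpace B A) (a : A) : P.E (star a) = star (P.E a) := map_star P.E a

theorem OVSpace.E_one (P : OVSpace B A) : P.E 1 = 1 := by
  simpa using P.E_incl 1

theorem OVSpace.E_incl_mul (P : OVSpace B A) (b : B) (a : A) :
    P.E (P.incl b * a) = b * P.E a := by
  simpa using P.E_bimodule b 1 a

theorem OVSpace.E_mul_incl (P : OVSpace B A) (a : A) (b : B) :
    P.E (a * P.incl b) = P.E a * b := by
  simpa using P.E_bimodule 1 b a

theorem OVSpace.E_real_smul (P : OVSpace B A) (r : ℝ) (a : A) : P.E (r • a) = r • P.E a := by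
  rw [← Complex.coe_smul, map_smul, Complex.coe_smul]

theorem OVSpace.incl_norm_le (P : OVSpace B A) (b : B) : ‖P.incl b‖ ≤ ‖b‖ :=
  NonUnitalStarAlgHom.norm_apply_le P.incl b

/-- Cauchy-Schwarz inequality for the `B`-valued inner product `E[v* u]`. -/
theorem OVSpace.star_E_mul_E_le (P : OVSpace B A) (u v : A) {k : ℝ} (hk : 0 < k)
    (hv : P.E (star v * v) ≤ algebraMap ℝ B k) :
    star (P.E (star v * u)) * P.E (star v * u) ≤ k • P.E (star u * u) := by
  set d : B := P.E (star v * u) with hd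
  have hd' : P.E (star u * v) = star d := by
    rw [hd, ← P.E_star, star_mul, star_star]
  -- The minimizer of `E[(u - v t)* (u - v t)]` would be `E[v* v]⁻¹ d`; replacing `E[v* v]` by its
  -- scalar bound `k` avoids an inverse in `B`.
  set t : B := k⁻¹ • d with ht
  have h0 : 0 ≤ P.E (star (u - v * P.incl t) * (u - v * P.incl t)) :=
    P.E_nonneg (star_mul_self_nonneg _)
  have h1 : P.E (star (u - v * P.incl t) * (u - v * P.incl t)) =
      P.E (star u * u) - star d * t - star t * d + star t * P.E (star v * v) * t := by
    have : star (u - v * P.incl t) * (u - v * P.incl t) =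
        star u * u - star u * v * P.incl t - P.incl (star t) * (star v * u) +
          P.incl (star t) * (star v * v) * P.incl t := by
      rw [star_sub, star_mul, map_star]
      noncomm_ring
    rw [this, map_add, map_sub, map_sub, P.E_mul_incl, P.E_incl_mul, P.E_bimodule, hd']
  have h2 : star t * P.E (star v * v) * t ≤ k • (star t * t) := by
    refine (star_left_conjugate_le_conjugate hv t).trans_eq ?_
    simp [Algebra.algebraMap_eq_smul_one]
  have h3 : 0 ≤ P.E (star u * u) - k⁻¹ • (star d * d) := by
    refine le_trans (h0.trans_eq h1) ?_
    refine le_trans (add_le_add_right h2 _) (le_of_eq ?_)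
    rw [ht, star_smul, star_trivial k⁻¹, mul_smul_comm, smul_mul_assoc, smul_mul_smul_comm, smul_smul]
    have : k * (k⁻¹ * k⁻¹) = k⁻¹ := by field_simp
    rw [this]
    abel
  have h4 := smul_le_smul_of_nonneg_left (sub_nonneg.1 h3) hk.le
  rwa [smul_smul, mul_inv_cancel₀ hk.ne', one_smul] at h4

theorem OVSpace.norm_E_sq_le (P : OVSpace B A) (u v : A) :
    ‖P.E (star v * u)‖ ^ 2 ≤ ‖P.E (star v * v)‖ * ‖P.E (star u * u)‖ := by
  -- The operator inequality needs `k > 0`, whereas `‖E[v* v]‖` may vanish; hence the perturbation.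
  refine le_of_forall_pos_le_add fun ε hε => ?_
  set a := ‖P.E (star v * v)‖
  set c := ‖P.E (star u * u)‖
  have ha : 0 ≤ a := norm_nonneg _
  have hc : 0 ≤ c := norm_nonneg _
  set e := ε / (c + 1)
  have he : 0 < e := by positivity
  have h1 : P.E (star v * v) ≤ algebraMap ℝ B (a + e) :=
    (IsSelfAdjoint.le_algebraMap_norm_self
      (IsSelfAdjoint.of_nonneg (P.E_nonneg (star_mul_self_nonneg v)))).trans
      (algebraMap_mono B (by linarith))
  have h2 := CStarAlgebra.norm_le_norm_of_nonneg_of_le (star_mul_self_nonneg _)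
    (P.star_E_mul_E_le u v (by positivity) h1)
  rw [CStarRing.norm_star_mul_self, norm_smul, Real.norm_of_nonneg (by positivity)] at h2
  have h3 : e * c ≤ ε := by
    rw [div_mul_eq_mul_div, div_le_iff₀ (by positivity)]
    nlinarith
  rw [sq]
  calc _ ≤ (a + e) * c := h2
    _ = a * c + e * c := by ring
    _ ≤ _ := by linarith

theorem OVSpace.norm_E_le_sqrt (P : OVSpace B A) (u v : A) :
    ‖P.E (star v * u)‖ ≤ √‖P.E (star v * v)‖ * √‖P.E (star u * u)‖ := by
  rw [← Real.sqrt_mul (norm_nonneg _)]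
  exact Real.le_sqrt_of_sq_le (P.norm_E_sq_le u v)

/-- Cauchy-Schwarz with `v = 1` is the Schwarz inequality `E[a]* E[a] ≤ E[a* a] ≤ ‖a‖²`. -/
theorem OVSpace.norm_E_le (P : OVSpace B A) (a : A) : ‖P.E a‖ ≤ ‖a‖ := by
  have h1 : P.E (star (1 : A) * 1) ≤ algebraMap ℝ B 1 := by simp [P.E_one]
  have h2 := P.star_E_mul_E_le a 1 one_pos h1
  rw [star_one, one_mul, one_smul] at h2
  have h3 := P.E_mono (CStarAlgebra.star_mul_le_algebraMap_norm_sq (a := a))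
  have h4 : P.E (algebraMap ℝ A (‖a‖ ^ 2)) = algebraMap ℝ B (‖a‖ ^ 2) := by
    rw [Algebra.algebraMap_eq_smul_one, P.E_real_smul, P.E_one, Algebra.algebraMap_eq_smul_one]
  rw [h4] at h3
  have h5 := (CStarAlgebra.norm_le_iff_le_algebraMap _ (by positivity)
    (star_mul_self_nonneg (P.E a))).2 (h2.trans h3)
  rw [CStarRing.norm_star_mul_self, ← sq] at h5
  exact le_of_sq_le_sq h5 (norm_nonneg _)

/-- The conditional expectation as a continuous linear map. -/
noncomputable def OVSpace.expect (P : OVSpace B A) : A →L[ℂ] B :=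
  LinearMap.mkContinuous
    { toFun := P.E, map_add' := map_add P.E, map_smul' := map_smul P.E } 1
    (fun a => by simpa using P.norm_E_le a)

theorem OVSpace.expect_apply (P : OVSpace B A) (a : A) : P.expect a = P.E a := rfl

theorem OVSpace.continuous_E (P : OVSpace B A) : Continuous P.E := P.expect.continuous

/-- The conditional expectation of `u* b u` is at most `‖b‖ E[u* u]` in norm. -/
theorem OVSpace.norm_E_conj_le (P : OVSpace B A) (u : A) {a : A} (ha : 0 ≤ a) :
    ‖P.E (star u * a * u)‖ ≤ ‖a‖ * ‖P.E (star u * u)‖ := by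
  have h := P.E_mono (CStarAlgebra.star_left_conjugate_le_norm_smul (a := u)
    (IsSelfAdjoint.of_nonneg ha))
  rw [P.E_real_smul] at h
  have := CStarAlgebra.norm_le_norm_of_nonneg_of_le
    (P.E_nonneg (star_left_conjugate_nonneg ha u)) h
  rwa [norm_smul, norm_norm] at this

/-- Cauchy-Schwarz for `x` and `b x`. The constant is the value of the variance at `1`, so `α₂`
controls the operator norm of every variance map. -/
theorem OVSpace.norm_variance_le (P : OVSpace B A) {x : A} (hx : IsSelfAdjoint x) (b : B) :
    ‖P.variance x b‖ ≤ ‖P.E (x ^ 2)‖ * ‖b‖ := by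
  have h1 := P.norm_E_sq_le (P.incl b * x) x
  have e : star (P.incl b * x) * (P.incl b * x) =
      star x * (star (P.incl b) * P.incl b) * x := by
    rw [star_mul]; noncomm_ring
  have h2 := P.norm_E_conj_le x (star_mul_self_nonneg (P.incl b))
  rw [CStarRing.norm_star_mul_self] at h2
  rw [e, hx.star_eq, ← mul_assoc, ← sq] at h1
  rw [hx.star_eq, ← sq, ← sq] at h2
  have h3 := P.incl_norm_le b
  refine le_of_sq_le_sq (h1.trans ?_) (by positivity)
  calc _ ≤ ‖P.E (x ^ 2)‖ * (‖P.incl b‖ ^ 2 * ‖P.E (x ^ 2)‖) := by gcongr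
    _ ≤ ‖P.E (x ^ 2)‖ * (‖b‖ ^ 2 * ‖P.E (x ^ 2)‖) := by gcongr
    _ = _ := by ring

/-- The variance of a self-adjoint element as a continuous linear map. -/
noncomputable def OVSpace.varianceCLM (P : OVSpace B A) (x : A) (hx : IsSelfAdjoint x) : B →L[ℂ] B :=
  LinearMap.mkContinuous
    { toFun := P.variance x
      map_add' := fun b c => by simp [OVSpace.variance, mul_add, add_mul]
      map_smul' := fun r b => by simp [OVSpace.variance] } ‖P.E (x ^ 2)‖
    (fun b => P.norm_variance_le hx b)

theorem OVSpace.varianceCLM_apply (P : OVSpace B A) {x : A} (hx : IsSelfAdjoint x) (b : B) :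
    P.varianceCLM x hx b = P.variance x b := rfl

theorem OVSpace.norm_varianceCLM_le (P : OVSpace B A) {x : A} (hx : IsSelfAdjoint x) :
    ‖P.varianceCLM x hx‖ ≤ ‖P.E (x ^ 2)‖ :=
  LinearMap.mkContinuous_norm_le _ (norm_nonneg _) _

/-- A continuous linear map that preserves adjoints and positive elements. -/
structure IsPositiveMap (η : B →L[ℂ] B) : Prop where
  map_star : ∀ b, η (star b) = star (η b)
  map_nonneg : ∀ b, 0 ≤ b → 0 ≤ η b

theorem OVSpace.isPositiveMap_varianceCLM (P : OVSpace B A) {x : A} (hx : IsSelfAdjoint x) :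
    IsPositiveMap (P.varianceCLM x hx) where
  map_star b := by
    rw [varianceCLM_apply, varianceCLM_apply, OVSpace.variance, OVSpace.variance, ← P.E_star]
    simp [hx.star_eq, mul_assoc, map_star]
  map_nonneg b hb := by
    rw [varianceCLM_apply, OVSpace.variance]
    refine P.E_nonneg ?_
    have := star_left_conjugate_nonneg (map_nonneg P.incl hb) x
    rwa [hx.star_eq] at this

theorem IsPositiveMap.imaginaryPart {η : B →L[ℂ] B} (h : IsPositiveMap η) (c : B) :
    (ℑ (η c) : B) = η (ℑ c : B) := by
  refine imaginaryPart_eq_of_sub_star ?_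
  rw [← h.map_star, ← map_sub, sub_star_eq_smul_imaginaryPart, map_smul]

theorem OVSpace.incl_sub_mem_halfSpace (P : OVSpace B A) {δ : ℝ} {b : B} (hb : b ∈ halfSpace B δ)
    {x : A} (hx : IsSelfAdjoint x) : P.incl b - x ∈ halfSpace A δ := by
  have h : (ℑ (P.incl b - x) : A) = P.incl (ℑ b : B) := by
    refine imaginaryPart_eq_of_sub_star ?_
    rw [← map_smul, ← sub_star_eq_smul_imaginaryPart, map_sub, star_sub, hx.star_eq, map_star]
    abel
  rw [mem_halfSpace_iff, h]
  have := OrderHomClass.mono P.incl hb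
  rw [Algebra.algebraMap_eq_smul_one, ← Complex.coe_smul, map_smul, map_one, Complex.coe_smul,
    ← Algebra.algebraMap_eq_smul_one] at this
  exact this

end Expectation

/-! ### The flow of `c' = -η(c⁻¹)` as a limit of Euler schemes. -/

section Flow

open Filter Topology

/-- A discrete Grönwall inequality, which turns one-step errors of the Euler scheme into global
errors. -/
theorem le_mul_exp_of_le_one_add_mul_add {e : ℕ → ℝ} {a b : ℝ} (ha : 0 ≤ a) (hb : 0 ≤ b) (h0 : e 0 ≤ 0) (m : ℕ)
    (h : ∀ k < m, e (k + 1) ≤ (1 + a) * e k + b) : e m ≤ m * b * Real.exp (m * a) := by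
  have key : ∀ k ≤ m, e k ≤ k * b * (1 + a) ^ k := by
    intro k
    induction k with
    | zero => intro _; simpa using h0
    | succ k ih =>
      intro hk
      have h1 := h k (by omega)
      have h2 := ih (by omega)
      have h3 : (1 : ℝ) ≤ (1 + a) ^ (k + 1) := one_le_pow₀ (by linarith)
      calc e (k + 1) ≤ (1 + a) * e k + b := h1
        _ ≤ (1 + a) * (k * b * (1 + a) ^ k) + b * (1 + a) ^ (k + 1) := by
            gcongr
            nlinarith
        _ = _ := by push_cast; ring
  refine (key m le_rfl).trans ?_
  have : (1 + a) ^ m ≤ Real.exp (m * a) := by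
    rw [Real.exp_nat_mul]
    have := Real.add_one_le_exp a
    gcongr
    linarith
  gcongr

variable {B : Type u} [CStarAlgebra B] [PartialOrder B] [StarOrderedRing B]

/-- One step of size `h` of the Euler scheme for the equation `c' = -η(c⁻¹)`. -/
noncomputable def eulerStep (η : B →L[ℂ] B) (h : ℝ) (c : B) : B := c - h • η c⁻¹ʳ

/-- `Im(-η(c⁻¹)) = η(-Im c⁻¹) ≥ 0`, so a step can only raise the imaginary part. The scheme never
leaves the half space, and every estimate holds with one fixed `δ`. -/
theorem IsPositiveMap.eulerStep_mem {η : B →L[ℂ] B} (hη : IsPositiveMap η) {h δ : ℝ} (hh : 0 ≤ h)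
    (hδ : 0 < δ) {c : B} (hc : c ∈ halfSpace B δ) : eulerStep η h c ∈ halfSpace B δ := by
  rw [eulerStep, sub_eq_add_neg]
  refine halfSpace_add_nonneg hc ?_
  have h1 := hη.map_nonneg _ (neg_nonneg.2 (imaginaryPart_inverse_nonpos hδ hc))
  rw [map_neg, ← hη.imaginaryPart] at h1
  have := smul_nonneg hh h1
  simpa using this

theorem IsPositiveMap.eulerStep_iterate_mem {η : B →L[ℂ] B} (hη : IsPositiveMap η) {h δ : ℝ}
    (hh : 0 ≤ h) (hδ : 0 < δ) {c : B} (hc : c ∈ halfSpace B δ) (k : ℕ) :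
    (eulerStep η h)^[k] c ∈ halfSpace B δ := by
  induction k with
  | zero => simpa using hc
  | succ k ih => rw [Function.iterate_succ_apply']; exact hη.eulerStep_mem hh hδ ih

variable {η : B →L[ℂ] B} {K : ℝ}

theorem norm_eulerStep_sub_self_le (hK : ‖η‖ ≤ K) {h δ : ℝ} (hh : 0 ≤ h) (hδ : 0 < δ) {c : B}
    (hc : c ∈ halfSpace B δ) : ‖eulerStep η h c - c‖ ≤ h * K * δ⁻¹ := by
  rw [eulerStep, sub_sub_cancel_left, norm_neg, norm_smul, Real.norm_of_nonneg hh, mul_assoc]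
  have := η.le_of_opNorm_le_of_le hK (norm_inverse_le_of_mem_halfSpace hδ hc)
  gcongr

theorem norm_eulerStep_sub_le (hK : ‖η‖ ≤ K) {h δ : ℝ} (hh : 0 ≤ h) (hδ : 0 < δ) {c d : B}
    (hc : c ∈ halfSpace B δ) (hd : d ∈ halfSpace B δ) :
    ‖eulerStep η h c - eulerStep η h d‖ ≤ (1 + h * K * δ⁻¹ ^ 2) * ‖c - d‖ := by
  have e : eulerStep η h c - eulerStep η h d = (c - d) - h • η (c⁻¹ʳ - d⁻¹ʳ) := by
    rw [eulerStep, eulerStep, map_sub, smul_sub]; abel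
  rw [e]
  have h1 := η.le_of_opNorm_le_of_le hK (norm_inverse_sub_inverse_le hδ hc hd)
  calc _ ≤ ‖c - d‖ + ‖h • η (c⁻¹ʳ - d⁻¹ʳ)‖ := norm_sub_le _ _
    _ ≤ ‖c - d‖ + h * (K * (δ⁻¹ ^ 2 * ‖c - d‖)) := by
        rw [norm_smul, Real.norm_of_nonneg hh]; gcongr
    _ = _ := by ring

/-- The double step uses `η(c⁻¹)` twice, while the second of the two single steps uses the inverse
at a point `O(h)` away from `c`; the error is thus quadratic in `h`. -/
theorem IsPositiveMap.norm_eulerStep_two_sub_le (hη : IsPositiveMap η) (hK : ‖η‖ ≤ K) {h δ : ℝ}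
    (hh : 0 ≤ h) (hδ : 0 < δ) {c : B} (hc : c ∈ halfSpace B δ) :
    ‖eulerStep η (2 * h) c - eulerStep η h (eulerStep η h c)‖ ≤ h ^ 2 * (K ^ 2 * δ⁻¹ ^ 3) := by
  have hT := hη.eulerStep_mem hh hδ hc
  have e : eulerStep η (2 * h) c - eulerStep η h (eulerStep η h c) =
      h • η ((eulerStep η h c)⁻¹ʳ - c⁻¹ʳ) := by
    rw [map_sub, smul_sub]
    conv_lhs => rw [eulerStep, eulerStep]
    rw [two_mul, add_smul]
    nth_rewrite 1 [eulerStep]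
    abel
  have hK0 : 0 ≤ K := (norm_nonneg _).trans hK
  rw [e, norm_smul, Real.norm_of_nonneg hh]
  have h1 := η.le_of_opNorm_le_of_le hK (norm_inverse_sub_inverse_le hδ hT hc)
  have h2 := norm_eulerStep_sub_self_le hK hh hδ hc
  calc _ ≤ h * (K * (δ⁻¹ ^ 2 * (h * K * δ⁻¹))) := by gcongr; exact h1.trans (by gcongr)
    _ = _ := by ring

/-- The Euler scheme with `2 ^ m` steps up to time `s`. -/
noncomputable def flowApprox (η : B →L[ℂ] B) (s : ℝ) (m : ℕ) (c : B) : B :=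
  (eulerStep η (s / 2 ^ m))^[2 ^ m] c

/-- The time-`s` map of the flow `c' = -η(c⁻¹)` on the upper half plane. -/
noncomputable def flow (η : B →L[ℂ] B) (s : ℝ) (c : B) : B :=
  limUnder atTop fun m => flowApprox η s m c

theorem IsPositiveMap.flowApprox_mem (hη : IsPositiveMap η) {s δ : ℝ} (hs : 0 ≤ s) (hδ : 0 < δ)
    {c : B} (hc : c ∈ halfSpace B δ) (m : ℕ) : flowApprox η s m c ∈ halfSpace B δ :=
  hη.eulerStep_iterate_mem (by positivity) hδ hc _

/-- Each step of length `2h` is compared with two steps of length `h`. The `2 ^ m` local errors of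
order `h²` add up to order `2 ^ (-m)`, so the dyadic refinements form a Cauchy sequence. -/
theorem IsPositiveMap.dist_flowApprox_le (hη : IsPositiveMap η) (hK : ‖η‖ ≤ K) {s δ : ℝ}
    (hs : 0 ≤ s) (hδ : 0 < δ) {c : B} (hc : c ∈ halfSpace B δ) (m : ℕ) :
    dist (flowApprox η s m c) (flowApprox η s (m + 1) c) ≤
      (s ^ 2 * (K ^ 2 * δ⁻¹ ^ 3) * Real.exp (s * K * δ⁻¹ ^ 2)) / 2 / 2 ^ m := by
  have hK0 : 0 ≤ K := (norm_nonneg _).trans hK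
  set h : ℝ := s / 2 ^ (m + 1) with hh
  have hh0 : 0 ≤ h := by positivity
  have h2 : s / 2 ^ m = 2 * h := by rw [hh, pow_succ]; field_simp
  have key := le_mul_exp_of_le_one_add_mul_add
    (e := fun k => ‖(eulerStep η (2 * h))^[k] c - (eulerStep η h)^[2 * k] c‖)
    (a := 2 * h * K * δ⁻¹ ^ 2) (b := h ^ 2 * (K ^ 2 * δ⁻¹ ^ 3)) (by positivity) (by positivity)
    (by simp) (2 ^ m) (fun k _ => by
      have e2 : 2 * (k + 1) = 2 * k + 1 + 1 := by ring
      simp only [e2, Function.iterate_succ_apply']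
      have m1 := hη.eulerStep_iterate_mem (h := 2 * h) (by positivity) hδ hc k
      have m2 := hη.eulerStep_iterate_mem hh0 hδ hc (2 * k)
      have b1 := norm_eulerStep_sub_le hK (h := 2 * h) (by positivity) hδ m1 m2
      have b2 := hη.norm_eulerStep_two_sub_le hK hh0 hδ m2
      exact (norm_sub_le_norm_sub_add_norm_sub _ _ _).trans (add_le_add b1 b2))
  rw [dist_eq_norm, flowApprox, flowApprox, h2, ← hh, pow_succ 2 m, mul_comm (2 ^ m) 2]
  refine key.trans ?_
  have e3 : ((2 ^ m : ℕ) : ℝ) * (2 * h * K * δ⁻¹ ^ 2) = s * K * δ⁻¹ ^ 2 := by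
    push_cast
    rw [← h2]; field_simp
  rw [e3]
  push_cast
  have e4 : (2 : ℝ) ^ m * (h ^ 2 * (K ^ 2 * δ⁻¹ ^ 3)) =
      s ^ 2 * (K ^ 2 * δ⁻¹ ^ 3) / 4 / 2 ^ m := by
    rw [hh, pow_succ]; field_simp; ring
  rw [e4]
  have : s ^ 2 * (K ^ 2 * δ⁻¹ ^ 3) / 4 / 2 ^ m ≤ s ^ 2 * (K ^ 2 * δ⁻¹ ^ 3) / 2 / 2 ^ m := by
    gcongr; norm_num
  calc _ ≤ s ^ 2 * (K ^ 2 * δ⁻¹ ^ 3) / 2 / 2 ^ m * Real.exp (s * K * δ⁻¹ ^ 2) := by gcongr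
    _ = _ := by ring

theorem IsPositiveMap.tendsto_flowApprox (hη : IsPositiveMap η) {s δ : ℝ}
    (hs : 0 ≤ s) (hδ : 0 < δ) {c : B} (hc : c ∈ halfSpace B δ) :
    Tendsto (fun m => flowApprox η s m c) atTop (𝓝 (flow η s c)) :=
  (cauchySeq_of_le_geometric_two (hη.dist_flowApprox_le le_rfl hs hδ hc)).tendsto_limUnder

theorem IsPositiveMap.dist_flowApprox_flow_le (hη : IsPositiveMap η) {s δ : ℝ}
    (hs : 0 ≤ s) (hδ : 0 < δ) {c : B} (hc : c ∈ halfSpace B δ) (m : ℕ) :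
    dist (flowApprox η s m c) (flow η s c) ≤
      (s ^ 2 * (‖η‖ ^ 2 * δ⁻¹ ^ 3) * Real.exp (s * ‖η‖ * δ⁻¹ ^ 2)) / 2 ^ m :=
  dist_le_of_le_geometric_two_of_tendsto (hη.dist_flowApprox_le le_rfl hs hδ hc)
    (hη.tendsto_flowApprox hs hδ hc) m

theorem IsPositiveMap.flow_mem (hη : IsPositiveMap η) {s δ : ℝ} (hs : 0 ≤ s) (hδ : 0 < δ)
    {c : B} (hc : c ∈ halfSpace B δ) : flow η s c ∈ halfSpace B δ :=
  (isClosed_halfSpace δ).mem_of_tendsto (hη.tendsto_flowApprox hs hδ hc)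
    (Eventually.of_forall fun m => hη.flowApprox_mem hs hδ hc m)

/-- The rate depends on `δ` only, not on the norm of the starting point. Uniformity is what lets
holomorphy pass to the limit. -/
theorem IsPositiveMap.tendstoUniformlyOn_flowApprox (hη : IsPositiveMap η) {s δ : ℝ}
    (hs : 0 ≤ s) (hδ : 0 < δ) :
    TendstoUniformlyOn (flowApprox η s) (flow η s) atTop (halfSpace B δ) := by
  rw [Metric.tendstoUniformlyOn_iff]
  intro ε hε
  have h1 : Tendsto (fun m : ℕ => (s ^ 2 * (‖η‖ ^ 2 * δ⁻¹ ^ 3) *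
      Real.exp (s * ‖η‖ * δ⁻¹ ^ 2)) / 2 ^ m) atTop (𝓝 0) :=
    tendsto_const_nhds.div_atTop (tendsto_pow_atTop_atTop_of_one_lt one_lt_two)
  filter_upwards [h1.eventually_lt_const hε] with m hm c hc
  rw [dist_comm]
  exact (hη.dist_flowApprox_flow_le hs hδ hc m).trans_lt hm

theorem differentiableOn_inverse_comp {u : ℂ → B} {U : Set ℂ} (hu : DifferentiableOn ℂ u U)
    {δ : ℝ} (hδ : 0 < δ) (hU : ∀ z ∈ U, u z ∈ halfSpace B δ) :
    DifferentiableOn ℂ (fun z => (u z)⁻¹ʳ) U := fun z hz =>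
  (differentiableAt_inverse (𝕜 := ℂ) (isUnit_of_mem_halfSpace hδ (hU z hz))).comp_differentiableWithinAt z
    (hu z hz)

/-- Euler iterates are holomorphic, being built from inverses and `η`, and uniform limits of
holomorphic functions are holomorphic. One complex parameter is enough for the later analytic
continuation. -/
theorem IsPositiveMap.differentiableOn_flow (hη : IsPositiveMap η) {s δ : ℝ} (hs : 0 ≤ s)
    (hδ : 0 < δ) {u : ℂ → B} {U : Set ℂ} (hUo : IsOpen U) (hu : DifferentiableOn ℂ u U)
    (hU : ∀ z ∈ U, u z ∈ halfSpace B δ) : DifferentiableOn ℂ (fun z => flow η s (u z)) U := by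
  have h1 : TendstoLocallyUniformlyOn (fun m z => flowApprox η s m (u z))
      (fun z => flow η s (u z)) atTop U := by
    refine TendstoUniformlyOn.tendstoLocallyUniformlyOn ?_
    exact ((hη.tendstoUniformlyOn_flowApprox hs hδ).comp u).mono hU
  refine h1.differentiableOn (Eventually.of_forall fun m => ?_) hUo
  have : ∀ k, DifferentiableOn ℂ (fun z => (eulerStep η (s / 2 ^ m))^[k] (u z)) U := by
    intro k
    induction k with
    | zero => simpa using hu
    | succ k ih =>
      simp only [Function.iterate_succ_apply']
      have h2 := differentiableOn_inverse_comp ih hδ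
        (fun z hz => hη.eulerStep_iterate_mem (by positivity) hδ (hU z hz) k)
      exact ih.sub ((η.differentiable.comp_differentiableOn h2).const_smul (s / 2 ^ m))
  exact this (2 ^ m)

/-- A solution of `f' = -η(f⁻¹)` which starts in the half space is given by the flow. -/
theorem IsPositiveMap.flow_eq_of_hasDerivAt (hη : IsPositiveMap η) {s δ M : ℝ} (hs : 0 ≤ s)
    (hδ : 0 < δ) {f : ℝ → B} (h0 : f 0 ∈ halfSpace B δ)
    (hunit : ∀ t ∈ Set.Icc 0 s, IsUnit (f t)) (hM : ∀ t ∈ Set.Icc 0 s, ‖(f t)⁻¹ʳ‖ ≤ M)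
    (hf : ∀ t ∈ Set.Icc 0 s, HasDerivWithinAt f (-η (f t)⁻¹ʳ) (Set.Icc 0 s) t) :
    flow η s (f 0) = f s := by
  set K := ‖η‖ with hK
  have hM0 : 0 ≤ M := (norm_nonneg _).trans (hM 0 ⟨le_rfl, hs⟩)
  have lip : ∀ t ∈ Set.Icc 0 s, ∀ t' ∈ Set.Icc 0 s, t ≤ t' → ‖f t' - f t‖ ≤ K * M * (t' - t) := by
    intro t ht t' ht' htt
    refine norm_image_sub_le_of_norm_deriv_le_segment' (a := t) (b := t')
      (f' := fun u => -η (f u)⁻¹ʳ) (fun u hu => (hf u ⟨ht.1.trans hu.1, hu.2.trans ht'.2⟩).mono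
        (Set.Icc_subset_Icc ht.1 ht'.2)) (fun u hu => ?_) t' ⟨htt, le_rfl⟩
    rw [norm_neg]
    exact η.le_of_opNorm_le_of_le le_rfl (hM u ⟨ht.1.trans hu.1, hu.2.le.trans ht'.2⟩)
  -- Local truncation error of the Euler scheme along the exact solution: the derivative of `f`
  -- varies by `O(t' - t)` on `[t, t']`.
  have step : ∀ t ∈ Set.Icc 0 s, ∀ t' ∈ Set.Icc 0 s, t ≤ t' →
      ‖f t' - f t + (t' - t) • η (f t)⁻¹ʳ‖ ≤ (t' - t) ^ 2 * (K ^ 2 * M ^ 3) := by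
    intro t ht t' ht' htt
    have h1 := norm_image_sub_le_of_norm_deriv_le_segment' (a := t) (b := t')
      (f := fun u => f u + (u - t) • η (f t)⁻¹ʳ) (f' := fun u => -η (f u)⁻¹ʳ + (1 : ℝ) • η (f t)⁻¹ʳ)
      (C := K * (M * (K * M * (t' - t)) * M))
      (fun u hu => ((hf u ⟨ht.1.trans hu.1, hu.2.trans ht'.2⟩).mono
        (Set.Icc_subset_Icc ht.1 ht'.2)).add
          (((hasDerivWithinAt_id u _).sub_const t).smul_const _)) (fun u hu => ?_) t' ⟨htt, le_rfl⟩
    · simp only [sub_self, zero_smul, add_zero] at h1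
      refine le_trans (le_of_eq ?_) (h1.trans (le_of_eq (by ring)))
      congr 1; abel
    · have hu' : u ∈ Set.Icc 0 s := ⟨ht.1.trans hu.1, hu.2.le.trans ht'.2⟩
      rw [one_smul, neg_add_eq_sub, ← map_sub]
      refine η.le_of_opNorm_le_of_le le_rfl ?_
      rw [inverse_sub_inverse (hunit t ht) (hunit u hu')]
      refine norm_mul₃_le.trans ?_
      have h3 := lip t ht u hu' hu.1
      have h4 : K * M * (u - t) ≤ K * M * (t' - t) := by
        have := hu.2.le
        have : 0 ≤ K := norm_nonneg _
        gcongr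
      have := hM t ht
      have := hM u hu'
      have := h3.trans h4
      gcongr
  -- Only the iterates are known to lie in the half space; inverses along `f` are bounded by `M`.
  -- Hence the mixed product `δ⁻¹ * M` in the Lipschitz constant.
  have bound : ∀ m : ℕ, ‖flowApprox η s m (f 0) - f s‖ ≤
      (s ^ 2 * (K ^ 2 * M ^ 3) * Real.exp (s * (K * (δ⁻¹ * M)))) / 2 ^ m := by
    intro m
    set h : ℝ := s / 2 ^ m with hh
    have hK0 : 0 ≤ K := norm_nonneg _
    have hh0 : 0 ≤ h := by positivity
    have hms : ((2 ^ m : ℕ) : ℝ) * h = s := by push_cast; rw [hh]; field_simp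
    have hmem : ∀ k : ℕ, k ≤ 2 ^ m → (k : ℝ) * h ∈ Set.Icc 0 s := fun k hk =>
      ⟨by positivity, by rw [← hms]; gcongr⟩
    have key := le_mul_exp_of_le_one_add_mul_add
      (e := fun k : ℕ => ‖(eulerStep η h)^[k] (f 0) - f (k * h)‖)
      (a := h * (K * (δ⁻¹ * M))) (b := h ^ 2 * (K ^ 2 * M ^ 3)) (by positivity) (by positivity)
      (by simp) (2 ^ m) (fun k hk => by
        simp only [Function.iterate_succ_apply']
        have m1 := hη.eulerStep_iterate_mem hh0 hδ h0 k
        set c := (eulerStep η h)^[k] (f 0)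
        have t1 := hmem k hk.le
        have t2 := hmem (k + 1) hk
        have b1 := step _ t1 _ t2 (by push_cast; nlinarith)
        have e1 : ((k + 1 : ℕ) : ℝ) * h - k * h = h := by push_cast; ring
        rw [e1] at b1
        have e2 : eulerStep η h c - f ((k + 1 : ℕ) * h) = (c - f (k * h)) -
            h • η (c⁻¹ʳ - (f (k * h))⁻¹ʳ) -
            (f ((k + 1 : ℕ) * h) - f (k * h) + h • η (f (k * h))⁻¹ʳ) := by
          rw [eulerStep, map_sub, smul_sub]; abel
        have b2 : ‖c⁻¹ʳ - (f (k * h))⁻¹ʳ‖ ≤ δ⁻¹ * ‖c - f (k * h)‖ * M := by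
          rw [inverse_sub_inverse (isUnit_of_mem_halfSpace hδ m1) (hunit _ t1)]
          refine norm_mul₃_le.trans ?_
          rw [norm_sub_rev c]
          have := hM _ t1
          have := norm_inverse_le_of_mem_halfSpace hδ m1
          gcongr
        have b3 := η.le_of_opNorm_le_of_le le_rfl b2
        rw [e2]
        calc _ ≤ ‖c - f (k * h)‖ + ‖h • η (c⁻¹ʳ - (f (k * h))⁻¹ʳ)‖ +
              ‖f ((k + 1 : ℕ) * h) - f (k * h) + h • η (f (k * h))⁻¹ʳ‖ :=
              (norm_sub_le _ _).trans (by gcongr; exact norm_sub_le _ _)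
          _ ≤ ‖c - f (k * h)‖ + h * (K * (δ⁻¹ * ‖c - f (k * h)‖ * M)) +
              h ^ 2 * (K ^ 2 * M ^ 3) := by
              rw [norm_smul, Real.norm_of_nonneg hh0]; gcongr
          _ = _ := by ring)
    simp only [hms] at key
    rw [flowApprox, ← hh]
    refine key.trans (le_of_eq ?_)
    have e3 : ((2 ^ m : ℕ) : ℝ) * (h * (K * (δ⁻¹ * M))) = s * (K * (δ⁻¹ * M)) := by
      rw [← mul_assoc, hms]
    have e4 : ((2 ^ m : ℕ) : ℝ) * (h ^ 2 * (K ^ 2 * M ^ 3)) = s ^ 2 * (K ^ 2 * M ^ 3) / 2 ^ m := by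
      push_cast; rw [hh]; field_simp
    rw [e3, e4]; ring
  have h1 : Tendsto (fun m : ℕ => flowApprox η s m (f 0)) atTop (𝓝 (f s)) := by
    rw [tendsto_iff_norm_sub_tendsto_zero]
    refine squeeze_zero (fun _ => norm_nonneg _) bound ?_
    exact tendsto_const_nhds.div_atTop (tendsto_pow_atTop_atTop_of_one_lt one_lt_two)
  exact tendsto_nhds_unique (hη.tendsto_flowApprox hs hδ h0) h1

/-- Second order expansion along the flow, for a function whose increments along the Euler scheme
are controlled. -/
theorem IsPositiveMap.norm_flow_expansion_le (hη : IsPositiveMap η) (hK : ‖η‖ ≤ K) {s δ : ℝ}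
    (hs : 0 ≤ s) (hδ : 0 < δ) {Φ ψ : B → B} (hΦ : ContinuousOn Φ (halfSpace B δ))
    (h1 : ∀ h, 0 ≤ h → ∀ c ∈ halfSpace B δ,
      ‖Φ (eulerStep η h c) - Φ c - h • ψ c‖ ≤ h ^ 2 * (K ^ 2 * δ⁻¹ ^ 5))
    (h2 : ∀ c ∈ halfSpace B δ, ∀ d ∈ halfSpace B δ, ‖ψ c - ψ d‖ ≤ 3 * K * δ⁻¹ ^ 4 * ‖c - d‖)
    {c : B} (hc : c ∈ halfSpace B δ) :
    ‖Φ (flow η s c) - Φ c - s • ψ c‖ ≤ 3 / 2 * K ^ 2 * δ⁻¹ ^ 5 * s ^ 2 := by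
  have hK0 : 0 ≤ K := (norm_nonneg _).trans hK
  -- In units of `h² K² δ⁻⁵`, step `k` costs `1` for its own remainder and `3k` for the drift of
  -- `ψ`. The factor `3/2` comes from `1 + 3k ≤ (3/2)((k+1)² - k²)`.
  have key : ∀ h, 0 ≤ h → ∀ k : ℕ, ‖(eulerStep η h)^[k] c - c‖ ≤ k * (h * K * δ⁻¹) ∧
      ‖Φ ((eulerStep η h)^[k] c) - Φ c - (k * h) • ψ c‖ ≤
        3 / 2 * K ^ 2 * δ⁻¹ ^ 5 * (k * h) ^ 2 := by
    intro h hh k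
    induction k with
    | zero => simp
    | succ k ih =>
      simp only [Function.iterate_succ_apply']
      have m1 := hη.eulerStep_iterate_mem hh hδ hc k
      set d := (eulerStep η h)^[k] c
      constructor
      · have := norm_eulerStep_sub_self_le hK hh hδ m1
        calc _ ≤ ‖eulerStep η h d - d‖ + ‖d - c‖ := norm_sub_le_norm_sub_add_norm_sub _ _ _
          _ ≤ h * K * δ⁻¹ + k * (h * K * δ⁻¹) := add_le_add this ih.1
          _ = _ := by push_cast; ring
      · have e : Φ (eulerStep η h d) - Φ c - (((k + 1 : ℕ) : ℝ) * h) • ψ c =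
            (Φ (eulerStep η h d) - Φ d - h • ψ d) + (Φ d - Φ c - (k * h) • ψ c) +
              h • (ψ d - ψ c) := by
          push_cast
          rw [add_mul, one_mul, add_smul, smul_sub]; abel
        rw [e]
        calc _ ≤ ‖Φ (eulerStep η h d) - Φ d - h • ψ d‖ + ‖Φ d - Φ c - (k * h) • ψ c‖ +
              ‖h • (ψ d - ψ c)‖ := norm_add₃_le
          _ ≤ h ^ 2 * (K ^ 2 * δ⁻¹ ^ 5) + 3 / 2 * K ^ 2 * δ⁻¹ ^ 5 * (k * h) ^ 2 +
              h * (3 * K * δ⁻¹ ^ 4 * (k * (h * K * δ⁻¹))) := by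
              rw [norm_smul, Real.norm_of_nonneg hh]
              gcongr
              · exact h1 h hh d m1
              · exact ih.2
              · exact (h2 d m1 c hc).trans (by gcongr; exact ih.1)
          _ ≤ _ := by
              push_cast
              have : 0 ≤ h ^ 2 * (K ^ 2 * δ⁻¹ ^ 5) := by positivity
              nlinarith
  have hb : ∀ m : ℕ, ‖Φ (flowApprox η s m c) - Φ c - s • ψ c‖ ≤
      3 / 2 * K ^ 2 * δ⁻¹ ^ 5 * s ^ 2 := by
    intro m
    have := (key (s / 2 ^ m) (by positivity) (2 ^ m)).2
    have e : ((2 ^ m : ℕ) : ℝ) * (s / 2 ^ m) = s := by push_cast; field_simp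
    rwa [e] at this
  have hlim : Tendsto (fun m => flowApprox η s m c) atTop (𝓝[halfSpace B δ] (flow η s c)) :=
    tendsto_nhdsWithin_iff.2 ⟨hη.tendsto_flowApprox hs hδ hc,
      Eventually.of_forall fun m => hη.flowApprox_mem hs hδ hc m⟩
  have h3 : Tendsto (fun m => Φ (flowApprox η s m c)) atTop (𝓝 (Φ (flow η s c))) :=
    (hΦ _ (hη.flow_mem hs hδ hc)).tendsto.comp hlim
  exact le_of_tendsto ((h3.sub_const _).sub_const _).norm (Eventually.of_forall hb)

end Flow

/-! ### Closed spans of words and monotone independence for resolvents. -/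

section Independence

variable {B : Type u} {A : Type v}
  [CStarAlgebra B] [PartialOrder B] [StarOrderedRing B]
  [CStarAlgebra A] [PartialOrder A] [StarOrderedRing A]

theorem OVSpace.incl_mul_mem_bimoduleAlg (P : OVSpace B A) {x a : A} (ha : a ∈ P.bimoduleAlg x)
    (b : B) : P.incl b * a ∈ P.bimoduleAlg x := by
  induction ha using Submodule.span_induction with
  | mem a ha =>
    obtain ⟨b₀, l, hl, rfl⟩ := ha
    exact Submodule.subset_span ⟨b * b₀, l, hl, by simp [OVSpace.monomial, mul_assoc]⟩
  | zero => simp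
  | add a c _ _ ha hc => rw [mul_add]; exact add_mem ha hc
  | smul r a _ ha => rw [mul_smul_comm]; exact Submodule.smul_mem _ _ ha

theorem OVSpace.monomial_mul_incl (P : OVSpace B A) (x : A) (b₀ : B) (l : List B) (hl : l ≠ [])
    (b : B) : ∃ l', l' ≠ [] ∧ P.monomial x b₀ l * P.incl b = P.monomial x b₀ l' := by
  obtain ⟨l, c, rfl⟩ := List.eq_nil_or_concat' l |>.resolve_left hl
  exact ⟨l ++ [c * b], by simp, by simp [OVSpace.monomial, mul_assoc]⟩

theorem OVSpace.mul_incl_mem_bimoduleAlg (P : OVSpace B A) {x a : A} (ha : a ∈ P.bimoduleAlg x)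
    (b : B) : a * P.incl b ∈ P.bimoduleAlg x := by
  induction ha using Submodule.span_induction with
  | mem a ha =>
    obtain ⟨b₀, l, hl, rfl⟩ := ha
    obtain ⟨l', hl', e⟩ := P.monomial_mul_incl x b₀ l hl b
    exact Submodule.subset_span ⟨b₀, l', hl', e⟩
  | zero => simp
  | add a c _ _ ha hc => rw [add_mul]; exact add_mem ha hc
  | smul r a _ ha => rw [smul_mul_assoc]; exact Submodule.smul_mem _ _ ha

theorem OVSpace.self_mem_bimoduleAlg (P : OVSpace B A) (x : A) : x ∈ P.bimoduleAlg x :=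
  Submodule.subset_span ⟨1, [1], by simp, by simp [OVSpace.monomial]⟩

theorem OVSpace.mul_mem_bimoduleAlg (P : OVSpace B A) {x a c : A} (ha : a ∈ P.bimoduleAlg x)
    (hc : c ∈ P.bimoduleAlg x) : a * c ∈ P.bimoduleAlg x := by
  induction hc using Submodule.span_induction with
  | mem c hc =>
    obtain ⟨b₀, l, hl, rfl⟩ := hc
    have : ∀ l : List B, ∀ a ∈ P.bimoduleAlg x,
        a * (l.map fun b => x * P.incl b).prod ∈ P.bimoduleAlg x := by
      intro l
      induction l with
      | nil => intro a ha; simpa using ha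
      | cons d l ih =>
        intro a ha
        rw [List.map_cons, List.prod_cons, ← mul_assoc]
        refine ih _ ?_
        rw [← mul_assoc]
        refine P.mul_incl_mem_bimoduleAlg ?_ d
        induction ha using Submodule.span_induction with
        | mem a ha =>
          obtain ⟨c₀, m, hm, rfl⟩ := ha
          exact Submodule.subset_span ⟨c₀, m ++ [1], by simp, by simp [OVSpace.monomial, mul_assoc]⟩
        | zero => simp
        | add a c _ _ ha hc => rw [add_mul]; exact add_mem ha hc
        | smul r a _ ha => rw [smul_mul_assoc]; exact Submodule.smul_mem _ _ ha
    rw [OVSpace.monomial, ← mul_assoc]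
    exact this l _ (P.mul_incl_mem_bimoduleAlg ha b₀)
  | zero => simp
  | add a c _ _ ha hc => rw [mul_add]; exact add_mem ha hc
  | smul r a _ ha => rw [mul_smul_comm]; exact Submodule.smul_mem _ _ ha

variable {n : ℕ}

/-- Lists of factors from the bimodule algebras generated by the `x i`. -/
def OVSpace.IsWord (P : OVSpace B A) (x : Fin n → A) (L : List (Fin n × A)) : Prop :=
  ∀ p ∈ L, p.2 ∈ P.bimoduleAlg (x p.1)

/-- The span of the nonempty words in the `x i` with `i < j`. -/
noncomputable def OVSpace.lowerWords (P : OVSpace B A) (x : Fin n → A) (j : Fin n) : Submodule ℂ A :=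
  Submodule.span ℂ {a | ∃ L, L ≠ [] ∧ P.IsWord x L ∧ (∀ p ∈ L, p.1 < j) ∧
    a = (L.map Prod.snd).prod}

/-- The closed span of the products which may stand to the left of a factor with index `j` that
is a local maximum. -/
noncomputable def OVSpace.leftWords (P : OVSpace B A) (x : Fin n → A) (j : Fin n) : Submodule ℂ A :=
  (Submodule.span ℂ {a | ∃ b L, P.IsWord x L ∧ (∀ p ∈ L.getLast?, p.1 < j) ∧
    a = P.incl b * (L.map Prod.snd).prod}).topologicalClosure

/-- The closed span of the products which may stand to the right of a factor with index `j` that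
is a local maximum. -/
noncomputable def OVSpace.rightWords (P : OVSpace B A) (x : Fin n → A) (j : Fin n) : Submodule ℂ A :=
  (Submodule.span ℂ {a | ∃ b L, P.IsWord x L ∧ (∀ p ∈ L.head?, p.1 < j) ∧
    a = (L.map Prod.snd).prod * P.incl b}).topologicalClosure

/-- The closed span of all words with a coefficient on the left. -/
noncomputable def OVSpace.leftAll (P : OVSpace B A) (x : Fin n → A) : Submodule ℂ A :=
  (Submodule.span ℂ {a | ∃ b L, P.IsWord x L ∧
    a = P.incl b * (L.map Prod.snd).prod}).topologicalClosure

/-- The closed span of all words with a coefficient on the right. -/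
noncomputable def OVSpace.rightAll (P : OVSpace B A) (x : Fin n → A) : Submodule ℂ A :=
  (Submodule.span ℂ {a | ∃ b L, P.IsWord x L ∧
    a = (L.map Prod.snd).prod * P.incl b}).topologicalClosure

/-- Membership in a closed span is inherited under a continuous bilinear operation. -/
theorem mul_mem_closedSpan {s t r : Set A}
    (h : ∀ a ∈ s, ∀ c ∈ t, a * c ∈ (Submodule.span ℂ r).topologicalClosure) {a c : A}
    (ha : a ∈ (Submodule.span ℂ s).topologicalClosure)
    (hc : c ∈ (Submodule.span ℂ t).topologicalClosure) :
    a * c ∈ (Submodule.span ℂ r).topologicalClosure := by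
  set R := (Submodule.span ℂ r).topologicalClosure
  have hR : IsClosed (R : Set A) := Submodule.isClosed_topologicalClosure _
  have h1 : ∀ a ∈ s, ∀ c ∈ (Submodule.span ℂ t).topologicalClosure, a * c ∈ R := by
    intro a ha c hc
    have hle : (Submodule.span ℂ t).topologicalClosure ≤ R.comap (LinearMap.mulLeft ℂ a) := by
      refine Submodule.topologicalClosure_minimal _ (Submodule.span_le.2 fun c hc => h a ha c hc) ?_
      exact hR.preimage (continuous_const_mul a)
    exact hle hc
  have hle : (Submodule.span ℂ s).topologicalClosure ≤ R.comap (LinearMap.mulRight ℂ c) := by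
    refine Submodule.topologicalClosure_minimal _ (Submodule.span_le.2 fun a ha => h1 a ha c hc) ?_
    exact hR.preimage (continuous_mul_const c)
  exact hle ha

theorem OVSpace.IsWord.append {P : OVSpace B A} {x : Fin n → A} {L R : List (Fin n × A)}
    (hL : P.IsWord x L) (hR : P.IsWord x R) : P.IsWord x (L ++ R) := fun p hp =>
  (List.mem_append.1 hp).elim (hL p) (hR p)

theorem OVSpace.IsWord.singleton {P : OVSpace B A} {x : Fin n → A} {i : Fin n} {a : A}
    (ha : a ∈ P.bimoduleAlg (x i)) : P.IsWord x [(i, a)] := by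
  intro p hp
  rw [List.mem_singleton.1 hp]; exact ha

theorem subset_closedSpan {s : Set A} {a : A} (ha : a ∈ s) :
    a ∈ (Submodule.span ℂ s).topologicalClosure :=
  Submodule.le_topologicalClosure _ (Submodule.subset_span ha)

theorem closedSpan_mono {s t : Set A} (h : s ⊆ t) {a : A}
    (ha : a ∈ (Submodule.span ℂ s).topologicalClosure) :
    a ∈ (Submodule.span ℂ t).topologicalClosure :=
  Submodule.topologicalClosure_mono (Submodule.span_mono h) ha

variable (P : OVSpace B A) (x : Fin n → A) (j : Fin n)

theorem OVSpace.incl_mem_leftWords (b : B) : P.incl b ∈ P.leftWords x j :=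
  subset_closedSpan ⟨b, [], by simp [IsWord], by simp, by simp⟩

theorem OVSpace.incl_mem_rightWords (b : B) : P.incl b ∈ P.rightWords x j :=
  subset_closedSpan ⟨b, [], by simp [IsWord], by simp, by simp⟩

theorem OVSpace.lowerWords_le_leftWords {a : A}
    (ha : a ∈ (P.lowerWords x j).topologicalClosure) : a ∈ P.leftWords x j := by
  refine closedSpan_mono ?_ ha
  rintro a ⟨L, _, hL, hj, rfl⟩
  exact ⟨1, L, hL, fun p hp => hj p (List.mem_of_getLast? hp), by simp⟩

theorem OVSpace.lowerWords_le_rightWords {a : A}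
    (ha : a ∈ (P.lowerWords x j).topologicalClosure) : a ∈ P.rightWords x j := by
  refine closedSpan_mono ?_ ha
  rintro a ⟨L, _, hL, hj, rfl⟩
  exact ⟨1, L, hL, fun p hp => hj p (List.mem_of_head? hp), by simp⟩

variable {x j}

theorem OVSpace.leftWords_le_leftAll {a : A} (ha : a ∈ P.leftWords x j) : a ∈ P.leftAll x :=
  by
  refine closedSpan_mono ?_ ha
  rintro _ ⟨b, L, hL, _, e⟩
  exact ⟨b, L, hL, e⟩

theorem OVSpace.rightWords_le_rightAll {a : A} (ha : a ∈ P.rightWords x j) : a ∈ P.rightAll x :=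
  by
  refine closedSpan_mono ?_ ha
  rintro _ ⟨b, L, hL, _, e⟩
  exact ⟨b, L, hL, e⟩

theorem OVSpace.leftAll_mul_mem {a c : A} {i : Fin n} (ha : a ∈ P.leftAll x)
    (hc : c ∈ P.bimoduleAlg (x i)) : a * c ∈ P.leftAll x := by
  refine mul_mem_closedSpan (t := {c}) ?_ ha (subset_closedSpan rfl)
  rintro a ⟨b, L, hL, rfl⟩ c' hc'
  rw [Set.mem_singleton_iff.1 hc']
  exact subset_closedSpan ⟨b, L ++ [(i, c)], hL.append (.singleton hc), by simp [mul_assoc]⟩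

theorem OVSpace.mul_rightAll_mem {a c : A} {i : Fin n} (ha : a ∈ P.rightAll x)
    (hc : c ∈ P.bimoduleAlg (x i)) : c * a ∈ P.rightAll x := by
  refine mul_mem_closedSpan (s := {c}) ?_ (subset_closedSpan rfl) ha
  rintro c' hc' a ⟨b, L, hL, rfl⟩
  rw [Set.mem_singleton_iff.1 hc']
  exact subset_closedSpan ⟨b, (i, c) :: L, (IsWord.singleton hc).append hL, by simp [mul_assoc]⟩

/-- A nonempty lower word shields whatever stands to its left: the last letter of the product has
index below `j`, even if earlier letters have index `j`. This is why `lowerWords` excludes the empty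
word. -/
theorem OVSpace.leftAll_mul_lowerWords_mem {a c : A} (ha : a ∈ P.leftAll x)
    (hc : c ∈ (P.lowerWords x j).topologicalClosure) : a * c ∈ P.leftWords x j := by
  refine mul_mem_closedSpan ?_ ha hc
  rintro a ⟨b, L, hL, rfl⟩ c ⟨M, hM0, hM, hj, rfl⟩
  refine subset_closedSpan ⟨b, L ++ M, hL.append hM, fun p hp => ?_, by simp [mul_assoc]⟩
  rw [List.getLast?_append_of_ne_nil _ hM0] at hp
  exact hj p (List.mem_of_getLast? hp)

theorem OVSpace.lowerWords_mul_rightAll_mem {a c : A} (ha : a ∈ P.rightAll x)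
    (hc : c ∈ (P.lowerWords x j).topologicalClosure) : c * a ∈ P.rightWords x j := by
  refine mul_mem_closedSpan ?_ hc ha
  rintro c ⟨M, hM0, hM, hj, rfl⟩ a ⟨b, L, hL, rfl⟩
  refine subset_closedSpan ⟨b, M ++ L, hM.append hL, fun p hp => ?_, by simp [mul_assoc]⟩
  rw [List.head?_append_of_ne_nil _ hM0] at hp
  exact hj p (List.mem_of_head? hp)

variable {P}

/-- Monotone independence, extended to closed spans. -/
theorem OVSpace.MonotoneIndep.E_mul_mul (h : P.MonotoneIndep x) {p y q : A}
    (hp : p ∈ P.leftWords x j) (hy : y ∈ P.bimoduleAlg (x j)) (hq : q ∈ P.rightWords x j) :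
    P.E (p * y * q) = P.E (p * P.incl (P.E y) * q) := by
  -- The defect of the replacement rule is bilinear in `(p, q)` and continuous in each, so its
  -- vanishing on words extends to the closed spans one variable at a time.
  set f : A →ₗ[ℂ] A →ₗ[ℂ] B := LinearMap.mk₂ ℂ
    (fun p q => P.E (p * (y - P.incl (P.E y)) * q))
    (fun a b c => by rw [add_mul, add_mul, map_add])
    (fun r a c => by rw [smul_mul_assoc, smul_mul_assoc, map_smul])
    (fun a b c => by rw [mul_add, map_add])
    (fun r a c => by rw [mul_smul_comm, map_smul]) with hf
  have hfa : ∀ p q, f p q = P.E (p * (y - P.incl (P.E y)) * q) := fun _ _ => rfl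
  suffices f p q = 0 by
    rw [hfa, mul_sub, sub_mul, map_sub, sub_eq_zero] at this
    exact this
  have h1 : ∀ p ∈ {a | ∃ b L, P.IsWord x L ∧ (∀ p ∈ L.getLast?, p.1 < j) ∧
      a = P.incl b * (L.map Prod.snd).prod}, ∀ q ∈ P.rightWords x j, f p q = 0 := by
    rintro _ ⟨b, L, hL, hLj, rfl⟩ q hq
    have hle : P.rightWords x j ≤ LinearMap.ker (f (P.incl b * (L.map Prod.snd).prod)) := by
      refine Submodule.topologicalClosure_minimal _ (Submodule.span_le.2 ?_) ?_
      · rintro _ ⟨c, R, hR, hRj, rfl⟩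
        have := h L R j y hL hR hy hLj hRj
        rw [SetLike.mem_coe, LinearMap.mem_ker, hfa]
        have e : P.incl b * (L.map Prod.snd).prod * (y - P.incl (P.E y)) *
            ((R.map Prod.snd).prod * P.incl c) =
            P.incl b * ((L.map Prod.snd).prod * y * (R.map Prod.snd).prod -
              (L.map Prod.snd).prod * P.incl (P.E y) * (R.map Prod.snd).prod) * P.incl c := by
          noncomm_ring
        rw [e, P.E_bimodule, map_sub, this, sub_self, mul_zero, zero_mul]
      · have hc : Continuous fun q => P.E (P.incl b * (L.map Prod.snd).prod *
            (y - P.incl (P.E y)) * q) := P.continuous_E.comp (continuous_const_mul _)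
        exact isClosed_singleton.preimage hc
    exact hle hq
  have hle : P.leftWords x j ≤ LinearMap.ker (f.flip q) := by
    refine Submodule.topologicalClosure_minimal _ (Submodule.span_le.2 fun p hp => h1 p hp q hq) ?_
    have hc : Continuous fun p => P.E (p * (y - P.incl (P.E y)) * q) :=
      P.continuous_E.comp (by fun_prop)
    exact isClosed_singleton.preimage hc
  exact hle hp

variable (P)

theorem OVSpace.lowerWords_mul_incl_mem {a : A} (ha : a ∈ P.lowerWords x j) (b : B) :
    a * P.incl b ∈ P.lowerWords x j := by
  induction ha using Submodule.span_induction with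
  | mem a ha =>
    obtain ⟨L, hL0, hL, hj, rfl⟩ := ha
    obtain ⟨L, c, rfl⟩ := List.eq_nil_or_concat' L |>.resolve_left hL0
    refine Submodule.subset_span ⟨L ++ [(c.1, c.2 * P.incl b)], by simp, ?_, ?_,
      by simp [mul_assoc]⟩
    · exact IsWord.append (fun p hp => hL p (by simp [hp]))
        (.singleton (P.mul_incl_mem_bimoduleAlg (hL c (by simp)) b))
    · intro p hp
      rcases List.mem_append.1 hp with hp | hp
      · exact hj p (by simp [hp])
      · rw [List.mem_singleton.1 hp]; exact hj c (by simp)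
  | zero => simp
  | add a c _ _ ha hc => rw [add_mul]; exact add_mem ha hc
  | smul r a _ ha => rw [smul_mul_assoc]; exact Submodule.smul_mem _ _ ha

theorem OVSpace.incl_mul_lowerWords_mem {a : A} (ha : a ∈ P.lowerWords x j) (b : B) :
    P.incl b * a ∈ P.lowerWords x j := by
  induction ha using Submodule.span_induction with
  | mem a ha =>
    obtain ⟨L, hL0, hL, hj, rfl⟩ := ha
    obtain _ | ⟨c, L⟩ := L
    · exact absurd rfl hL0
    refine Submodule.subset_span ⟨(c.1, P.incl b * c.2) :: L, by simp, ?_, ?_,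
      by simp [mul_assoc]⟩
    · exact IsWord.append (.singleton (P.incl_mul_mem_bimoduleAlg (hL c (by simp)) b))
        (fun p hp => hL p (by simp [hp]))
    · intro p hp
      rcases List.mem_cons.1 hp with rfl | hp
      · exact hj c (by simp)
      · exact hj p (by simp [hp])
  | zero => simp
  | add a c _ _ ha hc => rw [mul_add]; exact add_mem ha hc
  | smul r a _ ha => rw [mul_smul_comm]; exact Submodule.smul_mem _ _ ha

theorem OVSpace.lowerWords_mul_mem {a c : A} (ha : a ∈ P.lowerWords x j)
    (hc : c ∈ P.lowerWords x j) : a * c ∈ P.lowerWords x j := by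
  induction ha using Submodule.span_induction with
  | mem a ha =>
    obtain ⟨L, hL0, hL, hj, rfl⟩ := ha
    induction hc using Submodule.span_induction with
    | mem c hc =>
      obtain ⟨M, hM0, hM, hjM, rfl⟩ := hc
      exact Submodule.subset_span ⟨L ++ M, by simp [hL0], hL.append hM,
        fun p hp => (List.mem_append.1 hp).elim (hj p) (hjM p), by simp⟩
    | zero => simp
    | add a c _ _ ha hc => rw [mul_add]; exact add_mem ha hc
    | smul r a _ ha => rw [mul_smul_comm]; exact Submodule.smul_mem _ _ ha
  | zero => simp
  | add a c _ _ ha hc => rw [add_mul]; exact add_mem ha hc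
  | smul r a _ ha => rw [smul_mul_assoc]; exact Submodule.smul_mem _ _ ha

theorem OVSpace.mem_lowerWords {i : Fin n} (hi : i < j) : x i ∈ P.lowerWords x j :=
  Submodule.subset_span ⟨[(i, x i)], by simp, .singleton (P.self_mem_bimoduleAlg _),
    by simpa using hi, by simp⟩

variable (x j)

/-- The C*-algebra generated by `B` and the `x i` with `i < j`. -/
noncomputable def OVSpace.lowerAlg : StarSubalgebra ℂ A :=
  (StarAlgebra.adjoin ℂ (Set.range P.incl ∪ x '' Set.Iio j)).topologicalClosure

variable {x j}

/-- Nonempty lower words absorb multiplication by `B` and by the lower `x i` on both sides, hence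
their closure absorbs the generated C*-algebra. The single factor `S` keeps every word nonempty. -/
theorem OVSpace.mul_lowerAlg_mem (hsa : ∀ i, IsSelfAdjoint (x i)) {S c : A}
    (hS : S ∈ Submodule.span ℂ (x '' Set.Iio j)) (hc : c ∈ P.lowerAlg x j) :
    S * c ∈ (P.lowerWords x j).topologicalClosure ∧
      c * S ∈ (P.lowerWords x j).topologicalClosure := by
  have hS' : S ∈ P.lowerWords x j := by
    refine Submodule.span_le.2 ?_ hS
    rintro _ ⟨i, hi, rfl⟩
    exact P.mem_lowerWords hi
  have h1 : ∀ c ∈ StarAlgebra.adjoin ℂ (Set.range P.incl ∪ x '' Set.Iio j),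
      ∀ l ∈ P.lowerWords x j, l * c ∈ P.lowerWords x j ∧ c * l ∈ P.lowerWords x j := by
    intro c hc
    rw [← StarSubalgebra.mem_toSubalgebra, StarAlgebra.adjoin_toSubalgebra] at hc
    induction hc using Algebra.adjoin_induction with
    | mem c hc =>
      intro l hl
      have : c ∈ Set.range P.incl ∪ x '' Set.Iio j := by
        rcases hc with hc | hc
        · exact hc
        · rcases hc with ⟨b, hb⟩ | ⟨i, hi, hb⟩
          · exact Or.inl ⟨star b, by rw [map_star, hb, star_star]⟩
          · refine Or.inr ⟨i, hi, ?_⟩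
            rw [← (hsa i).star_eq, hb, star_star]
      rcases this with ⟨b, rfl⟩ | ⟨i, hi, rfl⟩
      · exact ⟨P.lowerWords_mul_incl_mem hl b, P.incl_mul_lowerWords_mem hl b⟩
      · exact ⟨P.lowerWords_mul_mem hl (P.mem_lowerWords hi),
          P.lowerWords_mul_mem (P.mem_lowerWords hi) hl⟩
    | algebraMap r =>
      intro l hl
      rw [← Algebra.commutes, ← Algebra.smul_def]
      exact ⟨Submodule.smul_mem _ _ hl, Submodule.smul_mem _ _ hl⟩
    | add a c _ _ ha hc =>
      intro l hl
      rw [mul_add, add_mul]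
      exact ⟨add_mem (ha l hl).1 (hc l hl).1, add_mem (ha l hl).2 (hc l hl).2⟩
    | mul a c _ _ ha hc =>
      intro l hl
      constructor
      · rw [← mul_assoc]; exact (hc _ (ha l hl).1).1
      · rw [mul_assoc]; exact (ha _ (hc l hl).2).2
  have hc' : c ∈ closure ((StarAlgebra.adjoin ℂ (Set.range P.incl ∪ x '' Set.Iio j) :
      StarSubalgebra ℂ A) : Set A) := hc
  constructor
  · exact map_mem_closure (continuous_const_mul S) hc' (fun a ha => (h1 a ha S hS').1)
  · exact map_mem_closure (f := fun a => a * S) (continuous_mul_const S) hc'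
      (fun a ha => (h1 a ha S hS').2)

theorem OVSpace.incl_mem_lowerAlg (b : B) : P.incl b ∈ P.lowerAlg x j :=
  StarSubalgebra.le_topologicalClosure _ (StarAlgebra.subset_adjoin _ _ (Or.inl ⟨b, rfl⟩))

theorem OVSpace.span_le_lowerAlg {S : A} (hS : S ∈ Submodule.span ℂ (x '' Set.Iio j)) :
    S ∈ P.lowerAlg x j := by
  have : Submodule.span ℂ (x '' Set.Iio j) ≤ (P.lowerAlg x j).toSubalgebra.toSubmodule := by
    refine Submodule.span_le.2 fun a ha => ?_
    exact StarSubalgebra.le_topologicalClosure _ (StarAlgebra.subset_adjoin _ _ (Or.inr ha))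
  exact this hS

/-- Spectral permanence for C*-subalgebras. It gives resolvents at every point of the half plane,
beyond the range of the Neumann series. -/
theorem OVSpace.inverse_mem_lowerAlg {a : A} (ha : a ∈ P.lowerAlg x j) (hu : IsUnit a) :
    a⁻¹ʳ ∈ P.lowerAlg x j := by
  have hcl : IsClosed ((P.lowerAlg x j : StarSubalgebra ℂ A) : Set A) :=
    StarSubalgebra.isClosed_topologicalClosure _
  have h1 : IsUnit (⟨a, ha⟩ : P.lowerAlg x j) :=
    (StarSubalgebra.coe_isUnit (S := P.lowerAlg x j) (a := ⟨a, ha⟩)).1 hu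
  obtain ⟨u, hu'⟩ := h1
  have e : a⁻¹ʳ = ((u⁻¹ : (P.lowerAlg x j)ˣ) : P.lowerAlg x j) := by
    refine left_inv_eq_right_inv (Ring.inverse_mul_cancel a hu) ?_
    have := congrArg (Subtype.val) (u.mul_inv)
    rw [hu'] at this
    exact this
  rw [e]
  exact Subtype.mem _

/-- The resolvent of a combination of the `x i` with `i < j` is a coefficient plus a limit of
words. -/
theorem OVSpace.resolvent_sub_mem (hsa : ∀ i, IsSelfAdjoint (x i)) {S : A}
    (hS : S ∈ Submodule.span ℂ (x '' Set.Iio j)) {w : B} (hw : IsUnit w)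
    (hu : IsUnit (P.incl w - S)) :
    P.resolvent S w - P.incl w⁻¹ʳ ∈ (P.lowerWords x j).topologicalClosure ∧
    star (P.resolvent S w) - P.incl (star w⁻¹ʳ) ∈ (P.lowerWords x j).topologicalClosure := by
  have hG : P.resolvent S w ∈ P.lowerAlg x j :=
    P.inverse_mem_lowerAlg (sub_mem (P.incl_mem_lowerAlg w) (P.span_le_lowerAlg hS)) hu
  have e0 : P.incl w * P.incl w⁻¹ʳ = 1 := by
    rw [← map_mul, Ring.mul_inverse_cancel w hw, map_one]
  have e : P.resolvent S w - P.incl w⁻¹ʳ = P.resolvent S w * S * P.incl w⁻¹ʳ := by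
    have h1 : P.resolvent S w * (P.incl w - S) = 1 := Ring.inverse_mul_cancel _ hu
    have h2 := congrArg (· * P.incl w⁻¹ʳ) h1
    simp only [mul_sub, sub_mul, one_mul, mul_assoc, e0, mul_one] at h2
    nth_rewrite 1 [← h2]; simp [mul_assoc]
  -- The mirror image of `e`; its adjoint has the coefficient on the right, as needed for the second
  -- claim.
  have e' : P.resolvent S w - P.incl w⁻¹ʳ = P.incl w⁻¹ʳ * (S * P.resolvent S w) := by
    have e0 : P.incl w⁻¹ʳ * P.incl w = 1 := by
      rw [← map_mul, Ring.inverse_mul_cancel w hw, map_one]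
    have h1 : (P.incl w - S) * P.resolvent S w = 1 := Ring.mul_inverse_cancel _ hu
    have h2 := congrArg (P.incl w⁻¹ʳ * ·) h1
    simp only [mul_sub, sub_mul, mul_one, ← mul_assoc, e0, one_mul] at h2
    nth_rewrite 1 [← h2]; simp [mul_assoc]
  have hSs : star S ∈ Submodule.span ℂ (x '' Set.Iio j) := by
    clear e e' hG hu
    induction hS using Submodule.span_induction with
    | mem a ha =>
      obtain ⟨i, hi, rfl⟩ := ha
      rw [(hsa i).star_eq]
      exact Submodule.subset_span ⟨i, hi, rfl⟩
    | zero => simp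
    | add a c _ _ ha hc => rw [star_add]; exact add_mem ha hc
    | smul r a _ ha => rw [star_smul]; exact Submodule.smul_mem _ _ ha
  have right : ∀ a ∈ (P.lowerWords x j).topologicalClosure, ∀ b : B,
      a * P.incl b ∈ (P.lowerWords x j).topologicalClosure := fun a ha b =>
    map_mem_closure (f := fun a => a * P.incl b) (continuous_mul_const (P.incl b)) ha
      (fun c hc => P.lowerWords_mul_incl_mem hc b)
  constructor
  · rw [e]
    exact right _ (P.mul_lowerAlg_mem hsa hS hG).2 _
  · have : star (P.resolvent S w) - P.incl (star w⁻¹ʳ) =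
        star (P.resolvent S w) * star S * P.incl (star w⁻¹ʳ) := by
      rw [map_star, ← star_sub, e', star_mul, star_mul]
    rw [this]
    exact right _ (P.mul_lowerAlg_mem hsa hSs (star_mem hG)).2 _

end Independence

/-! ### Expansions of the Cauchy transform in one summand and along the flow. -/

section Lindeberg

variable {B : Type u} {A : Type v}
  [CStarAlgebra B] [PartialOrder B] [StarOrderedRing B]
  [CStarAlgebra A] [PartialOrder A] [StarOrderedRing A] {n : ℕ}
  {P : OVSpace B A} {x : Fin n → A} {j : Fin n}

theorem OVSpace.MonotoneIndep.E_mul_mul_eq_zero (h : P.MonotoneIndep x) {p y q : A}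
    (hp : p ∈ P.leftWords x j) (hy : y ∈ P.bimoduleAlg (x j)) (hq : q ∈ P.rightWords x j)
    (hy0 : P.E y = 0) : P.E (p * y * q) = 0 := by
  rw [h.E_mul_mul hp hy hq, hy0, map_zero, mul_zero, zero_mul, map_zero]

/-- Replacing `y G y` by its expectation, for a resolvent-like `G = b + g` with `g` in the closed
span of lower words. -/
theorem OVSpace.MonotoneIndep.E_second_order (h : P.MonotoneIndep x) {y G H : A} {b : B}
    (hy : y ∈ P.bimoduleAlg (x j)) (hy0 : P.E y = 0) (hH : H ∈ P.leftWords x j)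
    (hG : G ∈ P.rightWords x j) (hGb : G - P.incl b ∈ (P.lowerWords x j).topologicalClosure) :
    P.E (H * y * G * y * G) = P.E (H * P.incl (P.variance y b) * G) := by
  obtain ⟨g, rfl⟩ : ∃ g, G = P.incl b + g := ⟨G - P.incl b, by abel⟩
  rw [add_sub_cancel_left] at hGb
  set G := P.incl b + g with hGdef
  -- Only the inner `G` is split. With `b` the two `y` merge into one factor of index `j`; with `g`
  -- the first `y` is an isolated local maximum, and its mean is zero.
  have e : H * y * G * y * G = H * (y * P.incl b * y) * G + H * y * (g * (y * G)) := by
    rw [hGdef]; noncomm_ring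
  rw [e, map_add, h.E_mul_mul_eq_zero hH hy
    (P.lowerWords_mul_rightAll_mem (P.mul_rightAll_mem (P.rightWords_le_rightAll hG) hy) hGb) hy0,
    add_zero, h.E_mul_mul hH (P.mul_mem_bimoduleAlg (P.mul_incl_mem_bimoduleAlg hy b) hy) hG]
  rfl

/-- Both inner factors are split into coefficient plus lower words. The lower part of the inner `H`
isolates the first `y`; if `H` contributes `c`, the lower part of the inner `G` isolates the last
`y`. Only the term with both coefficients survives. -/
theorem OVSpace.MonotoneIndep.E_fourth_order (h : P.MonotoneIndep x) {y G H : A} {b c : B}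
    (hy : y ∈ P.bimoduleAlg (x j)) (hy0 : P.E y = 0) (hH : H ∈ P.leftWords x j)
    (hHc : H - P.incl c ∈ (P.lowerWords x j).topologicalClosure)
    (hG : G ∈ P.rightWords x j) (hGb : G - P.incl b ∈ (P.lowerWords x j).topologicalClosure) :
    P.E (H * y * H * y ^ 2 * G * y * G) =
      P.E (H * P.incl (P.E (y * P.incl c * y ^ 2 * P.incl b * y)) * G) := by
  obtain ⟨g, rfl⟩ : ∃ g, G = P.incl b + g := ⟨G - P.incl b, by abel⟩
  rw [add_sub_cancel_left] at hGb
  obtain ⟨k, rfl⟩ : ∃ k, H = P.incl c + k := ⟨H - P.incl c, by abel⟩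
  rw [add_sub_cancel_left] at hHc
  set G := P.incl b + g with hGdef
  set H := P.incl c + k with hHdef
  have hy2 : y ^ 2 ∈ P.bimoduleAlg (x j) := by rw [sq]; exact P.mul_mem_bimoduleAlg hy hy
  have e : H * y * H * y ^ 2 * G * y * G =
      H * (y * P.incl c * y ^ 2 * P.incl b * y) * G +
      H * y * (k * ((y ^ 2 * P.incl b * y) * G)) +
      H * y * (k * (y ^ 2 * (g * (y * G)))) +
      (H * (y * P.incl c * y ^ 2) * g) * y * G := by
    have : H * y * H * y ^ 2 * G * y * G =
        H * y * (P.incl c + k) * y ^ 2 * (P.incl b + g) * y * G := by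
      rw [← hGdef, ← hHdef]
    rw [this]
    noncomm_ring
  have hyG := P.mul_rightAll_mem (P.rightWords_le_rightAll hG) hy
  have m1 := P.mul_mem_bimoduleAlg (P.mul_incl_mem_bimoduleAlg hy2 b) hy
  have m2 := P.mul_mem_bimoduleAlg (P.mul_incl_mem_bimoduleAlg hy c) hy2
  have m3 := P.mul_mem_bimoduleAlg (P.mul_incl_mem_bimoduleAlg m2 b) hy
  rw [e, map_add, map_add, map_add,
    h.E_mul_mul_eq_zero hH hy (P.lowerWords_mul_rightAll_mem
      (P.mul_rightAll_mem (P.rightWords_le_rightAll hG) m1) hHc) hy0,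
    h.E_mul_mul_eq_zero hH hy (P.lowerWords_mul_rightAll_mem (P.mul_rightAll_mem
      (P.rightWords_le_rightAll (P.lowerWords_mul_rightAll_mem hyG hGb)) hy2) hHc) hy0,
    h.E_mul_mul_eq_zero (P.leftAll_mul_lowerWords_mem
      (P.leftAll_mul_mem (P.leftWords_le_leftAll hH) m2) hGb) hy hG hy0,
    add_zero, add_zero, add_zero, h.E_mul_mul hH m3 hG]

theorem OVSpace.norm_mul_incl_mul_le (P : OVSpace B A) (G H : A) (b : B) :
    ‖P.E (H * P.incl b * G)‖ ≤ ‖H‖ * ‖b‖ * ‖G‖ :=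
  (P.norm_E_le _).trans (norm_mul₃_le.trans (by gcongr; exact P.incl_norm_le b))

/-- Third order expansion of the Cauchy transform of a sum of monotone independent elements in the
last summand. -/
theorem OVSpace.MonotoneIndep.norm_cauchy_add_sub_le (h : P.MonotoneIndep x)
    (hsa : ∀ i, IsSelfAdjoint (x i)) {S y : A} (hS : S ∈ Submodule.span ℂ (x '' Set.Iio j))
    (hSsa : IsSelfAdjoint S) (hy : y ∈ P.bimoduleAlg (x j)) (hysa : IsSelfAdjoint y)
    (hy0 : P.E y = 0) {a₂ a₄ δ : ℝ} (hδ : 0 < δ) (h2 : ‖P.E (y ^ 2)‖ ≤ a₂)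
    (h4 : ∀ b, ‖P.E (y * star (P.incl b) * y ^ 2 * P.incl b * y)‖ ≤ a₄ * ‖b‖ ^ 2) (ha4 : 0 ≤ a₄)
    {w : B} (hw : w ∈ halfSpace B δ) :
    ‖P.cauchy (S + y) w - P.cauchy S w -
      P.E (P.resolvent S w * P.incl (P.variance y w⁻¹ʳ) * P.resolvent S w)‖ ≤
      √a₂ * √a₄ * δ⁻¹ ^ 4 := by
  have ha2 : 0 ≤ a₂ := (norm_nonneg _).trans h2
  have hwu := isUnit_of_mem_halfSpace hδ hw
  have mS := P.incl_sub_mem_halfSpace hw hSsa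
  have mSy := P.incl_sub_mem_halfSpace hw (hSsa.add hysa)
  set G := P.resolvent S w with hG
  set G' := P.resolvent (S + y) w with hG'
  set β := w⁻¹ʳ with hβ
  have nG : ‖G‖ ≤ δ⁻¹ := norm_inverse_le_of_mem_halfSpace hδ mS
  have nG' : ‖G'‖ ≤ δ⁻¹ := norm_inverse_le_of_mem_halfSpace hδ mSy
  have nβ : ‖β‖ ≤ δ⁻¹ := norm_inverse_le_of_mem_halfSpace hδ hw
  obtain ⟨r1, r2⟩ := P.resolvent_sub_mem hsa hS hwu (isUnit_of_mem_halfSpace hδ mS)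
  rw [← hG, ← hβ] at r1 r2
  have gl : ∀ {a : A} {b : B}, a - P.incl b ∈ (P.lowerWords x j).topologicalClosure →
      a ∈ P.leftWords x j ∧ a ∈ P.rightWords x j := by
    intro a b hab
    constructor
    · simpa using add_mem (P.incl_mem_leftWords x j b) (P.lowerWords_le_leftWords x j hab)
    · simpa using add_mem (P.incl_mem_rightWords x j b) (P.lowerWords_le_rightWords x j hab)
  have hy2 : y ^ 2 ∈ P.bimoduleAlg (x j) := by rw [sq]; exact P.mul_mem_bimoduleAlg hy hy
  have i1 : G' - G = G' * y * G := by
    have := inverse_sub_inverse (isUnit_of_mem_halfSpace hδ mSy) (isUnit_of_mem_halfSpace hδ mS)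
    have e : P.incl w - S - (P.incl w - (S + y)) = y := by abel
    rwa [e] at this
  have i2 : G' - G = G * y * G' := by
    have := inverse_sub_inverse (isUnit_of_mem_halfSpace hδ mS) (isUnit_of_mem_halfSpace hδ mSy)
    have e : P.incl w - (S + y) - (P.incl w - S) = -y := by abel
    rw [e, mul_neg, neg_mul, ← neg_sub, neg_inj] at this
    exact this
  -- The perturbed resolvent `G'` contains `y`, so independence does not apply to it. The expansion
  -- leaves it in the remainder only, where its norm bound suffices.
  have e : G' - G = G * y * G + G * y * G * y * G + (G * y) * (G' * y * G * y * G) := by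
    have j1 : G' = G + G' * y * G := by rw [← i1]; abel
    have j2 : G' = G + G * y * G' := by rw [← i2]; abel
    calc G' - G = G' * y * G := i1
      _ = (G + G * y * G') * y * G := by rw [← j2]
      _ = G * y * G + G * y * G' * y * G := by noncomm_ring
      _ = G * y * G + G * y * (G + G' * y * G) * y * G := by rw [← j1]
      _ = _ := by noncomm_ring
  have e1 : P.E (G * y * G) = 0 := h.E_mul_mul_eq_zero (gl r1).1 hy (gl r1).2 hy0
  have e2 := h.E_second_order hy hy0 (gl r1).1 (gl r1).2 r1
  have e3 : P.cauchy (S + y) w - P.cauchy S w -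
      P.E (G * P.incl (P.variance y β) * G) = P.E ((G * y) * (G' * y * G * y * G)) := by
    change P.E G' - P.E G - _ = _
    rw [← map_sub, e, map_add, map_add, e1, e2]
    abel
  rw [e3]
  -- Cauchy-Schwarz cuts the remainder into `v*` with one `y` and `G' u` with two. Once `G'` is
  -- removed in norm, `v* v` and `u* u` are words to which independence applies, giving the second
  -- and the fourth moment.
  set v : A := y * star G with hv
  have sv : star v = G * y := by rw [hv, star_mul, star_star, hysa.star_eq]
  have b1 : ‖P.E (star v * v)‖ ≤ a₂ * δ⁻¹ ^ 2 := by
    have : star v * v = G * y ^ 2 * star G := by rw [sv, hv]; noncomm_ring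
    rw [this, h.E_mul_mul (gl r1).1 hy2 (gl r2).2]
    refine (P.norm_mul_incl_mul_le _ _ _).trans ?_
    rw [norm_star]
    calc _ ≤ δ⁻¹ * a₂ * δ⁻¹ := by gcongr
      _ = _ := by ring
  set u : A := y * G * y * G with hu
  have b2 : ‖P.E (star (G' * u) * (G' * u))‖ ≤ a₄ * δ⁻¹ ^ 6 := by
    have eu : star (G' * u) * (G' * u) = star u * (star G' * G') * u := by
      rw [star_mul]; noncomm_ring
    have eu2 : star u * u = star G * y * star G * y ^ 2 * G * y * G := by
      rw [hu]; simp only [star_mul, hysa.star_eq]; noncomm_ring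
    have h5 := P.norm_E_conj_le u (star_mul_self_nonneg G')
    rw [CStarRing.norm_star_mul_self, eu2,
      h.E_fourth_order hy hy0 (gl r2).1 r2 (gl r1).2 r1] at h5
    rw [eu]
    refine h5.trans ?_
    have h6 := P.norm_mul_incl_mul_le G (star G)
      (P.E (y * P.incl (star β) * y ^ 2 * P.incl β * y))
    have h7 := h4 β
    rw [← map_star] at h7
    rw [norm_star] at h6
    have h8 : a₄ * ‖β‖ ^ 2 ≤ a₄ * δ⁻¹ ^ 2 := by gcongr
    calc _ ≤ δ⁻¹ * δ⁻¹ * (δ⁻¹ * (a₄ * δ⁻¹ ^ 2) * δ⁻¹) := by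
          gcongr
          refine h6.trans ?_
          have := h7.trans h8
          gcongr
      _ = _ := by ring
  have e5 : (G * y) * (G' * y * G * y * G) = star v * (G' * u) := by
    rw [sv, hu]; noncomm_ring
  rw [e5]
  refine (P.norm_E_le_sqrt _ _).trans ?_
  calc _ ≤ √(a₂ * δ⁻¹ ^ 2) * √(a₄ * δ⁻¹ ^ 6) := by gcongr
    _ = √a₂ * δ⁻¹ * (√a₄ * δ⁻¹ ^ 3) := by
      rw [Real.sqrt_mul ha2, Real.sqrt_mul ha4, Real.sqrt_sq (by positivity)]
      have : δ⁻¹ ^ 6 = (δ⁻¹ ^ 3) ^ 2 := by ring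
      rw [this, Real.sqrt_sq (by positivity)]
    _ = _ := by ring

/-- Second order expansion of the Cauchy transform along the flow. -/
theorem OVSpace.norm_cauchy_flow_sub_le (P : OVSpace B A) {S : A} (hS : IsSelfAdjoint S)
    {η : B →L[ℂ] B} (hη : IsPositiveMap η) {K s δ : ℝ} (hK : ‖η‖ ≤ K) (hs : 0 ≤ s) (hδ : 0 < δ)
    {w : B} (hw : w ∈ halfSpace B δ) :
    ‖P.cauchy S (flow η s w) - P.cauchy S w -
      s • P.E (P.resolvent S w * P.incl (η w⁻¹ʳ) * P.resolvent S w)‖ ≤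
      3 / 2 * K ^ 2 * δ⁻¹ ^ 5 * s ^ 2 := by
  have hK0 : 0 ≤ K := (norm_nonneg _).trans hK
  have nG : ∀ c ∈ halfSpace B δ, ‖P.resolvent S c‖ ≤ δ⁻¹ := fun c hc =>
    norm_inverse_le_of_mem_halfSpace hδ (P.incl_sub_mem_halfSpace hc hS)
  have diff : ∀ c ∈ halfSpace B δ, ∀ d ∈ halfSpace B δ,
      P.resolvent S c - P.resolvent S d =
        P.resolvent S c * P.incl (d - c) * P.resolvent S d := by
    intro c hc d hd
    have := inverse_sub_inverse (isUnit_of_mem_halfSpace hδ (P.incl_sub_mem_halfSpace hc hS))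
      (isUnit_of_mem_halfSpace hδ (P.incl_sub_mem_halfSpace hd hS))
    rwa [sub_sub_sub_cancel_right, ← map_sub] at this
  have lipG : ∀ c ∈ halfSpace B δ, ∀ d ∈ halfSpace B δ,
      ‖P.resolvent S c - P.resolvent S d‖ ≤ δ⁻¹ ^ 2 * ‖c - d‖ := by
    intro c hc d hd
    rw [diff c hc d hd]
    have := nG c hc
    have := nG d hd
    have := P.incl_norm_le (d - c)
    calc _ ≤ _ := norm_mul₃_le
      _ ≤ δ⁻¹ * ‖d - c‖ * δ⁻¹ := by gcongr
      _ = _ := by rw [norm_sub_rev]; ring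
  have nη : ∀ c ∈ halfSpace B δ, ‖P.incl (η c⁻¹ʳ)‖ ≤ K * δ⁻¹ := fun c hc =>
    (P.incl_norm_le _).trans (η.le_of_opNorm_le_of_le hK (norm_inverse_le_of_mem_halfSpace hδ hc))
  -- `ψ` is the derivative of `Φ` in the direction `-η(c⁻¹)` of the flow.
  refine hη.norm_flow_expansion_le hK hs hδ (Φ := P.cauchy S)
    (ψ := fun c => P.E (P.resolvent S c * P.incl (η c⁻¹ʳ) * P.resolvent S c)) ?_ ?_ ?_ hw
  · have : LipschitzOnWith (Real.toNNReal (δ⁻¹ ^ 2)) (P.cauchy S) (halfSpace B δ) := by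
      refine LipschitzOnWith.of_dist_le_mul fun c hc d hd => ?_
      rw [dist_eq_norm, dist_eq_norm, Real.coe_toNNReal _ (by positivity), OVSpace.cauchy,
        OVSpace.cauchy, ← map_sub]
      exact (P.norm_E_le _).trans (lipG c hc d hd)
    exact this.continuousOn
  · intro h hh c hc
    have hc' := hη.eulerStep_mem hh hδ hc
    set c' := eulerStep η h c with hc'def
    set G := P.resolvent S c
    set G' := P.resolvent S c'
    have e0 : c - c' = h • η c⁻¹ʳ := by rw [hc'def, eulerStep]; abel
    have e1 : P.incl (c - c') = h • P.incl (η c⁻¹ʳ) := by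
      rw [e0, ← Complex.coe_smul, map_smul, Complex.coe_smul]
    have d1 : G' - G = h • (G' * P.incl (η c⁻¹ʳ) * G) := by
      rw [diff c' hc' c hc, e1, mul_smul_comm, smul_mul_assoc]
    have e2 : P.cauchy S c' - P.cauchy S c - h • P.E (G * P.incl (η c⁻¹ʳ) * G) =
        P.E (h • ((G' - G) * P.incl (η c⁻¹ʳ) * G)) := by
      change P.E G' - P.E G - _ = _
      rw [← map_sub, ← P.E_real_smul, ← map_sub, sub_mul, sub_mul, smul_sub, ← d1]
    rw [e2]
    refine (P.norm_E_le _).trans ?_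
    rw [norm_smul, Real.norm_of_nonneg hh]
    have h1 := nη c hc
    have h2 := nG c hc
    have h3 := lipG c' hc' c hc
    have h4 : ‖c' - c‖ ≤ h * K * δ⁻¹ := norm_eulerStep_sub_self_le hK hh hδ hc
    calc _ ≤ h * (‖G' - G‖ * ‖P.incl (η c⁻¹ʳ)‖ * ‖G‖) := by gcongr; exact norm_mul₃_le
      _ ≤ h * ((δ⁻¹ ^ 2 * (h * K * δ⁻¹)) * (K * δ⁻¹) * δ⁻¹) := by
          gcongr
          exact h3.trans (by gcongr)
      _ = _ := by ring
  · intro c hc d hd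
    set G := P.resolvent S c
    set H := P.resolvent S d
    -- Three factors vary, and each contributes `K δ⁻⁴` to the Lipschitz constant; this is the `3`
    -- in the expansion lemma.
    have e : G * P.incl (η c⁻¹ʳ) * G - H * P.incl (η d⁻¹ʳ) * H =
        (G - H) * P.incl (η c⁻¹ʳ) * G + H * P.incl (η (c⁻¹ʳ - d⁻¹ʳ)) * G +
          H * P.incl (η d⁻¹ʳ) * (G - H) := by
      rw [map_sub, map_sub]; noncomm_ring
    simp only [← map_sub]
    refine (P.norm_E_le _).trans ?_
    rw [e]
    have n1 := nη c hc
    have n2 := nη d hd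
    have n3 : ‖G‖ ≤ δ⁻¹ := nG c hc
    have n4 : ‖H‖ ≤ δ⁻¹ := nG d hd
    have n5 : ‖G - H‖ ≤ _ := lipG c hc d hd
    have n6 : ‖P.incl (η (c⁻¹ʳ - d⁻¹ʳ))‖ ≤ K * (δ⁻¹ ^ 2 * ‖c - d‖) :=
      (P.incl_norm_le _).trans (η.le_of_opNorm_le_of_le hK (norm_inverse_sub_inverse_le hδ hc hd))
    calc _ ≤ ‖(G - H) * P.incl (η c⁻¹ʳ) * G‖ + ‖H * P.incl (η (c⁻¹ʳ - d⁻¹ʳ)) * G‖ +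
          ‖H * P.incl (η d⁻¹ʳ) * (G - H)‖ := norm_add₃_le
      _ ≤ (δ⁻¹ ^ 2 * ‖c - d‖) * (K * δ⁻¹) * δ⁻¹ + δ⁻¹ * (K * (δ⁻¹ ^ 2 * ‖c - d‖)) * δ⁻¹ +
          δ⁻¹ * (K * δ⁻¹) * (δ⁻¹ ^ 2 * ‖c - d‖) := by
          gcongr
          · exact norm_mul₃_le.trans (by gcongr)
          · exact norm_mul₃_le.trans (by gcongr)
          · exact norm_mul₃_le.trans (by gcongr)
      _ = _ := by ring

end Lindeberg

/-! ### Non-crossing pairings of intervals and their first-block decomposition. -/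

section Pairings

open Finset

/-- `p` restricts to a non-crossing pairing of the interval `[s, e)`, and is the identity off this
interval. -/
structure IsNCOn (s e : ℕ) (p : ℕ → ℕ) : Prop where
  le : ∀ i, s ≤ i → i < e → s ≤ p i
  lt : ∀ i, s ≤ i → i < e → p i < e
  ne : ∀ i, s ≤ i → i < e → p i ≠ i
  invol : ∀ i, p (p i) = i
  nc : ∀ i j, i < j → j < p i → ¬ p i < p j
  off : ∀ i, ¬ (s ≤ i ∧ i < e) → p i = i

/-- Extension of a self-map of `Fin k` by the identity. -/
def extendFin {k : ℕ} (σ : Fin k → Fin k) (i : ℕ) : ℕ := if h : i < k then (σ ⟨i, h⟩ : ℕ) else i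

theorem extendFin_coe {k : ℕ} (σ : Fin k → Fin k) (i : Fin k) : extendFin σ i = σ i := by
  simp [extendFin]

theorem extendFin_of_le {k : ℕ} (σ : Fin k → Fin k) {i : ℕ} (h : k ≤ i) : extendFin σ i = i := by
  simp [extendFin, h]

theorem extendFin_injective {k : ℕ} : Function.Injective (extendFin (k := k)) := by
  intro σ τ h
  funext i
  have := congrFun h i
  rw [extendFin_coe, extendFin_coe] at this
  exact Fin.ext this

theorem IsNCOn.exists_extendFin {s e : ℕ} {p : ℕ → ℕ} (h : IsNCOn s e p) :
    ∃ σ : Fin e → Fin e, extendFin σ = p := by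
  refine ⟨fun i => ⟨p i, ?_⟩, ?_⟩
  · by_cases hi : s ≤ (i : ℕ)
    · exact h.lt i hi i.2
    · rw [h.off i (by tauto)]; exact i.2
  · funext i
    by_cases hi : i < e
    · simp [extendFin, hi]
    · rw [extendFin_of_le _ (not_lt.1 hi), h.off i (by tauto)]

theorem finite_isNCOn (s e : ℕ) : {p | IsNCOn s e p}.Finite :=
  (Set.finite_range (extendFin (k := e))).subset fun _ hp => hp.exists_extendFin

/-- The non-crossing pairings of the interval `[s, e)`. -/
noncomputable def ncOn (s e : ℕ) : Finset (ℕ → ℕ) := (finite_isNCOn s e).toFinset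

theorem mem_ncOn {s e : ℕ} {p : ℕ → ℕ} : p ∈ ncOn s e ↔ IsNCOn s e p := by simp [ncOn]

/-- The pairing of `[s, e)` with first block `{s, m}`, restricting to `q` inside of this block and
to `r` to its right. -/
def gluePairing (s m : ℕ) (q r : ℕ → ℕ) (i : ℕ) : ℕ :=
  if i = s then m else if i = m then s else if i < m then q i else r i

/-- Restriction of a map to an interval, extended by the identity. -/
def restrictTo (s e : ℕ) (p : ℕ → ℕ) (i : ℕ) : ℕ := if s ≤ i ∧ i < e then p i else i

theorem IsNCOn.glue {s m e : ℕ} {q r : ℕ → ℕ} (hsm : s < m) (hme : m < e)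
    (hq : IsNCOn (s + 1) m q) (hr : IsNCOn (m + 1) e r) : IsNCOn s e (gluePairing s m q r) := by
  have q1 := hq.le; have q2 := hq.lt; have q3 := hq.ne; have q4 := hq.invol; have q5 := hq.nc
  have q6 := hq.off
  have r1 := hr.le; have r2 := hr.lt; have r3 := hr.ne; have r4 := hr.invol; have r5 := hr.nc
  have r6 := hr.off
  -- A complete table of positions relative to `s`, `m`, `e`, which reduces every axiom to linear
  -- arithmetic.
  have cases : ∀ i, (i < s ∧ gluePairing s m q r i = i) ∨ (i = s ∧ gluePairing s m q r i = m) ∨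
      (s + 1 ≤ i ∧ i < m ∧ gluePairing s m q r i = q i ∧ s + 1 ≤ q i ∧ q i < m ∧ q i ≠ i) ∨
      (i = m ∧ gluePairing s m q r i = s) ∨
      (m + 1 ≤ i ∧ i < e ∧ gluePairing s m q r i = r i ∧ m + 1 ≤ r i ∧ r i < e ∧ r i ≠ i) ∨
      (e ≤ i ∧ gluePairing s m q r i = i) := by
    intro i
    rcases lt_trichotomy i s with h | h | h
    · refine Or.inl ⟨h, ?_⟩
      rw [gluePairing, if_neg (by omega), if_neg (by omega), if_pos (by omega), q6 i (by omega)]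
    · exact Or.inr (Or.inl ⟨h, by rw [gluePairing, if_pos h]⟩)
    · rcases lt_trichotomy i m with h' | h' | h'
      · refine Or.inr (Or.inr (Or.inl ⟨h, h', ?_, q1 i h h', q2 i h h', q3 i h h'⟩))
        rw [gluePairing, if_neg (by omega), if_neg (by omega), if_pos (by omega)]
      · refine Or.inr (Or.inr (Or.inr (Or.inl ⟨h', ?_⟩)))
        rw [gluePairing, if_neg (by omega), if_pos (by omega)]
      · have hg : gluePairing s m q r i = r i := by
          rw [gluePairing, if_neg (by omega), if_neg (by omega), if_neg (by omega)]
        by_cases hie : i < e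
        · exact Or.inr (Or.inr (Or.inr (Or.inr (Or.inl ⟨h', hie, hg, r1 i h' hie, r2 i h' hie,
            r3 i h' hie⟩))))
        · exact Or.inr (Or.inr (Or.inr (Or.inr (Or.inr ⟨by omega, by rw [hg, r6 i (by omega)]⟩))))
  constructor
  · intro i _ _; rcases cases i with h | h | h | h | h | h <;> omega
  · intro i _ _; rcases cases i with h | h | h | h | h | h <;> omega
  · intro i _ _; rcases cases i with h | h | h | h | h | h <;> omega
  · intro i
    have c1 := cases i
    have c2 := cases (gluePairing s m q r i)
    have := q4 i
    have := r4 i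
    rcases c1 with h | h | h | h | h | h
    · rw [h.2, h.2]
    · rw [h.2]; have := cases m; omega
    · rw [h.2.2.1]; have := cases (q i); omega
    · rw [h.2]; have := cases s; omega
    · rw [h.2.2.1]; have := cases (r i); omega
    · rw [h.2, h.2]
  · intro i j hij hj
    have c1 := cases i
    have c2 := cases j
    have := q5 i j hij
    have := r5 i j hij
    omega
  · intro i hi
    have := cases i
    omega

/-- No block may cross `{s, p s}`, so `p` preserves both the inside of this block and the part to
its right. -/
theorem IsNCOn.first {s e : ℕ} {p : ℕ → ℕ} (h : IsNCOn s e p) (hse : s < e) :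
    s < p s ∧ p s < e ∧ IsNCOn (s + 1) (p s) (restrictTo (s + 1) (p s) p) ∧
      IsNCOn (p s + 1) e (restrictTo (p s + 1) e p) := by
  have h1 := h.le s le_rfl hse
  have h2 := h.lt s le_rfl hse
  have h3 := h.ne s le_rfl hse
  have hinner : ∀ i, s < i → i < p s → s < p i ∧ p i < p s := by
    intro i hi hi'
    have a1 := h.nc s i hi hi'
    have a2 := h.le i hi.le (by omega)
    have a3 : p i ≠ p s := fun e => by
      have := h.invol i; rw [e, h.invol s] at this; omega
    have a4 : p i ≠ s := fun e => by
      have := h.invol i; rw [e] at this; omega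
    omega
  have houter : ∀ i, p s < i → i < e → p s < p i ∧ p i < e := by
    intro i hi hi'
    have a2 := h.le i (by omega) hi'
    have a3 := h.lt i (by omega) hi'
    have a4 : p i ≠ s := fun e => by
      have := h.invol i; rw [e] at this; omega
    have a5 : p i ≠ p s := fun e => by
      have := h.invol i; rw [e, h.invol s] at this; omega
    have a6 : ¬ (s < p i ∧ p i < p s) := fun a => by
      have := hinner _ a.1 a.2
      rw [h.invol] at this; omega
    omega
  refine ⟨by omega, h2, ?_, ?_⟩
  · have hin : ∀ i, s + 1 ≤ i ∧ i < p s → restrictTo (s + 1) (p s) p i = p i := fun i hi => by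
      rw [restrictTo, if_pos hi]
    have hout : ∀ i, ¬ (s + 1 ≤ i ∧ i < p s) → restrictTo (s + 1) (p s) p i = i := fun i hi => by
      rw [restrictTo, if_neg hi]
    constructor
    · intro i a b; rw [hin i ⟨a, b⟩]; exact (hinner i a b).1
    · intro i a b; rw [hin i ⟨a, b⟩]; exact (hinner i a b).2
    · intro i a b; rw [hin i ⟨a, b⟩]; exact h.ne i (by omega) (by omega)
    · intro i
      by_cases hi : s + 1 ≤ i ∧ i < p s
      · rw [hin i hi, hin _ (hinner i hi.1 hi.2), h.invol]
      · rw [hout i hi, hout i hi]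
    · intro i j hij hj
      have := h.nc i j hij
      have := hin i; have := hout i; have := hin j; have := hout j
      have := hinner i
      omega
    · exact hout
  · have hin : ∀ i, p s + 1 ≤ i ∧ i < e → restrictTo (p s + 1) e p i = p i := fun i hi => by
      rw [restrictTo, if_pos hi]
    have hout : ∀ i, ¬ (p s + 1 ≤ i ∧ i < e) → restrictTo (p s + 1) e p i = i := fun i hi => by
      rw [restrictTo, if_neg hi]
    constructor
    · intro i a b; rw [hin i ⟨a, b⟩]; exact (houter i a b).1
    · intro i a b; rw [hin i ⟨a, b⟩]; exact (houter i a b).2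
    · intro i a b; rw [hin i ⟨a, b⟩]; exact h.ne i (by omega) (by omega)
    · intro i
      by_cases hi : p s + 1 ≤ i ∧ i < e
      · rw [hin i hi, hin _ (houter i hi.1 hi.2), h.invol]
      · rw [hout i hi, hout i hi]
    · intro i j hij hj
      have := h.nc i j hij
      have := hin i; have := hout i; have := hin j; have := hout j
      have := houter i
      omega
    · exact hout

/-- Gluing and restricting are mutually inverse; the extension by the identity makes a pairing
determined by its restrictions. The moment recursion rests on this. -/
theorem sum_ncOn {M : Type*} [AddCommMonoid M] {s e : ℕ} (hse : s < e) (f : (ℕ → ℕ) → M) :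
    ∑ p ∈ ncOn s e, f p = ∑ m ∈ Ioo s e, ∑ q ∈ ncOn (s + 1) m, ∑ r ∈ ncOn (m + 1) e,
      f (gluePairing s m q r) := by
  simp_rw [Finset.sum_sigma']
  refine Finset.sum_bij'
    (fun p _ => ⟨p s, restrictTo (s + 1) (p s) p, restrictTo (p s + 1) e p⟩)
    (fun t _ => gluePairing s t.1 t.2.1 t.2.2) ?_ ?_ ?_ ?_ ?_
  · intro p hp
    obtain ⟨h1, h2, h3, h4⟩ := (mem_ncOn.1 hp).first hse
    simp only [mem_sigma, mem_Ioo, mem_ncOn]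
    exact ⟨⟨h1, h2⟩, h3, h4⟩
  · rintro ⟨m, q, r⟩ ht
    simp only [mem_sigma, mem_Ioo, mem_ncOn] at ht ⊢
    exact IsNCOn.glue ht.1.1 ht.1.2 ht.2.1 ht.2.2
  · intro p hp
    have hp' := mem_ncOn.1 hp
    obtain ⟨h1, h2, h3, h4⟩ := hp'.first hse
    funext i
    simp only [gluePairing, restrictTo]
    have := hp'.off i
    split_ifs with a b c d e'
    · rw [a]
    · rw [b, hp'.invol]
    · rfl
    · rw [this]; omega
    · rfl
    · rw [this]; omega
  · rintro ⟨m, q, r⟩ ht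
    simp only [mem_sigma, mem_Ioo, mem_ncOn] at ht
    have e1 : gluePairing s m q r s = m := by simp [gluePairing]
    have e2 : restrictTo (s + 1) m (gluePairing s m q r) = q := by
      funext i
      have := ht.2.1.off i
      simp only [restrictTo, gluePairing]
      split_ifs <;> first | rfl | omega
    have e3 : restrictTo (m + 1) e (gluePairing s m q r) = r := by
      funext i
      have := ht.2.2.off i
      simp only [restrictTo, gluePairing]
      split_ifs <;> first | rfl | omega
    simp only [e1, e2, e3]
  · intro p hp
    have hp' := mem_ncOn.1 hp
    obtain ⟨h1, h2, h3, h4⟩ := hp'.first hse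
    congr 1
    funext i
    simp only [gluePairing, restrictTo]
    have := hp'.off i
    split_ifs with a b c d e'
    · rw [a]
    · rw [b, hp'.invol]
    · rfl
    · rw [this]; omega
    · rfl
    · rw [this]; omega

theorem ncOn_self (s : ℕ) : ncOn s s = {id} := by
  ext p
  rw [mem_ncOn, mem_singleton]
  constructor
  · intro h; funext i; exact h.off i (by omega)
  · rintro rfl
    exact ⟨by intros; omega, by intros; omega, by intros; omega, by simp,
      by intro i j h1 h2; simp at h2; omega, by simp⟩

/-- Number of blocks of a pairing of `[s, e)` which lie between `i` and its partner. -/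
def nestedCount (s e : ℕ) (p : ℕ → ℕ) (i : ℕ) : ℕ :=
  #{j ∈ Ico s e | j < p j ∧ i ≤ j ∧ p j ≤ p i}

/-- The tree factorial of a pairing of `[s, e)`. -/
def treeFactorialOn (s e : ℕ) (p : ℕ → ℕ) : ℕ :=
  ∏ i ∈ Ico s e, if i < p i then nestedCount s e p i else 1

/-- `p` exchanges the minima and the maxima of its blocks. -/
theorem IsNCOn.two_mul_card {s e : ℕ} {p : ℕ → ℕ} (h : IsNCOn s e p) :
    2 * #{j ∈ Ico s e | j < p j} = e - s := by
  have h1 : #{j ∈ Ico s e | j < p j} = #{j ∈ Ico s e | ¬ j < p j} := by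
    refine Finset.card_nbij' p p ?_ ?_ (fun i _ => h.invol i) (fun i _ => h.invol i)
    · intro i hi
      simp only [coe_filter, mem_Ico, Set.mem_ofPred_eq] at hi ⊢
      have := h.le i hi.1.1 hi.1.2; have := h.lt i hi.1.1 hi.1.2
      rw [h.invol]; omega
    · intro i hi
      simp only [coe_filter, mem_Ico, Set.mem_ofPred_eq] at hi ⊢
      have := h.le i hi.1.1 hi.1.2; have := h.lt i hi.1.1 hi.1.2; have := h.ne i hi.1.1 hi.1.2
      rw [h.invol]; omega
  have h2 := Finset.card_filter_add_card_filter_not (s := Ico s e) (fun j => j < p j)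
  rw [Nat.card_Ico] at h2
  omega

/-- The block `{s, m}` contains itself and the `(m - s - 1)/2` blocks inside it, and the counts of
all other blocks are unaffected. The `2` on the left clears the denominator. -/
theorem treeFactorialOn_glue {s m e : ℕ} {q r : ℕ → ℕ} (hsm : s < m) (hme : m < e)
    (hq : IsNCOn (s + 1) m q) (hr : IsNCOn (m + 1) e r) :
    2 * treeFactorialOn s e (gluePairing s m q r) =
      (m - s + 1) * treeFactorialOn (s + 1) m q * treeFactorialOn (m + 1) e r := by
  set g := gluePairing s m q r with hg
  have gs : g s = m := by simp [hg, gluePairing]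
  have gm : g m = s := by
    rw [hg, gluePairing, if_neg (by omega), if_pos rfl]
  have gq : ∀ i, s + 1 ≤ i → i < m → g i = q i := fun i a b => by
    rw [hg, gluePairing, if_neg (by omega), if_neg (by omega), if_pos b]
  have gr : ∀ i, m + 1 ≤ i → g i = r i := fun i a => by
    rw [hg, gluePairing, if_neg (by omega), if_neg (by omega), if_neg (by omega)]
  have split : treeFactorialOn s e g = (if s < g s then nestedCount s e g s else 1) *
      ((∏ i ∈ Ico (s + 1) m, if i < g i then nestedCount s e g i else 1) *
      ((if m < g m then nestedCount s e g m else 1) *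
        ∏ i ∈ Ico (m + 1) e, if i < g i then nestedCount s e g i else 1)) := by
    rw [treeFactorialOn, Finset.prod_eq_prod_Ico_succ_bot (by omega),
      ← Finset.prod_Ico_consecutive _ (show s + 1 ≤ m by omega) hme.le,
      Finset.prod_eq_prod_Ico_succ_bot hme]
  have c1 : nestedCount s e g s = 1 + #{j ∈ Ico (s + 1) m | j < q j} := by
    have : ({j ∈ Ico s e | j < g j ∧ s ≤ j ∧ g j ≤ g s} : Finset ℕ) =
        insert s ({j ∈ Ico (s + 1) m | j < q j}) := by
      ext j
      simp only [mem_filter, mem_Ico, mem_insert, gs]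
      rcases lt_trichotomy j s with hj | rfl | hj
      · omega
      · rw [gs]; omega
      · rcases lt_trichotomy j m with hj' | rfl | hj'
        · rw [gq j hj hj']
          have := hq.lt j hj hj'
          omega
        · rw [gm]; omega
        · rw [gr j hj']; omega
    rw [nestedCount, this, card_insert_of_notMem (by simp), add_comm]
  have c2 : ∀ i ∈ Ico (s + 1) m, (if i < g i then nestedCount s e g i else 1) =
      if i < q i then nestedCount (s + 1) m q i else 1 := by
    intro i hi
    rw [mem_Ico] at hi
    rw [gq i hi.1 hi.2]
    congr 1
    rw [nestedCount, nestedCount]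
    congr 1
    ext j
    have := hq.lt i hi.1 hi.2
    simp only [mem_filter, mem_Ico, gq i hi.1 hi.2]
    by_cases hj : s + 1 ≤ j ∧ j < m
    · rw [gq j hj.1 hj.2]; omega
    · omega
  have c3 : ∀ i ∈ Ico (m + 1) e, (if i < g i then nestedCount s e g i else 1) =
      if i < r i then nestedCount (m + 1) e r i else 1 := by
    intro i hi
    rw [mem_Ico] at hi
    rw [gr i hi.1]
    congr 1
    rw [nestedCount, nestedCount]
    congr 1
    ext j
    simp only [mem_filter, mem_Ico, gr i hi.1]
    by_cases hj : m + 1 ≤ j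
    · rw [gr j hj]; omega
    · omega
  rw [split, if_pos (by omega), if_neg (by omega), one_mul, Finset.prod_congr rfl c2,
    Finset.prod_congr rfl c3, c1, ← treeFactorialOn, ← treeFactorialOn]
  have := hq.two_mul_card
  have e1 : 2 * (1 + #{j ∈ Ico (s + 1) m | j < q j}) = m - s + 1 := by omega
  rw [← e1]; ring

theorem sum_ncPairings {M : Type*} [AddCommMonoid M] (k : ℕ) (f : (ℕ → ℕ) → M) :
    ∑ σ ∈ ncPairings k, f (extendFin σ) = ∑ p ∈ ncOn 0 k, f p := by
  refine Finset.sum_bij (fun σ _ => extendFin σ) ?_ (fun σ _ τ _ h => extendFin_injective h) ?_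
    (fun _ _ => rfl)
  · intro σ hσ
    simp only [ncPairings, mem_filter, mem_univ, true_and] at hσ
    obtain ⟨h1, h2, h3⟩ := hσ
    have hin : ∀ i (h : i < k), extendFin σ i = σ ⟨i, h⟩ := fun i h => by simp [extendFin, h]
    rw [mem_ncOn]
    constructor
    · intros; omega
    · intro i _ hi; rw [hin i hi]; exact (σ _).2
    · intro i _ hi; rw [hin i hi]; exact fun e => h1 ⟨i, hi⟩ (Fin.ext e)
    · intro i
      by_cases hi : i < k
      · rw [hin i hi, extendFin_coe, h2]
      · have e := extendFin_of_le σ (not_lt.1 hi)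
        rw [e, e]
    · intro i j hij hj
      by_cases hi : i < k
      · rw [hin i hi] at hj ⊢
        have hjk : j < k := hj.trans (σ _).2
        rw [hin j hjk]
        exact h3 ⟨i, hi⟩ ⟨j, hjk⟩ hij hj
      · rw [extendFin_of_le σ (not_lt.1 hi)] at hj; omega
    · intro i hi; exact extendFin_of_le σ (by omega)
  · intro p hp
    have hp := mem_ncOn.1 hp
    obtain ⟨σ, rfl⟩ := hp.exists_extendFin
    refine ⟨σ, ?_, rfl⟩
    simp only [ncPairings, mem_filter, mem_univ, true_and]
    refine ⟨fun i h => ?_, fun i => ?_, fun i j hij hj => ?_⟩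
    · refine hp.ne i (by omega) i.2 ?_
      rw [extendFin_coe, h]
    · have := hp.invol i
      rw [extendFin_coe, extendFin_coe] at this
      exact Fin.ext this
    · have := hp.nc i j hij
      simp only [extendFin_coe] at this
      exact this hj

theorem treeFactorial_eq {k : ℕ} (σ : Fin k → Fin k) :
    treeFactorial σ = treeFactorialOn 0 k (extendFin σ) := by
  rw [treeFactorialOn, ← Finset.range_eq_Ico, Finset.prod_range, treeFactorial, Finset.prod_filter]
  refine Finset.prod_congr rfl fun i _ => ?_
  simp only [extendFin_coe, Fin.lt_def]
  congr 1
  rw [nestedCount, extendFin_coe, ← Finset.range_eq_Ico]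
  refine Finset.card_bij (fun j _ => (j : ℕ)) ?_ (fun a _ b _ h => Fin.ext h) ?_
  · intro j hj
    simp only [mem_filter, mem_univ, true_and, Fin.le_def] at hj
    simp only [mem_filter, mem_range, extendFin_coe]
    exact ⟨j.2, hj⟩
  · intro j hj
    simp only [mem_filter, mem_range] at hj
    refine ⟨⟨j, hj.1⟩, ?_, rfl⟩
    obtain ⟨hjk, hj⟩ := hj
    rw [show extendFin σ j = σ ⟨j, hjk⟩ from extendFin_coe σ ⟨j, hjk⟩] at hj
    simp only [mem_filter, mem_univ, true_and, Fin.le_def]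
    exact hj

end Pairings

/-! ### Recursion, linearity and growth of arcsine moments. -/

section ArcsineMoments

open Finset

variable {B : Type u} [CStarAlgebra B]

theorem pairEval_congr {η : B → B} {b c : ℕ → B} {p q : ℕ → ℕ} {s e : ℕ} (hse : s ≤ e)
    (hb : ∀ i, s ≤ i → i ≤ e → b i = c i) (hp : ∀ i, s ≤ i → i < e → p i = q i) :
    pairEval η b p s e = pairEval η c q s e := by
  induction hk : e - s using Nat.strong_induction_on generalizing s e with
  | _ k ih =>
    rw [pairEval]
    conv_rhs => rw [pairEval]
    by_cases h : s < e
    · rw [hp s le_rfl h, hb s le_rfl hse]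
      by_cases h' : s < q s ∧ q s < e
      · rw [dif_pos h', dif_pos h']
        rw [ih (q s - (s + 1)) (by omega) (s := s + 1) (e := q s) (by omega)
          (fun i a b => hb i (by omega) (by omega)) (fun i a b => hp i (by omega) (by omega)) rfl,
          ih (e - (q s + 1)) (by omega) (s := q s + 1) (e := e) (by omega)
          (fun i a b => hb i (by omega) (by omega)) (fun i a b => hp i (by omega) (by omega)) rfl]
      · rw [dif_neg h', dif_neg h']
    · rw [dif_neg (by omega), dif_neg (by omega), hb s le_rfl hse]

theorem pairEval_glue (η : B → B) (b : ℕ → B) {s m e : ℕ} {q r : ℕ → ℕ} (hsm : s < m)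
    (hme : m < e) : pairEval η b (gluePairing s m q r) s e =
      b s * η (pairEval η b q (s + 1) m) * pairEval η b r (m + 1) e := by
  have gs : gluePairing s m q r s = m := by simp [gluePairing]
  rw [pairEval, dif_pos (show s < gluePairing s m q r s ∧ gluePairing s m q r s < e by omega), gs]
  refine congrArg₂ (· * ·) (congrArg (fun v => b s * η v) ?_) ?_
  · refine pairEval_congr (by omega) (fun _ _ _ => rfl) fun i a b => ?_
    rw [gluePairing, if_neg (by omega), if_neg (by omega), if_pos b]
  · refine pairEval_congr (by omega) (fun _ _ _ => rfl) fun i a b => ?_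
    rw [gluePairing, if_neg (by omega), if_neg (by omega), if_neg (by omega)]

/-- The moment `E[b_s x b_{s+1} ⋯ x b_e]` of the arcsine distribution. -/
noncomputable def arcsineOn (η : B → B) (b : ℕ → B) (s e : ℕ) : B :=
  ∑ p ∈ ncOn s e, ((treeFactorialOn s e p : ℂ)⁻¹) • pairEval η b p s e

theorem arcsineOn_self (η : B → B) (b : ℕ → B) (s : ℕ) : arcsineOn η b s s = b s := by
  rw [arcsineOn, ncOn_self, sum_singleton, pairEval, dif_neg (by omega)]
  simp [treeFactorialOn]

/-- Recursion for the moments of the arcsine distribution, according to the first block. -/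
theorem arcsineOn_of_lt (η : B →L[ℂ] B) (b : ℕ → B) {s e : ℕ} (hse : s < e) :
    arcsineOn η b s e = ∑ m ∈ Ioo s e, (2 / ((m - s + 1 : ℕ) : ℂ)) •
      (b s * η (arcsineOn η b (s + 1) m) * arcsineOn η b (m + 1) e) := by
  rw [arcsineOn, sum_ncOn hse]
  refine Finset.sum_congr rfl fun m hm => ?_
  rw [mem_Ioo] at hm
  rw [arcsineOn, arcsineOn, map_sum, mul_assoc, Finset.sum_mul_sum, mul_sum, smul_sum]
  refine Finset.sum_congr rfl fun q hq => ?_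
  rw [mul_sum, smul_sum]
  refine Finset.sum_congr rfl fun r hr => ?_
  rw [pairEval_glue _ _ hm.1 hm.2, map_smul, smul_mul_smul_comm, mul_smul_comm, smul_smul,
    mul_assoc (b s)]
  congr 1
  have h := treeFactorialOn_glue hm.1 hm.2 (mem_ncOn.1 hq) (mem_ncOn.1 hr)
  have h' : (2 : ℂ) * treeFactorialOn s e (gluePairing s m q r) =
      ((m - s + 1 : ℕ) : ℂ) * treeFactorialOn (s + 1) m q * treeFactorialOn (m + 1) e r := by
    exact_mod_cast h
  have e : (treeFactorialOn s e (gluePairing s m q r) : ℂ) =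
      ((m - s + 1 : ℕ) : ℂ) * treeFactorialOn (s + 1) m q * treeFactorialOn (m + 1) e r / 2 := by
    rw [← h']; ring
  rw [e, inv_div, div_eq_mul_inv, mul_inv, mul_inv]
  ring

theorem arcsineOn_congr (η : B →L[ℂ] B) {b c : ℕ → B} {s e : ℕ} (hse : s ≤ e)
    (h : ∀ i, s ≤ i → i ≤ e → b i = c i) : arcsineOn η b s e = arcsineOn η c s e :=
  Finset.sum_congr rfl fun p _ => by rw [pairEval_congr hse h fun _ _ _ => rfl]

theorem arcsineLaw_eq (η : B → B) (b₀ : B) (l : List B) :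
    arcsineLaw η b₀ l = arcsineOn η (fun j => (b₀ :: l).getD j 0) 0 l.length := by
  rw [arcsineLaw, arcsineOn, ← sum_ncPairings]
  refine Finset.sum_congr rfl fun σ _ => ?_
  rw [treeFactorial_eq]
  rfl

/-- In every term of the first-block recursion, `b i` enters exactly one of the three factors, so
linearity follows by induction on the length. -/
theorem exists_linearMap_arcsineOn (η : B →L[ℂ] B) (b : ℕ → B) {s e i : ℕ} (hsi : s ≤ i)
    (hie : i ≤ e) : ∃ Λ : B →ₗ[ℂ] B, ∀ v, arcsineOn η (Function.update b i v) s e = Λ v := by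
  induction hk : e - s using Nat.strong_induction_on generalizing s e with
  | _ k ih =>
    by_cases hse : s < e
    · have hstep : ∀ m ∈ Ioo s e, ∃ Λ : B →ₗ[ℂ] B, ∀ v,
          Function.update b i v s * η (arcsineOn η (Function.update b i v) (s + 1) m) *
            arcsineOn η (Function.update b i v) (m + 1) e = Λ v := by
        intro m hm
        rw [mem_Ioo] at hm
        have off : ∀ s' e', s' ≤ e' → ¬ (s' ≤ i ∧ i ≤ e') → ∀ v,
            arcsineOn η (Function.update b i v) s' e' = arcsineOn η b s' e' :=
          fun s' e' h h' v => arcsineOn_congr η h fun j _ _ =>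
            Function.update_of_ne (by omega) _ _
        by_cases h1 : i = s
        · subst h1
          refine ⟨LinearMap.mulRight ℂ (η (arcsineOn η b (i + 1) m) * arcsineOn η b (m + 1) e),
            fun v => ?_⟩
          rw [off _ _ (by omega) (by omega), off _ _ (by omega) (by omega), Function.update_self,
            LinearMap.mulRight_apply, mul_assoc]
        · have hb : ∀ v, Function.update b i v s = b s := fun v =>
            Function.update_of_ne (Ne.symm h1) _ _
          by_cases h2 : i ≤ m
          · obtain ⟨Λ, hΛ⟩ := ih (m - (s + 1)) (by omega) (s := s + 1) (e := m) (by omega) h2 rfl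
            refine ⟨(LinearMap.mulRight ℂ (arcsineOn η b (m + 1) e)).comp
              ((LinearMap.mulLeft ℂ (b s)).comp (η.toLinearMap.comp Λ)), fun v => ?_⟩
            rw [off (m + 1) _ (by omega) (by omega), hb, hΛ]
            rfl
          · obtain ⟨Λ, hΛ⟩ := ih (e - (m + 1)) (by omega) (s := m + 1) (e := e) (by omega) hie rfl
            refine ⟨(LinearMap.mulLeft ℂ (b s * η (arcsineOn η b (s + 1) m))).comp Λ, fun v => ?_⟩
            rw [off (s + 1) _ (by omega) (by omega), hb, hΛ]
            rfl
      choose! Λ hΛ using hstep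
      refine ⟨∑ m ∈ Ioo s e, (2 / ((m - s + 1 : ℕ) : ℂ)) • Λ m, fun v => ?_⟩
      rw [arcsineOn_of_lt η _ hse, LinearMap.sum_apply]
      exact Finset.sum_congr rfl fun m hm => by rw [hΛ m hm, LinearMap.smul_apply]
    · obtain rfl : s = e := by omega
      obtain rfl : s = i := by omega
      exact ⟨LinearMap.id, fun v => by rw [arcsineOn_self, Function.update_self]; rfl⟩

theorem catalan_le_four_pow (n : ℕ) : catalan n ≤ 4 ^ n := by
  rw [catalan_eq_centralBinom_div]
  refine (Nat.div_le_self _ _).trans ?_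
  rw [Nat.centralBinom_eq_two_mul_choose]
  calc _ ≤ 2 ^ (2 * n) := Nat.choose_le_two_pow _ _
    _ = 4 ^ n := by rw [pow_mul]; norm_num

theorem catalan_le_succ (n : ℕ) : catalan n ≤ catalan (n + 1) := by
  rw [catalan_succ' n]
  have : ((0, n) : ℕ × ℕ) ∈ antidiagonal n := by simp
  have h := Finset.single_le_sum (f := fun ij : ℕ × ℕ => catalan ij.1 * catalan ij.2)
    (fun _ _ => Nat.zero_le _) this
  simpa using h

theorem sum_Ioo_catalan_le (s e : ℕ) :
    ∑ m ∈ Ioo s e, catalan (m - (s + 1)) * catalan (e - (m + 1)) ≤ catalan (e - s) := by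
  by_cases h : s + 2 ≤ e
  · obtain ⟨k, rfl⟩ : ∃ k, e = s + 2 + k := ⟨e - (s + 2), by omega⟩
    have h1 : ∑ m ∈ Ioo s (s + 2 + k), catalan (m - (s + 1)) * catalan (s + 2 + k - (m + 1)) =
        catalan (k + 1) := by
      rw [catalan_succ', Finset.Nat.sum_antidiagonal_eq_sum_range_succ_mk,
        ← Finset.Ico_succ_left_eq_Ioo, Finset.sum_Ico_eq_sum_range]
      have : s + 2 + k - Order.succ s = k.succ := by
        rw [Nat.succ_eq_succ]; omega
      rw [this]
      refine Finset.sum_congr rfl fun i _ => ?_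
      simp only [Nat.succ_eq_succ]
      congr 2 <;> omega
    rw [h1]
    have : s + 2 + k - s = k + 1 + 1 := by omega
    rw [this]
    exact catalan_le_succ _
  · have : Ioo s e = ∅ := by
      ext i; simp only [mem_Ioo, notMem_empty, iff_false]; omega
    rw [this, Finset.sum_empty]
    exact Nat.zero_le _

/-- The weights `2/(m - s + 1)` are at most `1`, and what remains is dominated by the Catalan
recursion. Indexing by length instead of the number of pairs is wasteful, but only geometric growth
matters. -/
theorem norm_arcsineOn_le {η : B →L[ℂ] B} {k : ℝ} (hk : 0 ≤ k) (hη : ‖η‖ ≤ k ^ 2) (b : ℕ → B)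
    {s e : ℕ} (hse : s ≤ e) :
    ‖arcsineOn η b s e‖ ≤ catalan (e - s) * k ^ (e - s) * ∏ i ∈ Icc s e, ‖b i‖ := by
  induction hd : e - s using Nat.strong_induction_on generalizing s e with
  | _ d ih =>
    subst hd
    rcases hse.eq_or_lt with rfl | hlt
    · simp [arcsineOn_self]
    · rw [arcsineOn_of_lt η b hlt]
      have hterm : ∀ m ∈ Ioo s e, ‖(2 / ((m - s + 1 : ℕ) : ℂ)) •
          (b s * η (arcsineOn η b (s + 1) m) * arcsineOn η b (m + 1) e)‖ ≤
          ((catalan (m - (s + 1)) * catalan (e - (m + 1)) : ℕ) : ℝ) *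
            (k ^ (e - s) * ∏ i ∈ Icc s e, ‖b i‖) := by
        intro m hm
        rw [mem_Ioo] at hm
        have i1 := ih (m - (s + 1)) (by omega) (s := s + 1) (e := m) (by omega) rfl
        have i2 := ih (e - (m + 1)) (by omega) (s := m + 1) (e := e) (by omega) rfl
        have c1 : ‖(2 / ((m - s + 1 : ℕ) : ℂ))‖ ≤ 1 := by
          rw [norm_div, Complex.norm_natCast, Complex.norm_ofNat]
          rw [div_le_one (by positivity)]
          exact_mod_cast (by omega : 2 ≤ m - s + 1)
        have p1 : ∏ i ∈ Icc s e, ‖b i‖ =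
            ‖b s‖ * (∏ i ∈ Icc (s + 1) m, ‖b i‖) * ∏ i ∈ Icc (m + 1) e, ‖b i‖ := by
          have conv : ∀ a c, Icc a c = Ico a (c + 1) := fun a c => by
            ext i; simp only [mem_Icc, mem_Ico]; omega
          rw [conv, conv, conv, Finset.prod_eq_prod_Ico_succ_bot (by omega), mul_assoc,
            Finset.prod_Ico_consecutive _ (by omega) (by omega)]
        have p2 : k ^ (e - s) = k ^ 2 * k ^ (m - (s + 1)) * k ^ (e - (m + 1)) := by
          rw [← pow_add, ← pow_add]; congr 1; omega
        have hη' := η.le_of_opNorm_le_of_le hη i1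
        rw [norm_smul]
        calc _ ≤ 1 * (‖b s‖ * ‖η (arcsineOn η b (s + 1) m)‖ * ‖arcsineOn η b (m + 1) e‖) := by
              gcongr
              exact norm_mul₃_le
          _ ≤ 1 * (‖b s‖ * (k ^ 2 * (catalan (m - (s + 1)) * k ^ (m - (s + 1)) *
                ∏ i ∈ Icc (s + 1) m, ‖b i‖)) *
              (catalan (e - (m + 1)) * k ^ (e - (m + 1)) * ∏ i ∈ Icc (m + 1) e, ‖b i‖)) := by
              gcongr
          _ = _ := by rw [p1, p2]; push_cast; ring
      refine (norm_sum_le _ _).trans ((Finset.sum_le_sum hterm).trans ?_)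
      rw [← Finset.sum_mul, ← Nat.cast_sum, mul_assoc]
      gcongr
      exact sum_Ioo_catalan_le s e

/-- The value of a law at a nonempty list of coefficients. -/
def Law.app (μ : Law B) : List B → B
  | [] => 0
  | b :: l => μ b l

/-- A law which is linear in each of its arguments. -/
def Law.IsMultilinear (μ : Law B) : Prop :=
  ∀ l₁ l₂ : List B, ∃ Λ : B →ₗ[ℂ] B, ∀ v, Law.app μ (l₁ ++ v :: l₂) = Λ v

/-- A law whose moments grow at most geometrically. -/
def Law.IsBounded (μ : Law B) (C R : ℝ) : Prop :=
  ∀ b₀ l, ‖μ b₀ l‖ ≤ C * R ^ l.length * (‖b₀‖ * (l.map norm).prod)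

theorem isMultilinear_arcsineLaw (η : B →L[ℂ] B) : Law.IsMultilinear (arcsineLaw η) := by
  have app_eq : ∀ l : List B, l ≠ [] →
      Law.app (arcsineLaw η) l = arcsineOn η (fun j => l.getD j 0) 0 (l.length - 1) := by
    intro l hl
    cases l with
    | nil => exact absurd rfl hl
    | cons b l => exact arcsineLaw_eq η b l
  intro l₁ l₂
  obtain ⟨Λ, hΛ⟩ := exists_linearMap_arcsineOn η (fun j => (l₁ ++ 0 :: l₂).getD j 0)
    (Nat.zero_le l₁.length) (show l₁.length ≤ (l₁ ++ 0 :: l₂).length - 1 by simp)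
  refine ⟨Λ, fun v => ?_⟩
  rw [app_eq _ (by simp), ← hΛ v]
  have hlen : (l₁ ++ v :: l₂).length = (l₁ ++ 0 :: l₂).length := by simp
  rw [hlen]
  congr 1
  funext j
  rcases eq_or_ne j l₁.length with rfl | hj
  · simp
  · rw [Function.update_of_ne hj]
    rcases lt_or_gt_of_ne hj with h | h
    · rw [List.getD_append _ _ _ _ h, List.getD_append _ _ _ _ h]
    · rw [List.getD_append_right _ _ _ _ h.le, List.getD_append_right _ _ _ _ h.le]
      obtain ⟨i, hi⟩ : ∃ i, j - l₁.length = i + 1 := ⟨j - l₁.length - 1, by omega⟩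
      rw [hi, List.getD_cons_succ, List.getD_cons_succ]

theorem isBounded_arcsineLaw (η : B →L[ℂ] B) :
    Law.IsBounded (arcsineLaw η) 1 (4 * √‖η‖) := by
  intro b₀ l
  rw [arcsineLaw_eq]
  refine (norm_arcsineOn_le (Real.sqrt_nonneg ‖η‖) (Real.sq_sqrt (norm_nonneg η)).ge _
    (Nat.zero_le _)).trans ?_
  have h1 : ∏ i ∈ Icc 0 l.length, ‖(b₀ :: l).getD i 0‖ = ‖b₀‖ * (l.map norm).prod := by
    have : Icc 0 l.length = range (l.length + 1) := by
      ext i; simp only [mem_Icc, mem_range]; omega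
    rw [this, Finset.prod_range_succ']
    simp only [List.getD_cons_succ, List.getD_cons_zero]
    rw [mul_comm]
    congr 1
    clear this
    induction l with
    | nil => simp
    | cons c l ih =>
      rw [List.length_cons, Finset.prod_range_succ']
      simp only [List.getD_cons_succ, List.getD_cons_zero, List.map_cons, List.prod_cons]
      rw [ih, mul_comm]
  rw [h1, Nat.sub_zero, one_mul, mul_pow]
  have : (catalan l.length : ℝ) ≤ 4 ^ l.length := by exact_mod_cast catalan_le_four_pow _
  have : 0 ≤ ‖b₀‖ * (l.map norm).prod :=
    mul_nonneg (norm_nonneg _) (List.prod_nonneg (by simp))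
  gcongr

/-- The arcsine moments with all coefficients equal to `c`. -/
noncomputable def arcsineMoment (η : B →L[ℂ] B) (c : B) (k : ℕ) : B :=
  arcsineLaw η c (List.replicate k c)

/-- Translation invariance: the recursion sees positions only through their differences. -/
theorem arcsineOn_const (η : B →L[ℂ] B) (c : B) (s k : ℕ) :
    arcsineOn η (fun _ => c) s (s + k) = arcsineMoment η c k := by
  have h0 : arcsineMoment η c k = arcsineOn η (fun _ => c) 0 k := by
    rw [arcsineMoment, arcsineLaw_eq, List.length_replicate]
    refine arcsineOn_congr η (Nat.zero_le _) fun i _ hi => ?_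
    cases i with
    | zero => rfl
    | succ i => rw [List.getD_cons_succ, List.getD_eq_getElem _ _ (by simp; omega), List.getElem_replicate]
  rw [h0]
  clear h0
  have key : ∀ k s t, arcsineOn η (fun _ => c) s (s + k) = arcsineOn η (fun _ => c) t (t + k) := by
    intro k
    induction k using Nat.strong_induction_on with
    | _ k ih =>
      intro s t
      rcases Nat.eq_zero_or_pos k with rfl | hk
      · simp [arcsineOn_self]
      · rw [arcsineOn_of_lt η _ (show s < s + k by omega),
          arcsineOn_of_lt η _ (show t < t + k by omega)]
        refine Finset.sum_nbij' (fun m => m - s + t) (fun m => m - t + s) ?_ ?_ ?_ ?_ ?_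
        · intro m hm; simp only [mem_Ioo] at hm ⊢; omega
        · intro m hm; simp only [mem_Ioo] at hm ⊢; omega
        · intro m hm; simp only [mem_Ioo] at hm; omega
        · intro m hm; simp only [mem_Ioo] at hm; omega
        · intro m hm
          simp only [mem_Ioo] at hm
          have e1 := ih (m - (s + 1)) (by omega) (s + 1) (t + 1)
          have e2 := ih (s + k - (m + 1)) (by omega) (m + 1) (m - s + t + 1)
          rw [show s + 1 + (m - (s + 1)) = m by omega,
            show t + 1 + (m - (s + 1)) = m - s + t by omega] at e1
          rw [show m + 1 + (s + k - (m + 1)) = s + k by omega,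
            show m - s + t + 1 + (s + k - (m + 1)) = t + k by omega] at e2
          rw [e1, e2, show m - s + t - t + 1 = m - s + 1 by omega]
  simpa using key k s 0

theorem arcsineMoment_zero (η : B →L[ℂ] B) (c : B) : arcsineMoment η c 0 = c := by
  rw [← arcsineOn_const η c 0, arcsineOn_self]

theorem arcsineMoment_one (η : B →L[ℂ] B) (c : B) : arcsineMoment η c 1 = 0 := by
  rw [← arcsineOn_const η c 0, arcsineOn_of_lt η _ (by omega)]
  have : Ioo 0 (0 + 1) = ∅ := by decide
  rw [this, Finset.sum_empty]

theorem arcsineMoment_add_two (η : B →L[ℂ] B) (c : B) (k : ℕ) :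
    arcsineMoment η c (k + 2) = ∑ ij ∈ antidiagonal k, (2 / ((ij.1 + 2 : ℕ) : ℂ)) •
      (c * η (arcsineMoment η c ij.1) * arcsineMoment η c ij.2) := by
  rw [← arcsineOn_const η c 0, arcsineOn_of_lt η _ (by omega),
    Finset.Nat.sum_antidiagonal_eq_sum_range_succ_mk, ← Finset.Ico_succ_left_eq_Ioo,
    Finset.sum_Ico_eq_sum_range]
  have : 0 + (k + 2) - Order.succ 0 = k.succ := by rw [Nat.succ_eq_succ]; omega
  rw [this]
  refine Finset.sum_congr rfl fun i hi => ?_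
  rw [mem_range] at hi
  simp only [Nat.succ_eq_succ]
  have e1 := arcsineOn_const η c (0 + 1) i
  have e2 := arcsineOn_const η c (Nat.succ 0 + i + 1) (k - i)
  rw [show Nat.succ 0 + i + 1 + (k - i) = 0 + (k + 2) by omega] at e2
  rw [show 0 + 1 + i = Nat.succ 0 + i by omega] at e1
  rw [e1, e2, show Nat.succ 0 + i - 0 + 1 = i + 2 by omega]

/-- The orders of the two inner moments in each term add up to an odd number, so one of them is odd
again. -/
theorem arcsineMoment_odd (η : B →L[ℂ] B) (c : B) (k : ℕ) : arcsineMoment η c (2 * k + 1) = 0 := by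
  induction k using Nat.strong_induction_on with
  | _ k ih =>
    cases k with
    | zero => exact arcsineMoment_one η c
    | succ k =>
      rw [show 2 * (k + 1) + 1 = (2 * k + 1) + 2 by ring, arcsineMoment_add_two]
      refine Finset.sum_eq_zero fun ij hij => ?_
      rw [HasAntidiagonal.mem_antidiagonal] at hij
      rcases Nat.even_or_odd' ij.1 with ⟨i, hi | hi⟩
      · have : ij.2 = 2 * (k - i) + 1 := by omega
        rw [this, ih (k - i) (by omega), mul_zero, smul_zero]
      · rw [hi, ih i (by omega), map_zero, mul_zero, zero_mul, smul_zero]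

/-- Recursion for the even arcsine moments. -/
theorem arcsineMoment_two_mul_succ (η : B →L[ℂ] B) (c : B) (k : ℕ) :
    arcsineMoment η c (2 * (k + 1)) = ∑ ij ∈ antidiagonal k, ((ij.1 + 1 : ℕ) : ℂ)⁻¹ •
      (c * η (arcsineMoment η c (2 * ij.1)) * arcsineMoment η c (2 * ij.2)) := by
  rw [show 2 * (k + 1) = 2 * k + 2 by ring, arcsineMoment_add_two]
  symm
  refine Finset.sum_of_injOn (fun ij => (2 * ij.1, 2 * ij.2)) ?_ ?_ ?_ ?_
  · intro a _ b _ h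
    simp only [Prod.mk.injEq] at h
    ext <;> omega
  · intro ij hij
    simp only [mem_coe, HasAntidiagonal.mem_antidiagonal] at hij ⊢
    omega
  · intro ij hij hn
    rw [HasAntidiagonal.mem_antidiagonal] at hij
    rcases Nat.even_or_odd' ij.1 with ⟨i, hi | hi⟩
    · exfalso
      refine hn ⟨(i, k - i), ?_, ?_⟩
      · simp only [mem_coe, HasAntidiagonal.mem_antidiagonal]; omega
      · ext <;> simp <;> omega
    · rw [hi, arcsineMoment_odd, map_zero, mul_zero, zero_mul, smul_zero]
  · intro ij _
    congr 1
    push_cast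
    rw [show (2 * (ij.1 : ℂ) + 2) = 2 * (ij.1 + 1) by ring, div_mul_cancel_left₀ two_ne_zero]

theorem norm_arcsineMoment_le (η : B →L[ℂ] B) (c : B) (k : ℕ) :
    ‖arcsineMoment η c k‖ ≤ ‖c‖ * (4 * √‖η‖ * ‖c‖) ^ k := by
  refine (isBounded_arcsineLaw η c (List.replicate k c)).trans (le_of_eq ?_)
  simp [mul_pow]
  ring

end ArcsineMoments

/-! ### Generating functions and the composition rule for monotone convolution. -/

section GeneratingFunctions

open Filter Topology

theorem tsum_sum_antidiagonal {E : Type*} [NormedAddCommGroup E] [CompleteSpace E]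
    {F : ℕ × ℕ → E} (hF : Summable F) :
    Summable (fun k => ∑ ij ∈ Finset.HasAntidiagonal.antidiagonal k, F ij) ∧
      ∑' k, ∑ ij ∈ Finset.HasAntidiagonal.antidiagonal k, F ij = ∑' i, ∑' j, F (i, j) := by
  have h1 : Summable (F ∘ Finset.HasAntidiagonal.sigmaAntidiagonalEquivProd) :=
    Finset.HasAntidiagonal.sigmaAntidiagonalEquivProd.summable_iff.2 hF
  have h2 : ∀ k, ∑' c : Finset.HasAntidiagonal.antidiagonal k, (F ∘ Finset.HasAntidiagonal.sigmaAntidiagonalEquivProd) ⟨k, c⟩ =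
      ∑ ij ∈ Finset.HasAntidiagonal.antidiagonal k, F ij := by
    intro k
    rw [tsum_fintype]
    simp only [Function.comp_apply, Finset.HasAntidiagonal.sigmaAntidiagonalEquivProd_apply]
    exact Finset.sum_coe_sort _ F
  have h3 := h1.sigma
  have h4 := h1.tsum_sigma
  simp only [h2] at h3 h4
  refine ⟨h3, ?_⟩
  rw [← h4, ← hF.tsum_prod]
  exact Finset.HasAntidiagonal.sigmaAntidiagonalEquivProd.tsum_eq F

variable {B : Type u} [CStarAlgebra B]

/-- The generating function `∑ r^k μ(c, c, …, c)` of a law. -/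
noncomputable def Law.genFun (r : ℝ) (μ : Law B) (c : B) : B :=
  ∑' k, r ^ k • μ c (List.replicate k c)

/-- The law with first argument fixed to be `e`. -/
def Law.shift (μ : Law B) (e : B) : Law B := fun e₀ es => μ e (e₀ :: es)

theorem Law.IsBounded.shift {μ : Law B} {C R : ℝ} (h : μ.IsBounded C R) (e : B) :
    (μ.shift e).IsBounded (C * R * ‖e‖) R := by
  intro b₀ l
  refine (h e (b₀ :: l)).trans (le_of_eq ?_)
  simp [pow_succ]
  ring

theorem Law.IsMultilinear.shift {μ : Law B} (h : μ.IsMultilinear) (e : B) :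
    (μ.shift e).IsMultilinear := by
  intro l₁ l₂
  obtain ⟨Λ, hΛ⟩ := h (e :: l₁) l₂
  refine ⟨Λ, fun v => ?_⟩
  rw [← hΛ v]
  cases l₁ <;> rfl

theorem convAux_add (ν μ μ' : Law B) (c : B) (q l : List B) :
    convAux ν (fun e es => μ e es + μ' e es) c q l = convAux ν μ c q l + convAux ν μ' c q l := by
  induction l generalizing μ μ' c q with
  | nil => rfl
  | cons d l ih => rw [convAux, convAux, convAux, ih, ih]; abel

theorem convAux_smul (ν μ : Law B) (a : ℂ) (c : B) (q l : List B) :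
    convAux ν (fun e es => a • μ e es) c q l = a • convAux ν μ c q l := by
  induction l generalizing μ c q with
  | nil => rfl
  | cons d l ih => rw [convAux, convAux, ih, ih, smul_add]

/-- Each letter of `l` is either a `y`, costing `R'`, or an `x` which also opens a new run, costing
`R * C'`. -/
theorem norm_convAux_le {μ ν : Law B} {C R C' R' : ℝ} (hC : 0 ≤ C) (hR : 0 ≤ R) (hC' : 0 ≤ C')
    (hR' : 0 ≤ R') (hμ : μ.IsBounded C R) (hν : ν.IsBounded C' R') (c : B) (q l : List B) :
    ‖convAux ν μ c q l‖ ≤ C * C' * R' ^ q.length * (R * C' + R') ^ l.length *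
      (‖c‖ * (q.map norm).prod * (l.map norm).prod) := by
  have hnn : ∀ l : List B, 0 ≤ (l.map norm).prod := fun l => List.prod_nonneg (by simp)
  induction l generalizing μ C c q with
  | nil =>
    rw [convAux]
    refine (hμ _ []).trans ?_
    have := hν c q
    simp only [List.length_nil, pow_zero, mul_one, List.map_nil, List.prod_nil]
    calc C * ‖ν c q‖ ≤ C * (C' * R' ^ q.length * (‖c‖ * (q.map norm).prod)) := by gcongr
      _ = _ := by ring
  | cons d l ih =>
    rw [convAux]
    have h1 := ih hC hμ c (q ++ [d])
    have h2 := ih (C := C * R * ‖ν c q‖) (by positivity) (hμ.shift (ν c q)) d []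
    have h3 := hν c q
    refine (norm_add_le _ _).trans ((add_le_add h1 h2).trans ?_)
    have := hnn q
    have := hnn l
    have e : C * R * ‖ν c q‖ * C' * R' ^ ([] : List B).length * (R * C' + R') ^ l.length *
        (‖d‖ * (([] : List B).map norm).prod * (l.map norm).prod) ≤
        C * R * (C' * R' ^ q.length * (‖c‖ * (q.map norm).prod)) * C' *
          (R * C' + R') ^ l.length * (‖d‖ * (l.map norm).prod) := by
      simp only [List.length_nil, pow_zero, mul_one, List.map_nil, List.prod_nil]
      gcongr
    refine (add_le_add_right e _).trans (le_of_eq ?_)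
    simp only [List.length_append, List.length_cons, List.length_nil, List.map_append,
      List.prod_append, List.map_cons, List.map_nil, List.prod_cons, List.prod_nil, pow_succ,
      zero_add, mul_one]
    ring

theorem Law.IsBounded.monotoneConv {μ ν : Law B} {C R C' R' : ℝ} (hC : 0 ≤ C) (hR : 0 ≤ R)
    (hC' : 0 ≤ C') (hR' : 0 ≤ R') (hμ : μ.IsBounded C R) (hν : ν.IsBounded C' R') :
    Law.IsBounded (monotoneConv μ ν) (C * C') (R * C' + R') := by
  intro b l
  refine (norm_convAux_le hC hR hC' hR' hμ hν b [] l).trans (le_of_eq ?_)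
  simp

/-- Expansion of a moment of the convolution according to the length of the first run. -/
theorem monotoneConv_replicate_succ (μ ν : Law B) (c : B) (k : ℕ) :
    monotoneConv μ ν c (List.replicate (k + 1) c) = μ (ν c (List.replicate (k + 1) c)) [] +
      ∑ ij ∈ Finset.HasAntidiagonal.antidiagonal k, monotoneConv (μ.shift (ν c (List.replicate ij.2 c))) ν c
        (List.replicate ij.1 c) := by
  have key : ∀ k j, convAux ν μ c (List.replicate j c) (List.replicate k c) =
      μ (ν c (List.replicate (j + k) c)) [] + ∑ i ∈ Finset.range k,
        monotoneConv (μ.shift (ν c (List.replicate (j + i) c))) ν c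
          (List.replicate (k - 1 - i) c) := by
    intro k
    induction k with
    | zero => intro j; simp [convAux]
    | succ k ih =>
      intro j
      have e : List.replicate j c ++ [c] = List.replicate (j + 1) c := by
        rw [List.replicate_succ']
      rw [List.replicate_succ (n := k), convAux, e, ih (j + 1), Finset.sum_range_succ']
      have e2 : ∀ i, j + 1 + i = j + (i + 1) := fun i => by ring
      simp only [e2, add_zero, Nat.sub_zero, Nat.add_sub_cancel]
      rw [add_assoc]
      congr 2
      refine Finset.sum_congr rfl fun i _ => ?_
      congr 2
      omega
  have := key (k + 1) 0
  simp only [List.replicate_zero, zero_add, Nat.add_sub_cancel] at this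
  rw [OVProb.monotoneConv, this, Finset.Nat.antidiagonal_eq_map', Finset.sum_map]
  rfl

theorem norm_pow_smul_le {μ : Law B} {C R : ℝ} (hμ : μ.IsBounded C R) (r : ℝ) (c : B) (k : ℕ) :
    ‖r ^ k • μ c (List.replicate k c)‖ ≤ C * ‖c‖ * (|r| * R * ‖c‖) ^ k := by
  rw [norm_smul, norm_pow, Real.norm_eq_abs]
  refine (mul_le_mul_of_nonneg_left (hμ c _) (by positivity)).trans (le_of_eq ?_)
  simp [mul_pow]
  ring

theorem Law.IsBounded.summable {μ : Law B} {C R : ℝ} (hR : 0 ≤ R) (hμ : μ.IsBounded C R)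
    {r : ℝ} {c : B} (hr : |r| * R * ‖c‖ < 1) :
    Summable fun k => ‖r ^ k • μ c (List.replicate k c)‖ :=
  Summable.of_nonneg_of_le (fun _ => norm_nonneg _) (norm_pow_smul_le hμ r c)
    ((summable_geometric_of_lt_one (by positivity) hr).mul_left _)

theorem Law.IsBounded.norm_genFun_le {μ : Law B} {C R : ℝ} (hR : 0 ≤ R)
    (hμ : μ.IsBounded C R) {r : ℝ} {c : B} (hr : |r| * R * ‖c‖ < 1) :
    ‖μ.genFun r c‖ ≤ C * ‖c‖ * (1 - |r| * R * ‖c‖)⁻¹ :=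
  tsum_of_norm_bounded ((hasSum_geometric_of_lt_one (by positivity) hr).mul_left _)
    (norm_pow_smul_le hμ r c)

/-- The moments of `μ.shift e ▷ ν` depend linearly on `e`. -/
theorem exists_clm_monotoneConv_shift {μ ν : Law B} {C R C' R' : ℝ} (hC : 0 ≤ C) (hR : 0 ≤ R)
    (hC' : 0 ≤ C') (hR' : 0 ≤ R') (hμ : μ.IsBounded C R) (hν : ν.IsBounded C' R')
    (hlin : μ.IsMultilinear) (c : B) (l : List B) :
    ∃ L : B →L[ℂ] B, ∀ e, L e = monotoneConv (μ.shift e) ν c l := by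
  have hadd : ∀ e e', monotoneConv (μ.shift (e + e')) ν c l =
      monotoneConv (μ.shift e) ν c l + monotoneConv (μ.shift e') ν c l := by
    intro e e'
    rw [OVProb.monotoneConv, OVProb.monotoneConv, OVProb.monotoneConv, ← convAux_add]
    congr 1
    funext e₀ es
    obtain ⟨Λ, hΛ⟩ := hlin [] (e₀ :: es)
    have h1 := hΛ (e + e')
    rw [map_add, ← hΛ e, ← hΛ e'] at h1
    exact h1
  have hsmul : ∀ (a : ℂ) e, monotoneConv (μ.shift (a • e)) ν c l =
      a • monotoneConv (μ.shift e) ν c l := by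
    intro a e
    rw [OVProb.monotoneConv, OVProb.monotoneConv, ← convAux_smul]
    congr 1
    funext e₀ es
    obtain ⟨Λ, hΛ⟩ := hlin [] (e₀ :: es)
    have h1 := hΛ (a • e)
    rw [map_smul, ← hΛ e] at h1
    exact h1
  refine ⟨LinearMap.mkContinuous ⟨⟨fun e => monotoneConv (μ.shift e) ν c l, hadd⟩, hsmul⟩
    (C * R * C' * (R * C' + R') ^ l.length * (‖c‖ * (l.map norm).prod)) fun e => ?_,
    fun e => rfl⟩
  refine (Law.IsBounded.monotoneConv (C := C * R * ‖e‖) (by positivity) hR hC' hR'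
    (hμ.shift e) hν c l).trans (le_of_eq ?_)
  ring

-- Words are sorted by the run of `y` before the first `x`. Words without `x` sum to the first term.
-- Otherwise the moment is linear in the value of the first run, so summation over its length moves
-- inside and produces `ν.genFun r c`, independently of the rest of the word.
set_option maxHeartbeats 1000000 in
theorem genFun_monotoneConv_step {μ ν : Law B} {C R C' R' : ℝ} (hC : 0 ≤ C) (hR : 0 ≤ R)
    (hC' : 0 ≤ C') (hR' : 0 ≤ R') (hμ : μ.IsBounded C R) (hν : ν.IsBounded C' R')
    (hlin : μ.IsMultilinear) {r : ℝ} {c : B} (hr : |r| * (R * C' + R') * ‖c‖ < 1) :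
    Law.genFun r (monotoneConv μ ν) c = μ (ν.genFun r c) [] +
      r • Law.genFun r (monotoneConv (μ.shift (ν.genFun r c)) ν) c := by
  have hq0 : 0 ≤ |r| * (R * C' + R') * ‖c‖ := by positivity
  have hr' : |r| * R' * ‖c‖ < 1 := by
    refine lt_of_le_of_lt ?_ hr
    gcongr
    nlinarith [mul_nonneg hR hC']
  have hν_sum := hν.summable hR' hr'
  have hbd := fun e => Law.IsBounded.monotoneConv (C := C * R * ‖e‖) (by positivity) hR hC' hR'
    (hμ.shift e) hν
  have hL := fun i => exists_clm_monotoneConv_shift hC hR hC' hR' hμ hν hlin c (List.replicate i c)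
  choose L hL using hL
  have hLn : ∀ i e, ‖r ^ i • L i e‖ ≤
      C * R * C' * ‖c‖ * (|r| * (R * C' + R') * ‖c‖) ^ i * ‖e‖ := by
    intro i e
    rw [hL]
    refine (norm_pow_smul_le (hbd e) r c i).trans (le_of_eq (by ring))
  set w : ℕ → B := fun j => r ^ j • ν c (List.replicate j c) with hw
  have hF : Summable fun ij : ℕ × ℕ => r ^ ij.1 • L ij.1 (w ij.2) := by
    have h1 : Summable fun i : ℕ => C * R * C' * ‖c‖ * (|r| * (R * C' + R') * ‖c‖) ^ i :=
      (summable_geometric_of_lt_one hq0 hr).mul_left _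
    refine Summable.of_norm_bounded (h1.mul_of_nonneg hν_sum (fun i => by positivity)
      (fun i => norm_nonneg _)) fun ij => ?_
    exact hLn _ _
  obtain ⟨hs1, hs2⟩ := tsum_sum_antidiagonal hF
  obtain ⟨Λ, hΛ⟩ : ∃ Λ : B →L[ℂ] B, ∀ e, Λ e = μ e [] := by
    obtain ⟨Λ, hΛ⟩ := hlin [] []
    refine ⟨LinearMap.mkContinuous Λ C fun e => ?_, fun e => (hΛ e).symm⟩
    rw [← hΛ e]
    refine (hμ e []).trans (le_of_eq (by simp))
  have hw_sum : Summable w := hν_sum.of_norm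
  have hterm : ∀ k, r ^ (k + 1) • monotoneConv μ ν c (List.replicate (k + 1) c) =
      Λ (w (k + 1)) + r • ∑ ij ∈ Finset.HasAntidiagonal.antidiagonal k, r ^ ij.1 • L ij.1 (w ij.2) := by
    intro k
    rw [monotoneConv_replicate_succ, smul_add, ← hΛ]
    congr 1
    · exact (Λ.map_smul_of_tower _ _).symm
    · rw [Finset.smul_sum, Finset.smul_sum]
      refine Finset.sum_congr rfl fun ij hij => ?_
      rw [Finset.HasAntidiagonal.mem_antidiagonal] at hij
      rw [← hL, show L ij.1 (w ij.2) = r ^ ij.2 • L ij.1 (ν c (List.replicate ij.2 c)) from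
        (L ij.1).map_smul_of_tower _ _, smul_smul, smul_smul, ← hij]
      congr 1
      ring
  have hsum := ((Law.IsBounded.monotoneConv hC hR hC' hR' hμ hν).summable (by positivity)
    (r := r) (c := c) hr).of_norm
  have hw1 : Summable fun k => Λ (w (k + 1)) :=
    ((summable_nat_add_iff 1).2 (hw_sum.mapL Λ))
  rw [Law.genFun, hsum.tsum_eq_zero_add]
  simp only [hterm]
  rw [hw1.tsum_add (hs1.const_smul r), tsum_const_smul'' r, hs2]
  have e0 : r ^ 0 • monotoneConv μ ν c (List.replicate 0 c) = Λ (w 0) := by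
    rw [hΛ, hw]; simp [OVProb.monotoneConv, convAux]
  rw [e0, ← add_assoc, ← (hw_sum.mapL Λ).tsum_eq_zero_add, ← Λ.map_tsum hw_sum, hΛ]
  congr 2
  rw [Law.genFun]
  refine tsum_congr fun i => ?_
  rw [← hL]
  have : ∑' j, r ^ i • L i (w j) = r ^ i • ∑' j, L i (w j) := tsum_const_smul'' _
  rw [this, ← (L i).map_tsum hw_sum]
  rfl

/-- The generating function of a monotone convolution is a composition. -/
theorem genFun_monotoneConv {μ ν : Law B} {C R C' R' : ℝ} (hC : 0 ≤ C) (hR : 0 ≤ R)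
    (hC' : 0 ≤ C') (hR' : 0 ≤ R') (hμ : μ.IsBounded C R) (hν : ν.IsBounded C' R')
    (hlin : μ.IsMultilinear) {r : ℝ} {c : B} (hr : |r| * (R * C' + R') * ‖c‖ < 1) :
    Law.genFun r (monotoneConv μ ν) c = μ.genFun r (ν.genFun r c) := by
  set M := ν.genFun r c with hM
  have hr' : |r| * R' * ‖c‖ < 1 := by
    refine lt_of_le_of_lt ?_ hr
    gcongr
    nlinarith [mul_nonneg hR hC']
  -- A rearrangement of `hr`: the outer generating function is evaluated within its range of
  -- convergence.
  have hMn : |r| * R * ‖M‖ < 1 := by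
    have h1 := hν.norm_genFun_le hR' hr'
    have h2 : 0 < 1 - |r| * R' * ‖c‖ := by linarith
    calc |r| * R * ‖M‖ ≤ |r| * R * (C' * ‖c‖ * (1 - |r| * R' * ‖c‖)⁻¹) := by gcongr
      _ = (|r| * R * C' * ‖c‖) / (1 - |r| * R' * ‖c‖) := by ring
      _ < 1 := by rw [div_lt_one h2]; nlinarith
  -- iterate the one-step identity
  set sh : ℕ → Law B := fun K => (fun μ' : Law B => μ'.shift M)^[K] μ with hsh
  have sh_succ : ∀ K, sh (K + 1) = (sh K).shift M := fun K => Function.iterate_succ_apply' _ _ _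
  have sh_lin : ∀ K, (sh K).IsMultilinear := by
    intro K
    induction K with
    | zero => exact hlin
    | succ K ih => rw [sh_succ]; exact ih.shift M
  have sh_bd : ∀ K, (sh K).IsBounded (C * (R * ‖M‖) ^ K) R := by
    intro K
    induction K with
    | zero =>
      show Law.IsBounded μ (C * (R * ‖M‖) ^ 0) R
      simpa using hμ
    | succ K ih =>
      rw [sh_succ]
      have := ih.shift M
      have e : C * (R * ‖M‖) ^ (K + 1) = C * (R * ‖M‖) ^ K * R * ‖M‖ := by ring
      rwa [e]
  have sh_app : ∀ K e l, sh K e l = μ.app (List.replicate K M ++ e :: l) := by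
    intro K
    induction K with
    | zero => intro e l; rfl
    | succ K ih =>
      intro e l
      rw [sh_succ, Law.shift, ih, List.replicate_succ', List.append_assoc]
      rfl
  have sh_val : ∀ K, sh K M [] = μ M (List.replicate K M) := by
    intro K
    rw [sh_app, ← List.replicate_succ']
    rfl
  have iter : ∀ K, Law.genFun r (monotoneConv μ ν) c =
      ∑ m ∈ Finset.range K, r ^ m • μ M (List.replicate m M) +
        r ^ K • Law.genFun r (monotoneConv (sh K) ν) c := by
    intro K
    induction K with
    | zero => simp [hsh]
    | succ K ih =>
      rw [ih, genFun_monotoneConv_step (C := C * (R * ‖M‖) ^ K) (by positivity) hR hC' hR'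
        (sh_bd K) hν (sh_lin K) hr, ← hM, sh_val, ← sh_succ, smul_add, smul_smul, ← pow_succ,
        ← add_assoc, Finset.sum_range_succ]
  -- The `K`-th shift has moment constant `C (R ‖M‖)^K`, so the remainder decays geometrically by
  -- `hMn`.
  have hlim : Tendsto (fun K => r ^ K • Law.genFun r (monotoneConv (sh K) ν) c) atTop (𝓝 0) := by
    set D := C' * ‖c‖ * (1 - |r| * (R * C' + R') * ‖c‖)⁻¹ with hD
    have hbound : ∀ K, ‖r ^ K • Law.genFun r (monotoneConv (sh K) ν) c‖ ≤
        C * D * (|r| * R * ‖M‖) ^ K := by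
      intro K
      have := (Law.IsBounded.monotoneConv (C := C * (R * ‖M‖) ^ K) (by positivity) hR hC' hR'
        (sh_bd K) hν).norm_genFun_le (by positivity) (r := r) (c := c) hr
      rw [norm_smul, norm_pow, Real.norm_eq_abs]
      refine (mul_le_mul_of_nonneg_left this (by positivity)).trans (le_of_eq ?_)
      rw [hD]; ring
    refine squeeze_zero_norm hbound ?_
    have := (tendsto_pow_atTop_nhds_zero_of_lt_one (by positivity) hMn).const_mul (C * D)
    simpa using this
  have hsum := (hμ.summable hR hMn).of_norm.hasSum.tendsto_sum_nat
  have h1 := hsum.add hlim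
  rw [add_zero] at h1
  have h2 : Tendsto (fun K => ∑ m ∈ Finset.range K, r ^ m • μ M (List.replicate m M) +
        r ^ K • Law.genFun r (monotoneConv (sh K) ν) c) atTop
      (𝓝 (Law.genFun r (monotoneConv μ ν) c)) := by
    simp only [← iter]
    exact tendsto_const_nhds
  exact tendsto_nhds_unique h2 h1

end GeneratingFunctions

/-! ### Arcsine generating functions as flow maps. -/

section ArcsineFlow

open Filter Topology

variable {B : Type u} [CStarAlgebra B] [PartialOrder B] [StarOrderedRing B]

theorem norm_arcsineMoment_two_mul_le (η : B →L[ℂ] B) (c : B) (k : ℕ) :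
    ‖arcsineMoment η c (2 * k)‖ ≤ ‖c‖ * (16 * ‖η‖ * ‖c‖ ^ 2) ^ k := by
  refine (norm_arcsineMoment_le η c (2 * k)).trans (le_of_eq ?_)
  have h : (4 * √‖η‖ * ‖c‖) ^ 2 = 16 * ‖η‖ * ‖c‖ ^ 2 := by
    rw [mul_pow, mul_pow, Real.sq_sqrt (norm_nonneg _)]
    norm_num
  rw [pow_mul, h]

/-- The subordination equation for the generating function of the even arcsine moments. -/
theorem tsum_arcsineMoment_eq (η : B →L[ℂ] B) {c : B} {t : ℝ}
    (ht : |t| * (16 * ‖η‖ * ‖c‖ ^ 2) < 1) :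
    ∑' k, t ^ k • arcsineMoment η c (2 * k) =
      c + c * (∑' k : ℕ, (t ^ (k + 1) / (k + 1)) • η (arcsineMoment η c (2 * k))) *
        ∑' k, t ^ k • arcsineMoment η c (2 * k) := by
  set q := 16 * ‖η‖ * ‖c‖ ^ 2 with hq
  have hgeo := summable_geometric_of_lt_one (by positivity) ht
  set G : ℕ → B := fun k => t ^ k • arcsineMoment η c (2 * k) with hG
  set H : ℕ → B := fun k => (t ^ (k + 1) / (k + 1)) • η (arcsineMoment η c (2 * k)) with hH
  have hGn : Summable fun k => ‖G k‖ := by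
    refine Summable.of_nonneg_of_le (fun _ => norm_nonneg _) (fun k => ?_) (hgeo.mul_left ‖c‖)
    rw [hG, norm_smul, norm_pow, Real.norm_eq_abs, mul_pow]
    calc _ ≤ |t| ^ k * (‖c‖ * q ^ k) := by
          gcongr; exact norm_arcsineMoment_two_mul_le η c k
      _ = _ := by ring
  have hHn : Summable fun k => ‖H k‖ := by
    refine Summable.of_nonneg_of_le (fun _ => norm_nonneg _) (fun k => ?_)
      (hGn.mul_left (|t| * ‖η‖))
    rw [hH, hG, norm_smul, norm_smul, norm_div, norm_pow, norm_pow, Real.norm_eq_abs]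
    have h1 : (1 : ℝ) ≤ ‖(k + 1 : ℝ)‖ := by
      rw [Real.norm_of_nonneg (by positivity)]; linarith [(Nat.cast_nonneg k : (0 : ℝ) ≤ k)]
    calc _ ≤ |t| ^ (k + 1) * (‖η‖ * ‖arcsineMoment η c (2 * k)‖) := by
          gcongr
          · exact div_le_self (by positivity) h1
          · exact η.le_opNorm _
      _ = _ := by ring
  have hF : Summable fun ij : ℕ × ℕ => c * (H ij.1 * G ij.2) :=
    (Summable.mul_norm hHn hGn).of_norm.mul_left c
  obtain ⟨-, hs⟩ := tsum_sum_antidiagonal hF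
  conv_lhs => rw [hGn.of_norm.tsum_eq_zero_add]
  congr 1
  · simp [hG, arcsineMoment_zero]
  -- The even moment recursion is a Cauchy product; its weight `1/(i+1)` goes into `H`, as in
  -- term-by-term integration.
  · have hterm : ∀ k, G (k + 1) =
        ∑ ij ∈ Finset.HasAntidiagonal.antidiagonal k, c * (H ij.1 * G ij.2) := by
      intro k
      simp only [hG, hH]
      rw [arcsineMoment_two_mul_succ, Finset.smul_sum]
      refine Finset.sum_congr rfl fun ij hij => ?_
      rw [Finset.HasAntidiagonal.mem_antidiagonal] at hij
      rw [smul_mul_smul_comm, mul_smul_comm, mul_assoc, ← Complex.coe_smul, ← Complex.coe_smul,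
        smul_smul]
      congr 1
      rw [← hij]
      push_cast
      ring
    simp only [hterm]
    rw [hs]
    have e1 : ∀ i, ∑' j, c * (H i * G j) = c * H i * ∑' j, G j := by
      intro i
      rw [← hGn.of_norm.tsum_mul_left]
      simp only [mul_assoc]
    simp only [e1]
    rw [(hHn.of_norm.mul_left c).tsum_mul_right, hHn.of_norm.tsum_mul_left]

theorem genFun_arcsineLaw_eq_tsum (η : B →L[ℂ] B) (c : B) (r : ℝ) :
    Law.genFun r (arcsineLaw η) c = ∑' k, (r ^ 2) ^ k • arcsineMoment η c (2 * k) := by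
  have hinj : Function.Injective fun k : ℕ => 2 * k := fun a b h => by simpa using h
  have hsupp : Function.support (fun k => r ^ k • arcsineMoment η c k) ⊆
      Set.range fun k : ℕ => 2 * k := by
    intro k hk
    rcases Nat.even_or_odd' k with ⟨i, rfl | rfl⟩
    · exact ⟨i, rfl⟩
    · exact absurd (by simp [arcsineMoment_odd]) hk
  have := hinj.tsum_eq hsupp
  simp only [pow_mul] at this
  exact this.symm

/-- The generating function of the arcsine law is given by the flow of `w' = -η(w⁻¹)`. -/
theorem IsPositiveMap.genFun_arcsineLaw {η : B →L[ℂ] B} (hη : IsPositiveMap η) {r δ : ℝ}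
    (hδ : 0 < δ) {w : B} (hw : w ∈ halfSpace B δ)
    (hr : (r ^ 2 + 1) * (16 * ‖η‖ * ‖w⁻¹ʳ‖ ^ 2) ≤ 1 / 2) :
    Law.genFun r (arcsineLaw η) w⁻¹ʳ = (flow η (r ^ 2) w)⁻¹ʳ := by
  set s := r ^ 2 with hs
  have hs0 : 0 ≤ s := sq_nonneg r
  set c := w⁻¹ʳ with hc
  set q := 16 * ‖η‖ * ‖c‖ ^ 2 with hq
  have hq0 : 0 ≤ q := by positivity
  have hwu := isUnit_of_mem_halfSpace hδ hw
  have hwc : w * c = 1 := Ring.mul_inverse_cancel w hwu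
  have hcw : c * w = 1 := Ring.inverse_mul_cancel w hwu
  set g : ℝ → B := fun t => ∑' k, t ^ k • arcsineMoment η c (2 * k) with hg
  -- `h` is the antiderivative of `η ∘ g` with `h 0 = 0`. The equation `g = c + c h g` says `g = (w
  -- - h)⁻¹`, so `w - h` solves the flow equation and starts at `w`.
  set h : ℝ → B := fun t => ∑' k : ℕ, (t ^ (k + 1) / (k + 1)) • η (arcsineMoment η c (2 * k))
    with hh
  -- The `+ 1` leaves an open interval around `[0, s]` for termwise differentiation; the ratio `1/2`
  -- bounds the geometric sums by `2`.
  have hts : ∀ t, |t| < s + 1 → |t| * q ≤ 1 / 2 := fun t ht =>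
    (mul_le_mul_of_nonneg_right ht.le hq0).trans hr
  have hgs : ∀ t, |t| < s + 1 → Summable fun k => t ^ k • arcsineMoment η c (2 * k) := by
    intro t ht
    have h1 := summable_geometric_of_lt_one (mul_nonneg (abs_nonneg t) hq0)
      ((hts t ht).trans_lt (by norm_num))
    refine Summable.of_norm_bounded (h1.mul_left ‖c‖) fun k => ?_
    rw [norm_smul, norm_pow, Real.norm_eq_abs, mul_pow]
    calc _ ≤ |t| ^ k * (‖c‖ * q ^ k) := by
          gcongr; exact norm_arcsineMoment_two_mul_le η c k
      _ = _ := by ring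
  have hgn : ∀ t, |t| < s + 1 → ‖g t‖ ≤ 2 * ‖c‖ := by
    intro t ht
    have h2 := hts t ht
    have h1 := hasSum_geometric_of_lt_one (mul_nonneg (abs_nonneg t) hq0)
      (h2.trans_lt (by norm_num))
    have h3 : ‖g t‖ ≤ ‖c‖ * (1 - |t| * q)⁻¹ := by
      refine tsum_of_norm_bounded (h1.mul_left ‖c‖) fun k => ?_
      rw [norm_smul, norm_pow, Real.norm_eq_abs, mul_pow]
      calc _ ≤ |t| ^ k * (‖c‖ * q ^ k) := by
            gcongr; exact norm_arcsineMoment_two_mul_le η c k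
        _ = _ := by ring
    refine h3.trans ?_
    rw [mul_comm]
    gcongr
    rw [inv_le_comm₀ (by linarith) (by norm_num)]
    linarith
  have hbd : ∀ (t : ℝ) (k : ℕ), |t| < s + 1 → ‖t ^ k • η (arcsineMoment η c (2 * k))‖ ≤
      ‖η‖ * ‖c‖ * ((s + 1) * q) ^ k := by
    intro t k ht
    rw [norm_smul, norm_pow, Real.norm_eq_abs]
    calc _ ≤ (s + 1) ^ k * (‖η‖ * (‖c‖ * q ^ k)) := by
          gcongr
          exact (η.le_opNorm _).trans (by gcongr; exact norm_arcsineMoment_two_mul_le η c k)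
      _ = _ := by rw [mul_pow (s + 1) q k]; ring
  have hT := summable_geometric_of_lt_one (mul_nonneg (by linarith) hq0 : 0 ≤ (s + 1) * q)
    (hr.trans_lt (by norm_num))
  have hh0 : h 0 = 0 := by simp [hh]
  have hderiv : ∀ t, |t| < s + 1 → HasDerivAt h (η (g t)) t := by
    intro t ht
    have hmem : ∀ y : ℝ, y ∈ Set.Ioo (-(s + 1)) (s + 1) ↔ |y| < s + 1 := fun y => abs_lt.symm
    have key := hasDerivAt_tsum_of_isPreconnected
      (g := fun (k : ℕ) (t : ℝ) => (t ^ (k + 1) / (k + 1)) • η (arcsineMoment η c (2 * k)))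
      (g' := fun k t => t ^ k • η (arcsineMoment η c (2 * k))) (y₀ := 0) (y := t)
      (hT.mul_left (‖η‖ * ‖c‖)) (isOpen_Ioo (a := -(s + 1)) (b := s + 1)) isPreconnected_Ioo
      (fun k y _ => by
        refine HasDerivAt.smul_const ?_ _
        have h1 := (hasDerivAt_pow (k + 1) y).div_const ((k : ℝ) + 1)
        have h2 : ((k + 1 : ℕ) : ℝ) * y ^ (k + 1 - 1) / ((k : ℝ) + 1) = y ^ k := by
          push_cast
          exact mul_div_cancel_left₀ _ (by positivity)
        rwa [h2] at h1)
      (fun k y hy => hbd y k ((hmem y).1 hy)) ((hmem 0).2 (by rw [abs_zero]; linarith))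
      (by simp) ((hmem t).2 ht)
    have e : ∑' k, t ^ k • η (arcsineMoment η c (2 * k)) = η (g t) := by
      rw [hg, η.map_tsum (hgs t ht)]
      exact tsum_congr fun k => (η.map_smul_of_tower _ _).symm
    rwa [e] at key
  have hhn : ∀ t, |t| < s + 1 → ‖c * h t‖ < 1 := by
    intro t ht
    have h2 := hts t ht
    have h1 := hasSum_geometric_of_lt_one (mul_nonneg (abs_nonneg t) hq0)
      (h2.trans_lt (by norm_num))
    have h3 : ‖h t‖ ≤ |t| * ‖η‖ * ‖c‖ * (1 - |t| * q)⁻¹ := by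
      refine tsum_of_norm_bounded (h1.mul_left (|t| * ‖η‖ * ‖c‖)) fun k => ?_
      have h1 : (1 : ℝ) ≤ ‖(k + 1 : ℝ)‖ := by
        rw [Real.norm_of_nonneg (by positivity)]; linarith [(Nat.cast_nonneg k : (0 : ℝ) ≤ k)]
      rw [norm_smul, norm_div, norm_pow, Real.norm_eq_abs, mul_pow]
      calc _ ≤ |t| ^ (k + 1) * (‖η‖ * (‖c‖ * q ^ k)) := by
            gcongr
            · exact div_le_self (by positivity) h1
            · exact (η.le_opNorm _).trans (by gcongr; exact norm_arcsineMoment_two_mul_le η c k)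
        _ = _ := by ring
    have h4 : (1 - |t| * q)⁻¹ ≤ 2 := by
      rw [inv_le_comm₀ (by linarith) (by norm_num)]; linarith
    calc ‖c * h t‖ ≤ ‖c‖ * ‖h t‖ := norm_mul_le _ _
      _ ≤ ‖c‖ * (|t| * ‖η‖ * ‖c‖ * 2) := by
        gcongr
        exact h3.trans (by gcongr)
      _ = |t| * q / 8 := by rw [hq]; ring
      _ < 1 := by linarith
  have hgeq : ∀ t, |t| < s + 1 → g t = c + c * h t * g t := fun t ht =>
    tsum_arcsineMoment_eq η ((hts t ht).trans_lt (by norm_num))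
  have hfu : ∀ t, |t| < s + 1 → IsUnit (w - h t) := by
    intro t ht
    have : w - h t = w * (1 - c * h t) := by rw [mul_sub, mul_one, ← mul_assoc, hwc, one_mul]
    rw [this]
    exact hwu.mul (isUnit_one_sub_of_norm_lt_one (hhn t ht))
  have hfg : ∀ t, |t| < s + 1 → (w - h t)⁻¹ʳ = g t := by
    intro t ht
    have h1 : (w - h t) * g t = 1 := by
      have h2 : w * g t = 1 + h t * g t := by
        conv_lhs => rw [hgeq t ht]
        rw [mul_add, hwc, ← mul_assoc, ← mul_assoc, hwc, one_mul]
      rw [sub_mul, h2, add_sub_cancel_right]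
    calc (w - h t)⁻¹ʳ = (w - h t)⁻¹ʳ * ((w - h t) * g t) := by rw [h1, mul_one]
      _ = g t := by rw [← mul_assoc, Ring.inverse_mul_cancel _ (hfu t ht), one_mul]
  have habs : ∀ t ∈ Set.Icc 0 s, |t| < s + 1 := fun t ht => by
    rw [abs_of_nonneg ht.1]; linarith [ht.2]
  have hflow := hη.flow_eq_of_hasDerivAt (f := fun t => w - h t) (M := 2 * ‖c‖) hs0 hδ
    (by simpa [hh0] using hw) (fun t ht => hfu t (habs t ht))
    (fun t ht => by rw [hfg t (habs t ht)]; exact hgn t (habs t ht))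
    (fun t ht => by
      rw [hfg t (habs t ht)]
      exact ((hderiv t (habs t ht)).const_sub w).hasDerivWithinAt)
  simp only [hh0, sub_zero] at hflow
  rw [hflow, hfg s (habs s ⟨hs0, le_rfl⟩), genFun_arcsineLaw_eq_tsum]

theorem isBounded_diracZero : Law.IsBounded (diracZero : Law B) 1 0 := by
  intro b l
  cases l with
  | nil => simp [diracZero]
  | cons d l => simp [diracZero]

theorem genFun_diracZero (r : ℝ) (c : B) : Law.genFun r diracZero c = c := by
  rw [Law.genFun, tsum_eq_single 0]
  · simp [diracZero]
  · intro k hk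
    cases k with
    | zero => exact absurd rfl hk
    | succ k => simp [List.replicate_succ, diracZero]

theorem foldr_flow_mem {s δ : ℝ} (hs : 0 ≤ s) (hδ : 0 < δ) (l : List (B →L[ℂ] B))
    (hl : ∀ η ∈ l, IsPositiveMap η) {w : B} (hw : w ∈ halfSpace B δ) :
    l.foldr (fun η w => flow η s w) w ∈ halfSpace B δ := by
  induction l with
  | nil => exact hw
  | cons η l ih =>
    exact (hl η (by simp)).flow_mem hs hδ (ih fun ζ hζ => hl ζ (by simp [hζ]))

/-- The generating function of a monotone convolution of arcsine laws, for large arguments. -/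
theorem exists_genFun_foldr_arcsineLaw (r : ℝ) (l : List (B →L[ℂ] B))
    (hl : ∀ η ∈ l, IsPositiveMap η) :
    (∃ C R, 0 ≤ C ∧ 0 ≤ R ∧
      Law.IsBounded ((l.map fun η : B →L[ℂ] B => (arcsineLaw η : Law B)).foldr monotoneConv diracZero) C R) ∧
    ∃ Y > 0, ∀ δ, Y ≤ δ → ∀ w ∈ halfSpace B δ,
      Law.genFun r ((l.map fun η : B →L[ℂ] B => (arcsineLaw η : Law B)).foldr monotoneConv diracZero) w⁻¹ʳ =
        (l.foldr (fun η w => flow η (r ^ 2) w) w)⁻¹ʳ := by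
  induction l with
  | nil => exact ⟨⟨1, 0, zero_le_one, le_rfl, isBounded_diracZero⟩, 1, one_pos,
      fun δ _ w _ => genFun_diracZero r _⟩
  | cons η l ih =>
    obtain ⟨⟨C, R, hC, hR, hbd⟩, Y, hY, hgen⟩ := ih fun ζ hζ => hl ζ (by simp [hζ])
    have hη := hl η (by simp)
    refine ⟨⟨1 * C, 4 * √‖η‖ * C + R, by positivity, by positivity,
      (isBounded_arcsineLaw η).monotoneConv zero_le_one (by positivity) hC hR hbd⟩, ?_⟩
    -- One summand per requirement: the threshold of the tail, `δ ≥ 1`, convergence for the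
    -- composition rule, and the smallness condition of `genFun_arcsineLaw`.
    refine ⟨Y + 1 + |r| * (4 * √‖η‖ * C + R) + (r ^ 2 + 1) * (32 * ‖η‖), by positivity, ?_⟩
    intro δ hYδ w hw
    have p1 : 0 ≤ |r| * (4 * √‖η‖ * C + R) := by positivity
    have p2 : 0 ≤ (r ^ 2 + 1) * (32 * ‖η‖) := by positivity
    have hδ : 0 < δ := by linarith
    have hδ1 : 1 ≤ δ := by linarith
    have hn : ∀ {v : B}, v ∈ halfSpace B δ → ‖v⁻¹ʳ‖ ≤ δ⁻¹ := fun hv =>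
      norm_inverse_le_of_mem_halfSpace hδ hv
    have hmem := foldr_flow_mem (sq_nonneg r) hδ l (fun ζ hζ => hl ζ (by simp [hζ])) hw
    rw [List.map_cons, List.foldr_cons, List.foldr_cons,
      genFun_monotoneConv zero_le_one (by positivity) hC hR (isBounded_arcsineLaw η) hbd
        (isMultilinear_arcsineLaw η), hgen δ (by linarith) w hw]
    · refine hη.genFun_arcsineLaw hδ hmem ?_
      calc _ ≤ (r ^ 2 + 1) * (16 * ‖η‖ * δ⁻¹ ^ 2) := by
            gcongr; exact hn hmem
        _ = ((r ^ 2 + 1) * (32 * ‖η‖)) * δ⁻¹ * δ⁻¹ / 2 := by ring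
        _ ≤ δ * δ⁻¹ * δ⁻¹ / 2 := by gcongr; linarith
        _ = δ⁻¹ / 2 := by rw [mul_inv_cancel₀ hδ.ne', one_mul]
        _ ≤ 1 / 2 := by
          have := inv_le_one_of_one_le₀ hδ1
          linarith
    · calc _ ≤ |r| * (4 * √‖η‖ * C + R) * δ⁻¹ := by gcongr; exact hn hw
        _ < δ * δ⁻¹ := by
          refine mul_lt_mul_of_pos_right ?_ (by positivity)
          linarith
        _ = 1 := mul_inv_cancel₀ hδ.ne'

end ArcsineFlow

/-! ### The Cauchy transform of a generalized arcsine element, by analytic continuation. -/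

section CauchyOfLaw

open Filter Topology

variable {B : Type u} {A : Type v}
  [CStarAlgebra B] [PartialOrder B] [StarOrderedRing B]
  [CStarAlgebra A] [PartialOrder A] [StarOrderedRing A]

/-- The Cauchy transform is the generating function of the moments, for large arguments. -/
theorem OVSpace.cauchy_eq_genFun (P : OVSpace B A) {a : A} {μ : Law B} {r : ℝ}
    (h : P.law a = dilation r μ) {b : B} (hb : IsUnit b) (hab : ‖a‖ * ‖b⁻¹ʳ‖ < 1) :
    P.cauchy a b = Law.genFun r μ b⁻¹ʳ := by
  set c := b⁻¹ʳ with hc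
  have hbc : b * c = 1 := Ring.mul_inverse_cancel b hb
  have hcb : c * b = 1 := Ring.inverse_mul_cancel b hb
  set t := a * P.incl c with ht
  have htn : ‖t‖ < 1 := by
    refine lt_of_le_of_lt (norm_mul_le _ _) (lt_of_le_of_lt ?_ hab)
    gcongr
    exact P.incl_norm_le c
  have hsum : Summable fun k => t ^ k := summable_geometric_of_norm_lt_one htn
  have hres : P.resolvent a b = ∑' k, P.incl c * t ^ k := by
    rw [hsum.tsum_mul_left]
    have h1 : P.incl b - a = (1 - t) * P.incl b := by
      rw [sub_mul, one_mul, ht, mul_assoc, ← map_mul, hcb, map_one, mul_one]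
    have hu : IsUnit (P.incl b - a) := by
      rw [h1]
      exact (isUnit_one_sub_of_norm_lt_one htn).mul (hb.map P.incl)
    have h2 : (P.incl b - a) * (P.incl c * ∑' k, t ^ k) = 1 := by
      rw [h1, mul_assoc, ← mul_assoc (P.incl b), ← map_mul, hbc, map_one, one_mul,
        mul_neg_geom_series t htn]
    calc P.resolvent a b = Ring.inverse (P.incl b - a) *
          ((P.incl b - a) * (P.incl c * ∑' k, t ^ k)) := by rw [h2, mul_one]; rfl
      _ = _ := by rw [← mul_assoc, Ring.inverse_mul_cancel _ hu, one_mul]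
  rw [OVSpace.cauchy, hres, ← OVSpace.expect_apply, P.expect.map_tsum (hsum.mul_left _), Law.genFun]
  refine tsum_congr fun k => ?_
  have := congrFun (congrFun h c) (List.replicate k c)
  rw [OVSpace.law, dilation, List.length_replicate] at this
  rw [← this, OVSpace.expect_apply, OVSpace.monomial]
  simp [ht]

theorem add_smul_one_mem_halfSpace {b : B} {δ : ℝ} (hb : b ∈ halfSpace B δ) (z : ℂ) :
    b + z • 1 ∈ halfSpace B (δ + z.im) := by
  have h : (ℑ (z • (1 : B)) : B) = algebraMap ℝ B z.im := by
    have : z • (1 : B) = z.re • (1 : B) + Complex.I • (z.im • (1 : B)) := by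
      rw [← Complex.coe_smul, ← Complex.coe_smul, smul_smul, ← add_smul]
      congr 1
      rw [mul_comm]; exact (Complex.re_add_im z).symm
    rw [this, map_add, imaginaryPart_I_smul]
    have h1 : IsSelfAdjoint (z.re • (1 : B)) := by
      rw [IsSelfAdjoint, star_smul, star_one, star_trivial]
    have h2 : IsSelfAdjoint (z.im • (1 : B)) := by
      rw [IsSelfAdjoint, star_smul, star_one, star_trivial]
    rw [AddSubgroup.coe_add, h1.imaginaryPart, h2.coe_realPart, Algebra.algebraMap_eq_smul_one]
    simp
  change _ ≤ _ at hb ⊢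
  rw [map_add, map_add, AddSubgroup.coe_add, h]
  exact add_le_add_left hb _

/-- The Cauchy transform of a generalized arcsine element. -/
theorem OVSpace.cauchy_eq_inverse_foldr_flow (P : OVSpace B A) {a : A} (ha : IsSelfAdjoint a)
    {r : ℝ} (l : List (B →L[ℂ] B)) (hl : ∀ η ∈ l, IsPositiveMap η)
    (h : P.law a = dilation r ((l.map fun η : B →L[ℂ] B => (arcsineLaw η : Law B)).foldr monotoneConv diracZero))
    {δ : ℝ} (hδ : 0 < δ) {b : B} (hb : b ∈ halfSpace B δ) :
    P.cauchy a b = (l.foldr (fun η w => flow η (r ^ 2) w) b)⁻¹ʳ := by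
  obtain ⟨-, Y, hY, hgen⟩ := exists_genFun_foldr_arcsineLaw r l hl
  -- The continuation runs along `z ↦ b + z`, from large `Im z` down to `z = 0`. Giving up half of
  -- `δ` makes `0` a point of the open connected set `U`.
  set U : Set ℂ := {z | -(δ / 2) < z.im} with hU
  have hUo : IsOpen U := isOpen_lt continuous_const Complex.continuous_im
  have hUc : IsPreconnected U := (convex_halfSpace_im_gt _).isPreconnected
  set u : ℂ → B := fun z => b + z • 1 with hu
  have huU : ∀ z ∈ U, u z ∈ halfSpace B (δ / 2) := fun z hz =>
    halfSpace_mono (by have : -(δ / 2) < z.im := hz; linarith) (add_smul_one_mem_halfSpace hb z)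
  have hud : Differentiable ℂ u := by fun_prop
  have hd2 : 0 < δ / 2 := by linarith
  have hf : AnalyticOnNhd ℂ (fun z => P.cauchy a (u z)) U := by
    refine DifferentiableOn.analyticOnNhd ?_ hUo
    have h1 : DifferentiableOn ℂ (fun z => (P.incl (u z) - a)⁻¹ʳ) U := by
      refine differentiableOn_inverse_comp (δ := δ / 2) (DifferentiableOn.sub_const ?_ a) hd2
        fun z hz => P.incl_sub_mem_halfSpace (huU z hz) ha
      have : (fun z => P.incl (u z)) = fun z : ℂ => P.incl b + z • 1 := by
        funext z; simp [hu]
      rw [this]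
      fun_prop
    exact P.expect.differentiable.comp_differentiableOn h1
  have hg : AnalyticOnNhd ℂ (fun z => (l.foldr (fun η w => flow η (r ^ 2) w) (u z))⁻¹ʳ) U := by
    refine DifferentiableOn.analyticOnNhd ?_ hUo
    have key : DifferentiableOn ℂ (fun z => l.foldr (fun η w => flow η (r ^ 2) w) (u z)) U := by
      clear h hgen
      induction l with
      | nil => exact hud.differentiableOn
      | cons η l ih =>
        exact (hl η (by simp)).differentiableOn_flow (sq_nonneg r) hd2 hUo
          (ih fun ζ hζ => hl ζ (by simp [hζ]))
          fun z hz => foldr_flow_mem (sq_nonneg r) hd2 l (fun ζ hζ => hl ζ (by simp [hζ])) (huU z hz)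
    exact differentiableOn_inverse_comp key hd2 fun z hz =>
      foldr_flow_mem (sq_nonneg r) hd2 l hl (huU z hz)
  -- Above this height both the generating function formula and the Neumann series of the resolvent
  -- are available.
  set T := Y + ‖a‖ + 1 with hT
  have hagree : ∀ z : ℂ, T < z.im →
      P.cauchy a (u z) = (l.foldr (fun η w => flow η (r ^ 2) w) (u z))⁻¹ʳ := by
    intro z hz
    have hz0 : 0 < z.im := by linarith [norm_nonneg a]
    have hm : u z ∈ halfSpace B z.im :=
      halfSpace_mono (by linarith) (add_smul_one_mem_halfSpace hb z)
    rw [← hgen z.im (by linarith [norm_nonneg a]) (u z) hm]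
    refine P.cauchy_eq_genFun h (isUnit_of_mem_halfSpace hz0 hm) ?_
    calc _ ≤ ‖a‖ * z.im⁻¹ := by
          gcongr; exact norm_inverse_le_of_mem_halfSpace hz0 hm
      _ < z.im * z.im⁻¹ := mul_lt_mul_of_pos_right (by linarith) (by positivity)
      _ = 1 := mul_inv_cancel₀ hz0.ne'
  set z₀ : ℂ := ⟨0, T + 1⟩ with hz₀
  have hz₀U : z₀ ∈ U := by
    change -(δ / 2) < T + 1
    linarith [norm_nonneg a]
  have hev : (fun z => P.cauchy a (u z)) =ᶠ[𝓝 z₀]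
      fun z => (l.foldr (fun η w => flow η (r ^ 2) w) (u z))⁻¹ʳ := by
    have : {z : ℂ | T < z.im} ∈ 𝓝 z₀ :=
      (isOpen_lt continuous_const Complex.continuous_im).mem_nhds (by
        change T < T + 1
        linarith)
    filter_upwards [this] with z hz using hagree z hz
  have := hf.eqOn_of_preconnected_of_eventuallyEq hg hUc hz₀U hev
    (show (0 : ℂ) ∈ U by change -(δ / 2) < (0 : ℂ).im; simp [hδ])
  simpa [hu] using this

end CauchyOfLaw

/-! ### Telescoping and the operator-valued bound. -/

section BerryEsseen

variable {B : Type u} {A : Type v}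
  [CStarAlgebra B] [PartialOrder B] [StarOrderedRing B]
  [CStarAlgebra A] [PartialOrder A] [StarOrderedRing A]

theorem OVSpace.norm_E_sq_le_alpha2 (P : OVSpace B A) {n : ℕ} (x : Fin n → A) (j : Fin n) :
    ‖P.E (x j ^ 2)‖ ≤ P.alpha2 x :=
  le_ciSup (f := fun i => ‖P.E (x i ^ 2)‖) (Set.finite_range _).bddAbove j

theorem OVSpace.alpha2_nonneg (P : OVSpace B A) {n : ℕ} (x : Fin n → A) : 0 ≤ P.alpha2 x :=
  Real.iSup_nonneg fun _ => norm_nonneg _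

theorem OVSpace.alpha4_nonneg (P : OVSpace B A) {n : ℕ} (x : Fin n → A) : 0 ≤ P.alpha4 x :=
  Real.iSup_nonneg fun _ => Real.iSup_nonneg fun _ => norm_nonneg _

theorem OVSpace.norm_E_fourth_le (P : OVSpace B A) (a : A) (b : B) :
    ‖P.E (a * star (P.incl b) * a ^ 2 * P.incl b * a)‖ ≤ ‖a‖ ^ 4 * ‖b‖ ^ 2 := by
  refine (P.norm_E_le _).trans ?_
  calc _ ≤ ‖a‖ * ‖star (P.incl b)‖ * ‖a ^ 2‖ * ‖P.incl b‖ * ‖a‖ := by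
        refine (norm_mul_le _ _).trans ?_
        gcongr
        refine (norm_mul_le _ _).trans ?_
        gcongr
        exact norm_mul₃_le
    _ ≤ ‖a‖ * ‖b‖ * ‖a‖ ^ 2 * ‖b‖ * ‖a‖ := by
        have h1 := P.incl_norm_le b
        have h2 : ‖a ^ 2‖ ≤ ‖a‖ ^ 2 := by rw [sq, sq]; exact norm_mul_le _ _
        rw [norm_star]
        gcongr
    _ = _ := by ring

theorem OVSpace.norm_E_fourth_le_alpha4 (P : OVSpace B A) {n : ℕ} (x : Fin n → A) (j : Fin n)
    (b : B) : ‖P.E (x j * star (P.incl b) * x j ^ 2 * P.incl b * x j)‖ ≤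
      P.alpha4 x * ‖b‖ ^ 2 := by
  rcases eq_or_ne b 0 with rfl | hb
  · simp
  · have hb' : 0 < ‖b‖ := norm_pos_iff.2 hb
    set d : B := ((‖b‖⁻¹ : ℝ) : ℂ) • b with hd
    have hdn : d ∈ Metric.sphere (0 : B) 1 := by
      rw [mem_sphere_zero_iff_norm, hd, norm_smul, Complex.norm_real, norm_inv, norm_norm,
        inv_mul_cancel₀ hb'.ne']
    have h1 : ‖P.E (x j * star (P.incl d) * x j ^ 2 * P.incl d * x j)‖ ≤ P.alpha4 x := by
      refine le_trans ?_ (le_ciSup (f := fun i => ⨆ b : Metric.sphere (0 : B) 1,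
        ‖P.E (x i * star (P.incl b) * x i ^ 2 * P.incl b * x i)‖) (Set.finite_range _).bddAbove j)
      refine le_ciSup (f := fun b : Metric.sphere (0 : B) 1 =>
        ‖P.E (x j * star (P.incl b) * x j ^ 2 * P.incl b * x j)‖) ?_ ⟨d, hdn⟩
      -- The bound matters: in `ℝ` the supremum of an unbounded family is `0`.
      refine ⟨‖x j‖ ^ 4, ?_⟩
      rintro _ ⟨b, rfl⟩
      have h2 := P.norm_E_fourth_le (x j) (b : B)
      rwa [mem_sphere_zero_iff_norm.1 b.2, one_pow, mul_one] at h2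
    have hbd : b = ((‖b‖ : ℝ) : ℂ) • d := by
      rw [hd, smul_smul, ← Complex.ofReal_mul, mul_inv_cancel₀ hb'.ne', Complex.ofReal_one,
        one_smul]
    have h3 : P.E (x j * star (P.incl b) * x j ^ 2 * P.incl b * x j) =
        ((‖b‖ : ℝ) : ℂ) ^ 2 • P.E (x j * star (P.incl d) * x j ^ 2 * P.incl d * x j) := by
      rw [show P.incl b = ((‖b‖ : ℝ) : ℂ) • P.incl d by rw [← map_smul, ← hbd], star_smul,
        Complex.star_def, Complex.conj_ofReal]
      simp only [mul_smul_comm, smul_mul_assoc, map_smul, smul_smul, sq]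
    rw [h3, norm_smul, norm_pow, Complex.norm_real, norm_norm, mul_comm]
    gcongr

/-- The Schwarz inequality for `x_j²`, with `b = 1` admitted in the supremum because `‖1‖ = 1`. It
serves the case in which the trivial estimate is used. -/
theorem OVSpace.alpha2_le_sqrt_alpha4 [Nontrivial B] (P : OVSpace B A) {n : ℕ} (x : Fin n → A)
    (hsa : ∀ j, IsSelfAdjoint (x j)) : P.alpha2 x ≤ √(P.alpha4 x) := by
  refine Real.iSup_le (fun j => ?_) (Real.sqrt_nonneg _)
  refine Real.le_sqrt_of_sq_le ?_
  have h1 := P.norm_E_sq_le (x j ^ 2) 1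
  have h2 := P.norm_E_fourth_le_alpha4 x j 1
  simp only [star_one, one_mul, P.E_one, map_one, mul_one, norm_one, one_pow] at h1 h2
  refine h1.trans (le_trans (le_of_eq ?_) h2)
  rw [star_pow, (hsa j).star_eq]
  congr 2
  noncomm_ring

variable {n : ℕ} {P : OVSpace B A} {x : Fin n → A}

/-- The cost of replacing one summand by a step of the arcsine flow. -/
theorem OVSpace.MonotoneIndep.norm_cauchy_add_smul_sub_le (h : P.MonotoneIndep x)
    (hsa : ∀ i, IsSelfAdjoint (x i)) (hcent : ∀ i, P.E (x i) = 0) (j : Fin n) {S : A}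
    (hS : S ∈ Submodule.span ℂ (x '' Set.Iio j)) (hSsa : IsSelfAdjoint S) {r δ : ℝ} (hr : 0 ≤ r)
    (hδ : 0 < δ) {w : B} (hw : w ∈ halfSpace B δ) :
    ‖P.cauchy (S + r • x j) w - P.cauchy S (flow (P.varianceCLM (x j) (hsa j)) (r ^ 2) w)‖ ≤
      r ^ 3 * (√(P.alpha2 x) * √(P.alpha4 x) * δ⁻¹ ^ 4) +
        3 / 2 * P.alpha2 x ^ 2 * δ⁻¹ ^ 5 * (r ^ 2) ^ 2 := by
  have hα4 := P.alpha4_nonneg x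
  have hy2 : (r • x j) ^ 2 = r ^ 2 • x j ^ 2 := smul_pow _ _ _
  have hysa : IsSelfAdjoint (r • x j) := by
    rw [IsSelfAdjoint, star_smul, (hsa j).star_eq, star_trivial]
  have hy : r • x j ∈ P.bimoduleAlg (x j) := by
    rw [← Complex.coe_smul]
    exact Submodule.smul_mem _ _ (P.self_mem_bimoduleAlg _)
  have key := h.norm_cauchy_add_sub_le hsa (j := j) hS hSsa hy hysa
    (by rw [P.E_real_smul, hcent, smul_zero]) (a₂ := r ^ 2 * P.alpha2 x)
    (a₄ := (r ^ 2) ^ 2 * P.alpha4 x) hδ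
    (by
      rw [hy2, P.E_real_smul, norm_smul, Real.norm_of_nonneg (by positivity)]
      gcongr
      exact P.norm_E_sq_le_alpha2 x j)
    (fun b => by
      have e : P.E (r • x j * star (P.incl b) * (r • x j) ^ 2 * P.incl b * r • x j) =
          (r ^ 2) ^ 2 • P.E (x j * star (P.incl b) * x j ^ 2 * P.incl b * x j) := by
        rw [hy2]
        simp only [mul_smul_comm, smul_mul_assoc, P.E_real_smul, smul_smul]
        congr 1
        ring
      rw [e, norm_smul, Real.norm_of_nonneg (by positivity), mul_assoc ((r ^ 2) ^ 2)]
      exact mul_le_mul_of_nonneg_left (P.norm_E_fourth_le_alpha4 x j b) (by positivity)) (by positivity) hw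
  have hflow := P.norm_cauchy_flow_sub_le hSsa (P.isPositiveMap_varianceCLM (hsa j))
    ((P.norm_varianceCLM_le (hsa j)).trans (P.norm_E_sq_le_alpha2 x j)) (sq_nonneg r) hδ hw
  -- The second order terms of the two expansions coincide, so they cancel in the difference.
  have hvar : P.E (P.resolvent S w * P.incl (P.variance (r • x j) w⁻¹ʳ) * P.resolvent S w) =
      r ^ 2 • P.E (P.resolvent S w * P.incl (P.varianceCLM (x j) (hsa j) w⁻¹ʳ) *
        P.resolvent S w) := by
    have e : P.variance (r • x j) w⁻¹ʳ = ((r ^ 2 : ℝ) : ℂ) • P.varianceCLM (x j) (hsa j) w⁻¹ʳ := by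
      rw [Complex.coe_smul, P.varianceCLM_apply, OVSpace.variance, OVSpace.variance]
      simp only [mul_smul_comm, smul_mul_assoc, P.E_real_smul, smul_smul, sq]
    rw [e, map_smul, mul_smul_comm, smul_mul_assoc, map_smul, Complex.coe_smul]
  rw [hvar] at key
  have hs : √(r ^ 2 * P.alpha2 x) * √((r ^ 2) ^ 2 * P.alpha4 x) =
      r ^ 3 * (√(P.alpha2 x) * √(P.alpha4 x)) := by
    rw [Real.sqrt_mul (by positivity), Real.sqrt_mul (by positivity), Real.sqrt_sq hr,
      Real.sqrt_sq (by positivity)]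
    ring
  rw [hs] at key
  rw [← mul_assoc]
  refine le_trans ?_ (add_le_add key hflow)
  refine le_trans (le_of_eq ?_) (norm_sub_le _ _)
  congr 1
  abel

theorem OVSpace.cauchy_zero (P : OVSpace B A) {b : B} (hb : IsUnit b) :
    P.cauchy 0 b = b⁻¹ʳ := by
  have h : P.resolvent 0 b = P.incl b⁻¹ʳ := by
    rw [OVSpace.resolvent, sub_zero]
    calc (P.incl b)⁻¹ʳ = (P.incl b)⁻¹ʳ * (P.incl b * P.incl b⁻¹ʳ) := by
          rw [← map_mul, Ring.mul_inverse_cancel b hb, map_one, mul_one]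
      _ = _ := by rw [← mul_assoc, Ring.inverse_mul_cancel _ (hb.map P.incl), one_mul]
  rw [OVSpace.cauchy, h, P.E_incl]

/-- The telescoping sum along the Lindeberg exchange. -/
theorem OVSpace.MonotoneIndep.norm_cauchy_sum_sub_le (h : P.MonotoneIndep x)
    (hsa : ∀ i, IsSelfAdjoint (x i)) (hcent : ∀ i, P.E (x i) = 0) {r δ : ℝ} (hr : 0 ≤ r)
    (hδ : 0 < δ) {b : B} (hb : b ∈ halfSpace B δ) :
    ‖P.cauchy (r • ∑ j, x j) b - ((List.ofFn fun j => P.varianceCLM (x j) (hsa j)).foldr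
      (fun η w => flow η (r ^ 2) w) b)⁻¹ʳ‖ ≤
      n * (r ^ 3 * (√(P.alpha2 x) * √(P.alpha4 x) * δ⁻¹ ^ 4) +
        3 / 2 * P.alpha2 x ^ 2 * δ⁻¹ ^ 5 * (r ^ 2) ^ 2) := by
  set K := r ^ 3 * (√(P.alpha2 x) * √(P.alpha4 x) * δ⁻¹ ^ 4) +
        3 / 2 * P.alpha2 x ^ 2 * δ⁻¹ ^ 5 * (r ^ 2) ^ 2 with hK
  set L := List.ofFn fun j => P.varianceCLM (x j) (hsa j) with hL
  have hLlen : L.length = n := List.length_ofFn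
  have hLpos : ∀ η ∈ L, IsPositiveMap η := by
    intro η hη
    obtain ⟨j, rfl⟩ := (List.mem_ofFn' _ _).1 hη
    exact P.isPositiveMap_varianceCLM (hsa j)
  -- Stage `k` keeps the summands with index below `k` and has turned the others into flow steps of
  -- the argument. Since `w k` is one flow step applied to `w (k + 1)`, passing between stages
  -- removes the last, hence maximal, summand of `S (k + 1)`.
  set w : ℕ → B := fun k => (L.drop k).foldr (fun η w => flow η (r ^ 2) w) b with hw
  set S : ℕ → A := fun k => ∑ i : Fin n with i.val < k, r • x i with hS
  have hwmem : ∀ k, w k ∈ halfSpace B δ := fun k =>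
    foldr_flow_mem (sq_nonneg r) hδ _ (fun η hη => hLpos η (List.mem_of_mem_drop hη)) hb
  have step : ∀ k < n, dist (P.cauchy (S k) (w k)) (P.cauchy (S (k + 1)) (w (k + 1))) ≤ K := by
    intro k hk
    have e1 : w k = flow (P.varianceCLM (x ⟨k, hk⟩) (hsa ⟨k, hk⟩)) (r ^ 2) (w (k + 1)) := by
      simp only [hw]
      rw [List.drop_eq_getElem_cons (by rw [hLlen]; exact hk), List.foldr_cons]
      simp [hL]
    have e2 : S (k + 1) = S k + r • x ⟨k, hk⟩ := by
      simp only [hS]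
      have : (Finset.univ.filter fun i : Fin n => i.val < k + 1) =
          insert ⟨k, hk⟩ (Finset.univ.filter fun i : Fin n => i.val < k) := by
        ext i
        simp only [Finset.mem_filter, Finset.mem_univ, true_and, Finset.mem_insert, Fin.ext_iff]
        omega
      rw [this, Finset.sum_insert (by simp), add_comm]
    rw [dist_comm, dist_eq_norm, e1, e2]
    refine h.norm_cauchy_add_smul_sub_le hsa hcent ⟨k, hk⟩ ?_ ?_ hr hδ (hwmem _)
    · refine Submodule.sum_mem _ fun i hi => ?_
      rw [← Complex.coe_smul]
      refine Submodule.smul_mem _ _ (Submodule.subset_span ⟨i, ?_, rfl⟩)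
      simpa [Fin.lt_def] using hi
    · refine isSelfAdjoint_sum _ fun i _ => ?_
      rw [IsSelfAdjoint, star_smul, (hsa i).star_eq, star_trivial]
  have hsum := dist_le_range_sum_of_dist_le (f := fun k => P.cauchy (S k) (w k)) (d := fun _ => K)
    n (fun {k} hk => step k hk)
  have hw0 : w 0 = L.foldr (fun η w => flow η (r ^ 2) w) b := by simp [hw]
  have hwn : w n = b := by
    simp only [hw]
    rw [← hLlen, List.drop_length, List.foldr_nil]
  have hS0 : S 0 = 0 := by simp [hS]
  have hSn : S n = r • ∑ j, x j := by
    simp only [hS]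
    rw [Finset.filter_true_of_mem (fun i _ => i.2), Finset.smul_sum]
  rw [hS0, P.cauchy_zero (isUnit_of_mem_halfSpace hδ (hwmem 0)), hw0, hSn, hwn, dist_comm,
    dist_eq_norm, Finset.sum_const, Finset.card_range, nsmul_eq_mul] at hsum
  exact hsum

/-- Centre and radius do not depend on `a`, so two transforms differ by at most `δ⁻¹`. The naive `2
δ⁻¹` would be too large for the stated constant. -/
theorem OVSpace.norm_cauchy_add_le [Nontrivial B] (P : OVSpace B A) {a : A} (ha : IsSelfAdjoint a)
    {δ : ℝ} (hδ : 0 < δ) {b : B} (hb : b ∈ halfSpace B δ) :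
    ‖P.cauchy a b + (Complex.I / (2 * δ)) • (1 : B)‖ ≤ (2 * δ)⁻¹ := by
  have h : P.cauchy a b + (Complex.I / (2 * δ)) • (1 : B) =
      P.E ((P.incl b - a)⁻¹ʳ + (Complex.I / (2 * δ)) • (1 : A)) := by
    rw [map_add, map_smul, P.E_one]
    rfl
  rw [h]
  exact (P.norm_E_le _).trans (norm_inverse_add_le hδ (P.incl_sub_mem_halfSpace hb ha))

theorem one_le_sq_mul_add {t z : ℝ} (ht : t ^ 2 = 3 / 2) (hz : 0 ≤ z) (h : 1 ≤ t * z) :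
    1 ≤ z ^ 2 * (z + t * z) := by
  have h2 : 2 / 3 ≤ z ^ 2 := by nlinarith
  have h1 : 1 / 2 ≤ z := by nlinarith
  calc (1 : ℝ) = 2 / 3 * (1 / 2 + 1) := by norm_num
    _ ≤ _ := by gcongr

/-- The Berry-Esseen bound for operator-valued Cauchy transforms. -/
theorem OVSpace.MonotoneIndep.norm_cauchy_sub_arcsine_le {A' : Type*} [CStarAlgebra A']
    [PartialOrder A'] [StarOrderedRing A'] (h : P.MonotoneIndep x) (hn : 1 ≤ n)
    (hsa : ∀ i, IsSelfAdjoint (x i)) (hcent : ∀ i, P.E (x i) = 0) {P' : OVSpace B A'} {a : A'}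
    (ha : IsSelfAdjoint a)
    (hlaw : P'.law a = dilation (1 / √(n : ℝ))
        (monotoneConvFamily fun j => arcsineLaw (P.variance (x j)))) {b : B}
    (hb : b ∈ upperHalfPlane B) :
    ‖P.cauchy ((1 / √(n : ℝ)) • ∑ j, x j) b - P'.cauchy a b‖ ≤
      1 / √(n : ℝ) * ‖Ring.inverse (imaginaryPart b : B)‖ ^ 4 * √(P.alpha2 x) *
        (√(P.alpha4 x) + √(3 / 2 * P.alpha2 x ^ 2)) := by
  rcases subsingleton_or_nontrivial B with hB | hB
  · rw [Subsingleton.elim (P.cauchy ((1 / √(n : ℝ)) • ∑ j, x j) b - P'.cauchy a b) 0, norm_zero]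
    positivity
  obtain ⟨hN, hbδ⟩ := mem_halfSpace_of_mem_upperHalfPlane hb
  set N := ‖(ℑ b : B)⁻¹ʳ‖ with hNdef
  have hδ : 0 < N⁻¹ := inv_pos.2 hN
  set r := 1 / √(n : ℝ) with hr
  have hn' : (1 : ℝ) ≤ n := by exact_mod_cast hn
  have hr0 : 0 < r := by positivity
  have hr2 : n * r ^ 2 = 1 := by
    rw [hr, div_pow, Real.sq_sqrt (by positivity), one_pow, mul_one_div_cancel (by positivity)]
  have hr1 : r ^ 2 ≤ 1 := by nlinarith [sq_nonneg r]
  set L := List.ofFn fun j => P.varianceCLM (x j) (hsa j) with hL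
  have hLpos : ∀ η ∈ L, IsPositiveMap η := by
    intro η hη
    obtain ⟨j, rfl⟩ := (List.mem_ofFn' _ _).1 hη
    exact P.isPositiveMap_varianceCLM (hsa j)
  have hlaw' : P'.law a = dilation r
      ((L.map fun η : B →L[ℂ] B => (arcsineLaw η : Law B)).foldr monotoneConv diracZero) := by
    rw [hlaw, monotoneConvFamily, hL, List.map_ofFn]
    rfl
  have hA := P'.cauchy_eq_inverse_foldr_flow ha L hLpos hlaw' hδ hbδ
  set a₂ := P.alpha2 x with ha₂
  set a₄ := P.alpha4 x with ha₄
  have h2 : 0 ≤ a₂ := P.alpha2_nonneg x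
  set p := √a₂ with hp
  have hpp : p ^ 2 = a₂ := Real.sq_sqrt h2
  have hp0 : 0 ≤ p := Real.sqrt_nonneg _
  set t := √(3 / 2 : ℝ) with ht
  have htt : t ^ 2 = 3 / 2 := Real.sq_sqrt (by norm_num)
  have ht0 : 0 ≤ t := Real.sqrt_nonneg _
  have hsq : √(3 / 2 * a₂ ^ 2) = t * p ^ 2 := by
    rw [Real.sqrt_mul (by norm_num), Real.sqrt_sq h2, hpp]
  rw [hsq]
  -- The flow error is `t * (p * N * r)` times the second term of the claimed bound, so it is
  -- absorbed here. In the other case the right side exceeds the trivial bound `N`.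
  by_cases hcase : t * (p * N * r) ≤ 1
  · rw [hA]
    refine (h.norm_cauchy_sum_sub_le hsa hcent hr0.le hδ hbδ).trans ?_
    rw [inv_inv, ← ha₄, ← ha₂, ← hpp]
    have e : n * (r ^ 3 * (√(p ^ 2) * √a₄ * N ^ 4) + 3 / 2 * (p ^ 2) ^ 2 * N ^ 5 * (r ^ 2) ^ 2) =
        (n * r ^ 2) * (r * N ^ 4 * p * √a₄ + t ^ 2 * p ^ 4 * N ^ 5 * r ^ 2) := by
      rw [Real.sqrt_sq hp0, htt]; ring
    rw [e, hr2, one_mul]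
    have : t ^ 2 * p ^ 4 * N ^ 5 * r ^ 2 = (t * (p * N * r)) * (t * p ^ 3 * N ^ 4 * r) := by ring
    have h3 : t ^ 2 * p ^ 4 * N ^ 5 * r ^ 2 ≤ 1 * (t * p ^ 3 * N ^ 4 * r) := by
      rw [this]; gcongr
    linarith
  · push Not at hcase
    have d1 := P.norm_cauchy_add_le (a := r • ∑ j, x j) (by
      rw [IsSelfAdjoint, star_smul, star_trivial, star_sum]
      simp only [fun j => (hsa j).star_eq]) hδ hbδ
    have d2 := P'.norm_cauchy_add_le ha hδ hbδ
    have d3 : ‖P.cauchy (r • ∑ j, x j) b - P'.cauchy a b‖ ≤ N := by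
      have := (norm_sub_le _ _).trans (add_le_add d1 d2)
      rw [add_sub_add_right_eq_sub] at this
      refine this.trans (le_of_eq ?_)
      rw [mul_inv, inv_inv]; ring
    refine d3.trans ?_
    have h4 : p ^ 2 ≤ √a₄ := hpp ▸ P.alpha2_le_sqrt_alpha4 x hsa
    set z := p * N * r with hz
    have hz0 : 0 ≤ z := by positivity
    have hpN : z ^ 2 ≤ (p * N) ^ 2 := by
      rw [hz, mul_pow]
      exact mul_le_of_le_one_right (sq_nonneg _) hr1
    -- With `z = p N r` the claimed bound dominates `N (p N)² (z + t z)`, as `p² ≤ √α₄`. Since `z ≥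
    -- 1/t`, one has `z² ≥ 2/3` and `z + t z ≥ 3/2`.
    calc N ≤ N * (z ^ 2 * (z + t * z)) :=
          le_mul_of_one_le_right hN.le (one_le_sq_mul_add htt hz0 hcase.le)
      _ ≤ N * ((p * N) ^ 2 * (z + t * z)) := by gcongr
      _ = r * N ^ 4 * p * (p ^ 2 + t * p ^ 2) := by rw [hz]; ring
      _ ≤ _ := by gcongr

end BerryEsseen

/-! ### From Cauchy transforms to the Lévy distance. -/

section Levy

open Filter Topology MeasureTheory

theorem arctan_le_self {x : ℝ} (hx : 0 ≤ x) : Real.arctan x ≤ x := by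
  rcases hx.eq_or_lt with rfl | hx
  · simp
  · have := Real.lt_tan (Real.arctan_pos.2 hx) (Real.arctan_lt_pi_div_two x)
    rw [Real.tan_arctan] at this
    exact this.le

theorem le_arctan_of_le {y e u : ℝ} (hy : 0 < y) (he : 0 < e) (hu : e ≤ u) :
    Real.pi / 2 - y / e ≤ Real.arctan (u / y) := by
  have h1 : Real.arctan (y / e)⁻¹ = Real.pi / 2 - Real.arctan (y / e) :=
    Real.arctan_inv_of_pos (by positivity)
  rw [inv_div] at h1
  have h2 : Real.arctan (e / y) ≤ Real.arctan (u / y) := Real.arctan_mono (by gcongr)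
  have h3 := arctan_le_self (by positivity : 0 ≤ y / e)
  linarith

theorem hasDerivAt_arctan_div (u : ℝ) {v : ℝ} (hv : 0 < v) :
    HasDerivAt (fun v => Real.arctan (u / v)) (-(u / (u ^ 2 + v ^ 2))) v := by
  have h1 : HasDerivAt (fun v : ℝ => u / v) (-u / v ^ 2) v := by
    simpa [div_eq_mul_inv] using (hasDerivAt_inv hv.ne').const_mul u
  refine (h1.arctan).congr_deriv ?_
  have : 0 < u ^ 2 + v ^ 2 := by positivity
  field_simp
  ring

theorem abs_div_sq_add_sq_le (u : ℝ) {v : ℝ} (hv : 0 < v) : |u / (u ^ 2 + v ^ 2)| ≤ (2 * v)⁻¹ := by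
  have : 0 < u ^ 2 + v ^ 2 := by positivity
  rw [abs_div, abs_of_pos this, div_le_iff₀ this, ← sq_abs u, inv_mul_eq_div,
    le_div_iff₀ (by positivity)]
  nlinarith [sq_nonneg (|u| - v)]

theorem continuous_arctan_sub_div (t y : ℝ) : Continuous fun x : ℝ => Real.arctan ((t - x) / y) :=
  Real.continuous_arctan.comp (by fun_prop)

theorem integrable_arctan_sub_div (μ : Measure ℝ) [IsFiniteMeasure μ] (t y : ℝ) :
    Integrable (fun x => Real.arctan ((t - x) / y)) μ := by
  refine Integrable.of_bound (continuous_arctan_sub_div t y).aestronglyMeasurable (Real.pi / 2)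
    (Eventually.of_forall fun x => ?_)
  rw [Real.norm_eq_abs, abs_le]
  exact ⟨(Real.neg_pi_div_two_lt_arctan _).le, (Real.arctan_lt_pi_div_two _).le⟩

/-- The `v`-derivative of `arctan((t - x)/v)` is minus the real part of the Cauchy kernel at `t +
iv`. Near `v` it is dominated by a constant. -/
theorem hasDerivAt_integral_arctan (μ : Measure ℝ) [IsFiniteMeasure μ] (t : ℝ) {v : ℝ}
    (hv : 0 < v) : HasDerivAt (fun v => ∫ x, Real.arctan ((t - x) / v) ∂μ)
      (-∫ x, (t - x) / ((t - x) ^ 2 + v ^ 2) ∂μ) v := by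
  have hs : Set.Ioi (v / 2) ∈ 𝓝 v := Ioi_mem_nhds (by linarith)
  have key := (hasDerivAt_integral_of_dominated_loc_of_deriv_le (μ := μ)
    (F := fun v x => Real.arctan ((t - x) / v))
    (F' := fun v x => -((t - x) / ((t - x) ^ 2 + v ^ 2))) (bound := fun _ => v⁻¹) hs
    (Eventually.of_forall fun w => (continuous_arctan_sub_div t w).aestronglyMeasurable)
    (integrable_arctan_sub_div μ t v)
    (by
      refine Continuous.aestronglyMeasurable (Continuous.neg ?_)
      refine Continuous.div (by fun_prop) (by fun_prop) fun x => ?_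
      positivity)
    (Eventually.of_forall fun x w hw => by
      have hw : v / 2 < w := hw
      rw [norm_neg, Real.norm_eq_abs]
      refine (abs_div_sq_add_sq_le _ (by linarith)).trans ?_
      gcongr
      linarith)
    (integrable_const _)
    (Eventually.of_forall fun x w hw => hasDerivAt_arctan_div _ (by
      have hw : v / 2 < w := hw
      linarith))).2
  rwa [integral_neg] at key

theorem tendsto_integral_arctan (μ : Measure ℝ) [IsFiniteMeasure μ] (t : ℝ) :
    Tendsto (fun v => ∫ x, Real.arctan ((t - x) / v) ∂μ) atTop (𝓝 0) := by
  have := tendsto_integral_filter_of_dominated_convergence (μ := μ) (l := (atTop : Filter ℝ))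
    (F := fun v x => Real.arctan ((t - x) / v)) (f := fun _ => 0) (fun _ => Real.pi / 2)
    (Eventually.of_forall fun w => (continuous_arctan_sub_div t w).aestronglyMeasurable)
    (Eventually.of_forall fun w => Eventually.of_forall fun x => by
      rw [Real.norm_eq_abs, abs_le]
      exact ⟨(Real.neg_pi_div_two_lt_arctan _).le, (Real.arctan_lt_pi_div_two _).le⟩)
    (integrable_const _)
    (Eventually.of_forall fun x => by
      have h : Tendsto (fun v : ℝ => (t - x) / v) atTop (𝓝 0) :=
        tendsto_const_nhds.div_atTop tendsto_id
      have := (Real.continuous_arctan.tendsto 0).comp h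
      rwa [Real.arctan_zero] at this)
  simpa using this

/-- Integration of a bound for Cauchy transforms over a vertical half line. -/
theorem integral_arctan_le {μ ν : Measure ℝ} [IsFiniteMeasure μ] [IsFiniteMeasure ν] {t D : ℝ}
    (h : ∀ v > 0, ∫ x, (t - x) / ((t - x) ^ 2 + v ^ 2) ∂μ -
      ∫ x, (t - x) / ((t - x) ^ 2 + v ^ 2) ∂ν ≤ D * v⁻¹ ^ 4) {y : ℝ} (hy : 0 < y) :
    ∫ x, Real.arctan ((t - x) / y) ∂μ ≤ ∫ x, Real.arctan ((t - x) / y) ∂ν + D / 3 * y⁻¹ ^ 3 := by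
  -- The correction is chosen so that the hypothesis makes `f` nondecreasing; as `f` tends to `0` at
  -- infinity, `f ≤ 0`.
  set f : ℝ → ℝ := fun v => ∫ x, Real.arctan ((t - x) / v) ∂μ -
    ∫ x, Real.arctan ((t - x) / v) ∂ν - D / 3 * v⁻¹ ^ 3 with hf
  have hd : ∀ v, 0 < v → HasDerivAt f (-∫ x, (t - x) / ((t - x) ^ 2 + v ^ 2) ∂μ -
      -∫ x, (t - x) / ((t - x) ^ 2 + v ^ 2) ∂ν + D * v⁻¹ ^ 4) v := by
    intro v hv
    have h1 := ((hasDerivAt_integral_arctan μ t hv).sub (hasDerivAt_integral_arctan ν t hv)).sub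
      (((hasDerivAt_inv hv.ne').pow 3).const_mul (D / 3))
    refine h1.congr_deriv ?_
    push_cast
    field_simp
    ring
  have hmono : MonotoneOn f (Set.Ici y) := by
    refine monotoneOn_of_deriv_nonneg (convex_Ici y)
      (fun v hv => (hd v (hy.trans_le hv)).continuousAt.continuousWithinAt)
      (fun v hv => ?_) fun v hv => ?_
    · rw [interior_Ici] at hv
      exact (hd v (hy.trans hv)).differentiableAt.differentiableWithinAt
    · rw [interior_Ici] at hv
      rw [(hd v (hy.trans hv)).deriv]
      linarith [h v (hy.trans hv)]
  have hlim : Tendsto f atTop (𝓝 0) := by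
    have h3 : Tendsto (fun v : ℝ => D / 3 * v⁻¹ ^ 3) atTop (𝓝 (D / 3 * 0 ^ 3)) :=
      (tendsto_inv_atTop_zero.pow 3).const_mul _
    simpa [hf] using ((tendsto_integral_arctan μ t).sub (tendsto_integral_arctan ν t)).sub h3
  have : f y ≤ 0 := ge_of_tendsto hlim (eventually_atTop.2 ⟨y, fun v hv =>
    hmono Set.self_mem_Ici hv hv⟩)
  simp only [hf] at this
  linarith

/-- Up to an error `y/e` outside the `e`-neighbourhood of `t`, `arctan((t - x)/y)` is `π` times the
indicator of `x ≤ t`, minus `π/2`. Integrating against both measures and dividing by `π > 3` gives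
the claim. -/
theorem measureReal_Iic_le_of_cauchy {μ ν : Measure ℝ} [IsProbabilityMeasure μ]
    [IsProbabilityMeasure ν] {t D : ℝ} (hD : 0 ≤ D)
    (h : ∀ v > 0, ∫ x, (t - x) / ((t - x) ^ 2 + v ^ 2) ∂μ -
      ∫ x, (t - x) / ((t - x) ^ 2 + v ^ 2) ∂ν ≤ D * v⁻¹ ^ 4) {y e : ℝ} (hy : 0 < y) (he : 0 < e) :
    μ.real (Set.Iic (t - e)) ≤ ν.real (Set.Iic (t + e)) + (2 * (y / e) + D * y⁻¹ ^ 3) := by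
  have hπ := Real.pi_gt_three
  have h1 := integral_arctan_le h hy
  have hk0 : 0 ≤ y⁻¹ ^ 3 := by positivity
  generalize y⁻¹ ^ 3 = k at h1 hk0 ⊢
  have m1 : Real.pi * μ.real (Set.Iic (t - e)) - (Real.pi / 2 + y / e) ≤
      ∫ x, Real.arctan ((t - x) / y) ∂μ := by
    have : ∫ x, ((Set.Iic (t - e)).indicator (fun _ => Real.pi) x - (Real.pi / 2 + y / e)) ∂μ ≤
        ∫ x, Real.arctan ((t - x) / y) ∂μ := by
      refine integral_mono (((integrable_const _).indicator measurableSet_Iic).sub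
        (integrable_const _)) (integrable_arctan_sub_div μ t y) fun x => ?_
      by_cases hx : x ∈ Set.Iic (t - e)
      · simp only [Set.indicator_of_mem hx]
        have : x ≤ t - e := hx
        linarith [le_arctan_of_le hy he (show e ≤ t - x by linarith)]
      · simp only [Set.indicator_of_notMem hx]
        have := Real.neg_pi_div_two_lt_arctan ((t - x) / y)
        have : 0 < y / e := by positivity
        linarith
    rw [integral_sub ((integrable_const _).indicator measurableSet_Iic) (integrable_const _),
      integral_indicator_const _ measurableSet_Iic] at this
    simp only [integral_const, probReal_univ, smul_eq_mul, one_mul] at this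
    linarith
  have m2 : ∫ x, Real.arctan ((t - x) / y) ∂ν ≤
      Real.pi * ν.real (Set.Iic (t + e)) - (Real.pi / 2 - y / e) := by
    have : ∫ x, Real.arctan ((t - x) / y) ∂ν ≤
        ∫ x, ((Set.Iic (t + e)).indicator (fun _ => Real.pi) x - (Real.pi / 2 - y / e)) ∂ν := by
      refine integral_mono (integrable_arctan_sub_div ν t y)
        (((integrable_const _).indicator measurableSet_Iic).sub (integrable_const _)) fun x => ?_
      by_cases hx : x ∈ Set.Iic (t + e)
      · simp only [Set.indicator_of_mem hx]
        have := Real.arctan_lt_pi_div_two ((t - x) / y)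
        have : 0 < y / e := by positivity
        linarith
      · simp only [Set.indicator_of_notMem hx]
        have hx' : t + e < x := not_le.1 hx
        have := le_arctan_of_le hy he (show e ≤ x - t by linarith)
        have e2 : (t - x) / y = -((x - t) / y) := by ring
        rw [e2, Real.arctan_neg]
        linarith
    rw [integral_sub ((integrable_const _).indicator measurableSet_Iic) (integrable_const _),
      integral_indicator_const _ measurableSet_Iic] at this
    simp only [integral_const, probReal_univ, smul_eq_mul, one_mul] at this
    linarith
  have q1 : 0 ≤ y / e := by positivity
  have q2 : 0 ≤ D * k := by positivity
  have q3 := mul_le_mul_of_nonneg_right hπ.le (by positivity : 0 ≤ 2 * (y / e) + D * k)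
  refine le_of_mul_le_mul_left ?_ Real.pi_pos
  linarith

/-- Smoothing at height `y = z²` and tolerance `e = z` makes the error `y/e` comparable to the
shift. The comparison is centred at `t ∓ z`, so the total shift is `2z`. -/
theorem levyDist_le_of_cauchy {μ ν : Measure ℝ} [IsProbabilityMeasure μ] [IsProbabilityMeasure ν]
    {D : ℝ} (hD : 0 ≤ D)
    (h : ∀ t, ∀ v > 0, |∫ x, (t - x) / ((t - x) ^ 2 + v ^ 2) ∂μ -
      ∫ x, (t - x) / ((t - x) ^ 2 + v ^ 2) ∂ν| ≤ D * v⁻¹ ^ 4) {z : ℝ} (hz : 0 < z) :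
    levyDist μ ν ≤ 2 * z + D * (z ^ 2)⁻¹ ^ 3 := by
  have hq : 0 ≤ D * (z ^ 2)⁻¹ ^ 3 := by positivity
  have hyz : 2 * (z ^ 2 / z) = 2 * z := by field_simp
  refine csInf_le ⟨0, fun e he => he.1.le⟩ ⟨by positivity, fun t => ⟨?_, ?_⟩⟩
  · have h1 := measureReal_Iic_le_of_cauchy hD
      (fun v hv => (abs_le.1 (h (t - z) v hv)).2) (y := z ^ 2) (by positivity) hz
    rw [hyz, sub_add_cancel] at h1
    generalize D * (z ^ 2)⁻¹ ^ 3 = q at h1 hq ⊢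
    have h2 : μ.real (Set.Iic (t - (2 * z + q))) ≤ μ.real (Set.Iic (t - z - z)) :=
      measureReal_mono (Set.Iic_subset_Iic.2 (by linarith))
    exact sub_le_iff_le_add.2 (h2.trans h1)
  · have h1 := measureReal_Iic_le_of_cauchy (μ := ν) (ν := μ) hD
      (fun v hv => by have := (abs_le.1 (h (t + z) v hv)).1; linarith) (y := z ^ 2)
        (by positivity) hz
    rw [hyz, add_sub_cancel_right] at h1
    have h2 : μ.real (Set.Iic (t + z + z)) ≤ μ.real (Set.Iic (t + (2 * z + D * (z ^ 2)⁻¹ ^ 3))) :=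
      measureReal_mono (Set.Iic_subset_Iic.2 (by linarith))
    linarith

/-- Smoothing inequality: a bound of order `v⁻⁴` for the difference of two Cauchy transforms at
height `v` bounds the Lévy distance. -/
theorem levyDist_le_rpow {μ ν : Measure ℝ} [IsProbabilityMeasure μ] [IsProbabilityMeasure ν]
    {D : ℝ} (hD : 0 ≤ D)
    (h : ∀ t, ∀ v > 0, |∫ x, (t - x) / ((t - x) ^ 2 + v ^ 2) ∂μ -
      ∫ x, (t - x) / ((t - x) ^ 2 + v ^ 2) ∂ν| ≤ D * v⁻¹ ^ 4) :
    levyDist μ ν ≤ 3 * D ^ (1 / 7 : ℝ) := by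
  rcases hD.eq_or_lt with rfl | hD'
  · rw [Real.zero_rpow (by norm_num), mul_zero]
    refine le_of_forall_pos_le_add fun e he => ?_
    have := levyDist_le_of_cauchy hD h (z := e / 2) (by positivity)
    linarith
  -- This choice balances `2z` against `D z⁻⁶`, which then equals `z`.
  · set z := D ^ (1 / 7 : ℝ) with hz
    have hz0 : 0 < z := Real.rpow_pos_of_pos hD' _
    have hz7 : z ^ 7 = D := by
      rw [hz, ← Real.rpow_natCast, ← Real.rpow_mul hD]
      norm_num
    refine (levyDist_le_of_cauchy hD h hz0).trans (le_of_eq ?_)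
    rw [← hz7]
    field_simp
    ring

end Levy

/-! ### The measure `μ_a` and the real part of its Cauchy transform. -/

section ScalarLaw

open Filter Topology MeasureTheory

variable {A : Type v} [CStarAlgebra A] [PartialOrder A] [StarOrderedRing A]

/-- A continuous function which is `1` on `[-R, R]` and vanishes outside of `[-R - 1, R + 1]`. -/
noncomputable def cutoff (R : ℝ) (x : ℝ) : ℝ := max 0 (min 1 (R + 1 - |x|))

theorem continuous_cutoff (R : ℝ) : Continuous (cutoff R) := by
  unfold cutoff
  fun_prop

theorem cutoff_nonneg (R x : ℝ) : 0 ≤ cutoff R x := le_max_left _ _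

theorem cutoff_le_one (R x : ℝ) : cutoff R x ≤ 1 := max_le zero_le_one (min_le_left _ _)

theorem cutoff_eq_one {R x : ℝ} (h : |x| ≤ R) : cutoff R x = 1 := by
  rw [cutoff, min_eq_left (by linarith), max_eq_right zero_le_one]

theorem hasCompactSupport_cutoff (R : ℝ) : HasCompactSupport (cutoff R) := by
  refine HasCompactSupport.intro (isCompact_Icc (a := -(R + 1)) (b := R + 1)) fun x hx => ?_
  rw [Set.mem_Icc, ← abs_le, not_le] at hx
  rw [cutoff, min_eq_right (by linarith [abs_nonneg x]), max_eq_left (by linarith)]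

/-- The product of a continuous function and a cutoff. -/
noncomputable def cutoffMul (f : C(ℝ, ℝ)) (R : ℝ) : C_c(ℝ, ℝ) where
  toFun x := f x * cutoff R x
  continuous_toFun := f.continuous.mul (continuous_cutoff R)
  hasCompactSupport' := (hasCompactSupport_cutoff R).mul_left

/-- The cutoff is `1` on the spectrum of `a`, so the functional, defined only for compact support,
reaches all continuous functions. -/
theorem functionalOf_cutoffMul (P : OVSpace ℂ A) (a : A) (f : C(ℝ, ℝ)) {R : ℝ}
    (hR : ‖a‖ * ‖(1 : A)‖ ≤ R) : functionalOf P a (cutoffMul f R) = (P.E (cfc f a)).re := by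
  have h : cfc (⇑(cutoffMul f R)) a = cfc f a := by
    refine cfc_congr fun x hx => ?_
    have h1 : |x| ≤ R := (spectrum.norm_le_norm_mul_of_mem hx).trans hR
    change f x * cutoff R x = f x
    rw [cutoff_eq_one h1, mul_one]
  rw [← h]
  rfl

theorem functionalOf_cutoff (P : OVSpace ℂ A) {a : A} (ha : IsSelfAdjoint a) {R : ℝ}
    (hR : ‖a‖ * ‖(1 : A)‖ ≤ R) : functionalOf P a (cutoffMul 1 R) = 1 := by
  rw [functionalOf_cutoffMul P a 1 hR]
  have : cfc (⇑(1 : C(ℝ, ℝ))) a = 1 := cfc_const_one ℝ a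
  rw [this, P.E_one, Complex.one_re]

theorem isProbabilityMeasure_scalarLaw (P : OVSpace ℂ A) {a : A} (ha : IsSelfAdjoint a) :
    IsProbabilityMeasure (scalarLaw P a) := by
  refine ⟨le_antisymm ?_ ?_⟩
  · rw [scalarLaw, isOpen_univ.measure_eq_iSup_isCompact]
    refine iSup₂_le fun K _ => iSup_le fun hK => ?_
    obtain ⟨r, hr⟩ := hK.isBounded.subset_closedBall 0
    set R := max r (‖a‖ * ‖(1 : A)‖) with hR
    have h1 := RealRMK.rieszMeasure_le_of_eq_one (functionalOf P a) (f := cutoffMul 1 R)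
      (fun x => mul_nonneg zero_le_one (cutoff_nonneg R x)) hK fun x hx => by
        have h2 := hr hx
        rw [mem_closedBall_zero_iff, Real.norm_eq_abs] at h2
        change 1 * cutoff R x = 1
        rw [cutoff_eq_one (h2.trans (le_max_left _ _)), mul_one]
    rwa [functionalOf_cutoff P ha (le_max_right _ _), ENNReal.ofReal_one] at h1
  · have h1 := RealRMK.le_rieszMeasure_tsupport_subset (functionalOf P a)
      (f := cutoffMul 1 (‖a‖ * ‖(1 : A)‖))
      (fun x => ⟨mul_nonneg zero_le_one (cutoff_nonneg _ x), by
        change 1 * cutoff _ x ≤ 1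
        rw [one_mul]
        exact cutoff_le_one _ x⟩) (Set.subset_univ _)
    rwa [functionalOf_cutoff P ha le_rfl, ENNReal.ofReal_one] at h1

theorem integral_scalarLaw (P : OVSpace ℂ A) {a : A} (ha : IsSelfAdjoint a) (f : C(ℝ, ℝ)) :
    ∫ x, f x ∂(scalarLaw P a) = (P.E (cfc f a)).re := by
  have := isProbabilityMeasure_scalarLaw P ha
  set R := ‖a‖ * ‖(1 : A)‖ with hR
  have hint : ∀ g : C(ℝ, ℝ), ∫ x, g x * cutoff R x ∂(scalarLaw P a) = (P.E (cfc g a)).re :=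
    fun g => by
      rw [← functionalOf_cutoffMul P a g le_rfl]
      exact RealRMK.integral_rieszMeasure (functionalOf P a) (cutoffMul g R)
  have h1 : ∫ x, cutoff R x ∂(scalarLaw P a) = 1 := by
    have := (hint 1).trans ((functionalOf_cutoffMul P a 1 le_rfl).symm.trans
      (functionalOf_cutoff P ha le_rfl))
    simpa using this
  have hci : Integrable (cutoff R) (scalarLaw P a) :=
    Integrable.of_bound (continuous_cutoff R).aestronglyMeasurable 1
      (Eventually.of_forall fun x => by
        rw [Real.norm_of_nonneg (cutoff_nonneg R x)]; exact cutoff_le_one R x)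
  -- The cutoff is at most `1` and has integral `1` against a probability measure, so it equals `1`
  -- almost everywhere.
  have h2 : ∀ᵐ x ∂(scalarLaw P a), 1 - cutoff R x = 0 := by
    refine (integral_eq_zero_iff_of_nonneg (fun x => sub_nonneg.2 (cutoff_le_one R x))
      ((integrable_const 1).sub hci)).1 ?_
    rw [integral_sub (integrable_const 1) hci, h1]
    simp
  rw [← hint f]
  refine integral_congr_ae ?_
  filter_upwards [h2] with x hx
  rw [← sub_eq_zero.1 hx, mul_one]

theorem coe_imaginaryPart_complex (z : ℂ) : (ℑ z : ℂ) = z.im := by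
  refine imaginaryPart_eq_of_sub_star ?_
  rw [Complex.star_def, Complex.sub_conj, smul_eq_mul]
  push_cast
  ring

theorem mem_halfSpace_complex (t v : ℝ) : (t + v * Complex.I : ℂ) ∈ halfSpace ℂ v := by
  rw [mem_halfSpace_iff, coe_imaginaryPart_complex]
  simp

theorem mem_upperHalfPlane_complex (t : ℝ) {v : ℝ} (hv : 0 < v) :
    (t + v * Complex.I : ℂ) ∈ upperHalfPlane ℂ := by
  change IsStrictlyPositive _
  rw [coe_imaginaryPart_complex, IsStrictlyPositive.iff_of_unital]
  have : (t + v * Complex.I : ℂ).im = v := by simp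
  rw [this]
  exact ⟨by exact_mod_cast hv.le, (Complex.ofReal_ne_zero.2 hv.ne').isUnit⟩

/-- With `U = t - a`, the functional calculus gives `U f + v g = 1` and `U g = v f`, that is `(U +
iv)(f - ig) = 1`. As `φ(g)` is real, the real part of the transform is `φ(f)`. -/
theorem re_cauchy_eq_integral (P : OVSpace ℂ A) {a : A} (ha : IsSelfAdjoint a) (t : ℝ) {v : ℝ}
    (hv : 0 < v) : (P.cauchy a (t + v * Complex.I)).re =
      ∫ x, (t - x) / ((t - x) ^ 2 + v ^ 2) ∂(scalarLaw P a) := by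
  have hden : ∀ x : ℝ, (t - x) ^ 2 + v ^ 2 ≠ 0 := fun x => by positivity
  set f : C(ℝ, ℝ) := ⟨fun x => (t - x) / ((t - x) ^ 2 + v ^ 2),
    Continuous.div (by fun_prop) (by fun_prop) hden⟩ with hf
  set g : C(ℝ, ℝ) := ⟨fun x => v / ((t - x) ^ 2 + v ^ 2),
    Continuous.div (by fun_prop) (by fun_prop) hden⟩ with hg
  set U := cfc (fun x : ℝ => t - x) a with hU
  have hUa : U = algebraMap ℝ A t - a := by
    rw [hU, cfc_sub .., cfc_const t a, cfc_id' ℝ a]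
  have h1 : U * cfc f a + v • cfc g a = 1 := by
    rw [hU, ← cfc_mul .., ← cfc_smul .., ← cfc_add .., ← cfc_const_one ℝ a]
    refine cfc_congr fun x _ => ?_
    simp only [hf, hg, ContinuousMap.coe_mk, smul_eq_mul]
    field_simp [hden x]
  have h2 : U * cfc g a = v • cfc f a := by
    rw [hU, ← cfc_mul .., ← cfc_smul ..]
    refine cfc_congr fun x _ => ?_
    simp only [hf, hg, ContinuousMap.coe_mk, smul_eq_mul]
    ring
  have hincl : P.incl (t + v * Complex.I) - a = U + (v * Complex.I : ℂ) • 1 := by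
    have : ∀ z : ℂ, P.incl z = z • 1 := fun z => by
      rw [← map_one P.incl, ← map_smul, smul_eq_mul, mul_one]
    rw [this, hUa, add_smul, Algebra.algebraMap_eq_smul_one, Complex.coe_smul]
    abel
  have hmul : (P.incl (t + v * Complex.I) - a) * (cfc f a - Complex.I • cfc g a) = 1 := by
    rw [hincl, add_mul, mul_sub, mul_smul_comm, h2, smul_mul_assoc, one_mul, smul_sub, smul_smul,
      mul_assoc, Complex.I_mul_I, ← h1, ← Complex.coe_smul, ← Complex.coe_smul, smul_smul,
      mul_comm (v : ℂ) Complex.I, mul_neg_one, neg_smul]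
    abel
  have hunit : IsUnit (P.incl (t + v * Complex.I) - a) := by
    refine isUnit_of_mem_halfSpace hv (P.incl_sub_mem_halfSpace (mem_halfSpace_complex t v) ha)
  have hres : P.resolvent a (t + v * Complex.I) = cfc f a - Complex.I • cfc g a := by
    calc _ = (P.incl (t + v * Complex.I) - a)⁻¹ʳ * ((P.incl (t + v * Complex.I) - a) *
          (cfc f a - Complex.I • cfc g a)) := by rw [hmul, mul_one]; rfl
      _ = _ := by rw [← mul_assoc, Ring.inverse_mul_cancel _ hunit, one_mul]
  have him : (P.E (cfc g a)).im = 0 := by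
    have h3 : star (P.E (cfc g a)) = P.E (cfc g a) := by
      rw [← P.E_star, (cfc_predicate (R := ℝ) (p := IsSelfAdjoint) g a).star_eq]
    exact Complex.conj_eq_iff_im.1 h3
  have hlast := integral_scalarLaw P ha f
  rw [OVSpace.cauchy, hres, map_sub, map_smul, Complex.sub_re, smul_eq_mul, Complex.I_mul_re, him,
    neg_zero, sub_zero, ← hlast]
  rfl

end ScalarLaw

/-! ### The scalar bound. -/

section ScalarBerryEsseen

variable {A : Type v} [CStarAlgebra A] [PartialOrder A] [StarOrderedRing A]

theorem OVSpace.alpha4_eq_alpha4Tilde (P : OVSpace ℂ A) {n : ℕ} (x : Fin n → A) :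
    P.alpha4 x = P.alpha4Tilde x := by
  have : Nonempty (Metric.sphere (0 : ℂ) 1) := ⟨⟨1, by simp⟩⟩
  have hincl : ∀ z : ℂ, P.incl z = z • 1 := fun z => by
    rw [← map_one P.incl, ← map_smul, smul_eq_mul, mul_one]
  refine iSup_congr fun i => ?_
  have h : ∀ b : Metric.sphere (0 : ℂ) 1,
      ‖P.E (x i * star (P.incl b) * x i ^ 2 * P.incl b * x i)‖ = ‖P.E (x i ^ 4)‖ := by
    intro b
    have hb : ‖(b : ℂ)‖ = 1 := mem_sphere_zero_iff_norm.1 b.2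
    rw [hincl, star_smul, star_one]
    simp only [mul_smul_comm, smul_mul_assoc, mul_one, map_smul, norm_smul, norm_star, hb, one_mul]
    congr 2
    noncomm_ring
  simp only [h, ciSup_const]

/-- `D^(1/7) = (D²)^(1/14)`, and squaring removes the roots through `(p + q)² ≤ 2 (p² + q²)`. The
factor `2^(1/14)` is rounded up to `2`. -/
theorem sqrt_mul_add_rpow_le {a c m : ℝ} (ha : 0 ≤ a) (hc : 0 ≤ c) (hm : 0 < m) :
    (1 / √m * √a * (√c + √(3 / 2 * a ^ 2))) ^ (1 / 7 : ℝ) ≤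
      2 * (a * (c + 3 / 2 * a ^ 2)) ^ (1 / 14 : ℝ) * m ^ (-(1 / 14) : ℝ) := by
  set D := 1 / √m * √a * (√c + √(3 / 2 * a ^ 2)) with hD
  set W := a * (c + 3 / 2 * a ^ 2) with hW
  have hD0 : 0 ≤ D := by positivity
  have hW0 : 0 ≤ W := by positivity
  have h1 : D ^ 2 ≤ 2 * W * m⁻¹ := by
    have e1 := Real.sq_sqrt hc
    have e2 := Real.sq_sqrt (by positivity : 0 ≤ 3 / 2 * a ^ 2)
    have h2 : (√c + √(3 / 2 * a ^ 2)) ^ 2 ≤ 2 * (c + 3 / 2 * a ^ 2) := by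
      nlinarith [sq_nonneg (√c - √(3 / 2 * a ^ 2))]
    rw [hD, mul_pow, mul_pow, div_pow, Real.sq_sqrt hm.le, Real.sq_sqrt ha, one_pow]
    calc _ ≤ 1 / m * a * (2 * (c + 3 / 2 * a ^ 2)) := by gcongr
      _ = _ := by rw [hW]; ring
  have h2 : D ^ (1 / 7 : ℝ) = (D ^ 2) ^ (1 / 14 : ℝ) := by
    rw [← Real.rpow_natCast D 2, ← Real.rpow_mul hD0]
    norm_num
  have h3 : (2 : ℝ) ^ (1 / 14 : ℝ) ≤ 2 := by
    calc (2 : ℝ) ^ (1 / 14 : ℝ) ≤ 2 ^ (1 : ℝ) :=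
          Real.rpow_le_rpow_of_exponent_le (by norm_num) (by norm_num)
      _ = 2 := Real.rpow_one 2
  rw [h2]
  calc (D ^ 2) ^ (1 / 14 : ℝ) ≤ (2 * W * m⁻¹) ^ (1 / 14 : ℝ) := by gcongr
    _ = 2 ^ (1 / 14 : ℝ) * W ^ (1 / 14 : ℝ) * m ^ (-(1 / 14) : ℝ) := by
      rw [Real.mul_rpow (by positivity) (by positivity), Real.mul_rpow (by positivity) hW0,
        Real.inv_rpow hm.le, Real.rpow_neg hm.le]
    _ ≤ _ := by gcongr

/-- The Berry-Esseen bound for the Lévy distance in the scalar case. -/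
theorem OVSpace.MonotoneIndep.levyDist_arcsine_le {A' : Type*} [CStarAlgebra A']
    [PartialOrder A'] [StarOrderedRing A'] {P : OVSpace ℂ A} {n : ℕ} {x : Fin n → A}
    (h : P.MonotoneIndep x) (hn : 1 ≤ n) (hsa : ∀ i, IsSelfAdjoint (x i))
    (hcent : ∀ i, P.E (x i) = 0) {P' : OVSpace ℂ A'} {a : A'} (ha : IsSelfAdjoint a)
    (hlaw : P'.law a = dilation (1 / √(n : ℝ))
        (monotoneConvFamily fun j => arcsineLaw (P.variance (x j)))) :
    levyDist (scalarLaw P ((1 / √(n : ℝ)) • ∑ j, x j)) (scalarLaw P' a) ≤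
      6 * (P.alpha2 x * (P.alpha4Tilde x + 3 / 2 * P.alpha2 x ^ 2)) ^ (1 / 14 : ℝ) *
        (n : ℝ) ^ (-(1 / 14) : ℝ) := by
  have hX : IsSelfAdjoint ((1 / √(n : ℝ)) • ∑ j, x j) := by
    rw [IsSelfAdjoint, star_smul, star_trivial, star_sum]
    simp only [fun j => (hsa j).star_eq]
  have := isProbabilityMeasure_scalarLaw P hX
  have := isProbabilityMeasure_scalarLaw P' ha
  have h2 := P.alpha2_nonneg x
  have h4 := P.alpha4_nonneg x
  have hn' : (0 : ℝ) < n := by exact_mod_cast hn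
  refine (levyDist_le_rpow
    (D := 1 / √(n : ℝ) * √(P.alpha2 x) * (√(P.alpha4 x) + √(3 / 2 * P.alpha2 x ^ 2)))
    (by positivity) fun t v hv => ?_).trans ?_
  · rw [← re_cauchy_eq_integral P hX t hv, ← re_cauchy_eq_integral P' ha t hv, ← Complex.sub_re]
    refine (Complex.abs_re_le_norm _).trans ((h.norm_cauchy_sub_arcsine_le hn hsa hcent ha hlaw
      (mem_upperHalfPlane_complex t hv)).trans (le_of_eq ?_))
    have hi : ‖Ring.inverse (imaginaryPart (t + v * Complex.I : ℂ) : ℂ)‖ = v⁻¹ := by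
      have : (t + v * Complex.I : ℂ).im = v := by simp
      rw [coe_imaginaryPart_complex, this, Ring.inverse_eq_inv', norm_inv, Complex.norm_real,
        Real.norm_of_nonneg hv.le]
    rw [hi]
    ring
  · rw [← P.alpha4_eq_alpha4Tilde]
    linarith [sqrt_mul_add_rpow_le h2 h4 hn']

end ScalarBerryEsseen

end OVProb

theorem theorem4p3 :
    (∀ (B : Type*) [CStarAlgebra B] [PartialOrder B] [StarOrderedRing B]
      (A : Type*) [CStarAlgebra A] [PartialOrder A] [StarOrderedRing A]
      (A' : Type*) [CStarAlgebra A'] [PartialOrder A'] [StarOrderedRing A']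
      (P : OVSpace B A) (P' : OVSpace B A') (n : ℕ) (_hn : 1 ≤ n) (x : Fin n → A)
      (_hsa : ∀ j, IsSelfAdjoint (x j)) (_hcent : ∀ j, P.E (x j) = 0)
      (_hind : P.MonotoneIndep x)
      (An : A') (_hAn : IsSelfAdjoint An)
      (_hlaw : P'.law An = dilation (1 / √(n : ℝ))
        (monotoneConvFamily fun j => arcsineLaw (P.variance (x j)))),
      ∀ b ∈ upperHalfPlane B,
        ‖P.cauchy ((1 / √(n : ℝ)) • ∑ j, x j) b - P'.cauchy An b‖ ≤
          1 / √(n : ℝ) * ‖Ring.inverse (imaginaryPart b : B)‖ ^ 4 * √(P.alpha2 x) *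
            (√(P.alpha4 x) + √(3 / 2 * P.alpha2 x ^ 2))) ∧
    (∃ c : ℝ, 0 < c ∧
      ∀ (A : Type*) [CStarAlgebra A] [PartialOrder A] [StarOrderedRing A]
        (A' : Type*) [CStarAlgebra A'] [PartialOrder A'] [StarOrderedRing A']
        (P : OVSpace ℂ A) (P' : OVSpace ℂ A') (n : ℕ) (_hn : 1 ≤ n) (x : Fin n → A)
        (_hsa : ∀ j, IsSelfAdjoint (x j)) (_hcent : ∀ j, P.E (x j) = 0)
        (_hind : P.MonotoneIndep x)
        (An : A') (_hAn : IsSelfAdjoint An)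
        (_hlaw : P'.law An = dilation (1 / √(n : ℝ))
          (monotoneConvFamily fun j => arcsineLaw (P.variance (x j)))),
        levyDist (scalarLaw P ((1 / √(n : ℝ)) • ∑ j, x j)) (scalarLaw P' An) ≤
          c * (P.alpha2 x * (P.alpha4Tilde x + 3 / 2 * P.alpha2 x ^ 2)) ^ (1 / 14 : ℝ) *
            (n : ℝ) ^ (-(1 / 14) : ℝ)) := by
  -- The constant is the product of `3` from `levyDist_le_rpow` and `2` from `sqrt_mul_add_rpow_le`.
  refine ⟨?_, 6, by norm_num, ?_⟩
  · intro B _ _ _ A _ _ _ A' _ _ _ P P' n hn x hsa hcent hind a ha hlaw b hb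
    exact hind.norm_cauchy_sub_arcsine_le hn hsa hcent ha hlaw hb
  · intro A _ _ _ A' _ _ _ P P' n hn x hsa hcent hind a ha hlaw
    exact hind.levyDist_arcsine_le hn hsa hcent ha hlaw
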